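/- Let $d\ge 1$, let $\Theta\subset\mathbb{R}^d$ be compact, let $\alpha\in(0,1)$, and let $(\ell(\cdot\mid\theta))_\theta$ be probability densities with respect to a $\sigma$-finite measure $\mu$ on a measurable space $\mathcal{Y}$, jointly measurable in $(\theta,y)$ and defined for $\theta$ in an open set $U\supset\Theta$. Assume the following regularity. (i) For $\mu$-a.e. $y$, either $\ell(y\mid\theta)>0$ for all $\theta\in U$ or $\ell(y\mid\theta)=0$ for all $\theta\in U$; in the first case $\theta\mapsto\log\ell(y\mid\theta)$ is $C^2$ on $U$. (ii) Every $\theta_0\in\Theta$ is the centre of a ball $B\subset U$ for which there is a $\mu$-integrable $H$ such that, for $\mu$-a.e. $y$ with $\ell(y\mid\cdot)>0$ on $U$, $\big(1+\|\nabla_\theta\log\ell(y\mid\theta')\|^2+\|\nabla^2_\theta\log\ell(y\mid\theta')\|\big)\,\ell(y\mid\theta)\le H(y)$ for all $\theta,\theta'\in B$, and $H\ge 0$. (iii) If $\theta,\theta'\in\Theta$ and $\ell(\cdot\mid\theta)=\ell(\cdot\mid\theta')$ $\mu$-a.e., then $\theta=\theta'$. (iv) The Fisher information matrix $\mathcal{I}(\theta)=\big(-\int\partial^2_{\theta_i\theta_j}\log\ell(y\mid\theta)\,\ell(y\mid\theta)\,d\mu(y)\big)_{i,j}$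 (integral over the common support) is positive definite for all $\theta\in\Theta$. Put $J(\theta)=\sqrt{|\det\mathcal{I}(\theta)|}$ (the Jeffreys density). Priors and reference priors. A function on $\Theta$ is of class $\mathcal{R}^{\mathcal C}$ if it is measurable, locally bounded and Lebesgue-a.e. continuous on $\Theta$. A prior on $\Theta$ is a probability measure with a non-negative Lebesgue density of class $\mathcal{R}^{\mathcal C}$ on $\Theta$; we use the same letter for a prior and its density. For a probability measure $\pi$ on $\Theta$ let $\ell_k(\mathbf y\mid\theta)=\prod_{i=1}^k\ell(y_i\mid\theta)$, $p_k(\mathbf y)=\int_\Theta\ell_k(\mathbf y\mid\theta)\,d\pi(\theta)$ and $$I_{D_\alpha}(\pi\mid k)=\int_\Theta\int_{\mathcal{Y}^k}f_\alpha\!\left(\frac{p_k(\mathbf y)}{\ell_k(\mathbf y\mid\theta)}\right)\ell_k(\mathbf y\mid\theta)\,d\mu^{\otimes k}(\mathbf y)\,d\pi(\theta),\qquad f_\alpha(x)=\frac{x^\alpha-\alpha x-(1-\alpha)}{\alpha(\alpha-1)},$$ where the inner integrand is $0$ where $\ell_k(\mathbf y\mid\theta)=0$. Let $\mathcal P$ be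 a class of priors. A prior $\pi^*\in\mathcal{P}$ is a $D_\alpha$-reference prior over $\mathcal P$ if there are compact sets $\Theta_0\subset\Theta_1\subset\cdots\subset\Theta$ with $\bigcup_i\Theta_i=\Theta$ and $\pi^*(\Theta_i)>0$ for all $i$, and, for all $i$ from some index on, relatively open $V_i\subset\Theta$ with $\Theta_i\subset V_i\subset\Theta_{i+1}$, such that for every $i$ and every $\pi\in\mathcal{P}$ with $\pi(\Theta_i)>0$ the limit $$\lim_{k\to\infty}k^{d\alpha/2}\big(I_{D_\alpha}(\pi^*(\cdot\mid\Theta_i)\mid k)-I_{D_\alpha}(\pi(\cdot\mid\Theta_i)\mid k)\big)$$ exists and is $\ge 0$, where $\pi(\cdot\mid\Theta_i)=\pi(\cdot\cap\Theta_i)/\pi(\Theta_i)$. Statement. Let $g_1,\dots,g_p:\Theta\to\mathbb{R}$ be of class $\mathcal{R}^{\mathcal C}$ and such that $1,g_1,\dots,g_p$ are linearly independent functions on $\Theta$, let $c_1,\dots,c_p\in\mathbb{R}$, and let $\tilde{\mathcal P}$ be the class of priors $\pi$ on $\Theta$ with $\int_\Theta\pi g_j=c_j$ for $j=1,\dots,p$.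 1. There is at most one $D_\alpha$-reference prior over $\tilde{\mathcal P}$. 2. If $\pi^*$ is a $D_\alpha$-reference prior over $\tilde{\mathcal P}$ whose density is a.e. positive on $\Theta$, then there are $\lambda_0,\dots,\lambda_p\in\mathbb{R}$ such that, for a.e. $\theta\in\Theta$, $\lambda_0+\sum_{j=1}^p\lambda_jg_j(\theta)\ge 0$ and $$\pi^*(\theta)=J(\theta)\Big(\lambda_0+\sum_{j=1}^p\lambda_jg_j(\theta)\Big)^{1/\alpha}.\tag{$*$}$$ 3. Conversely, if $\pi^*\in\tilde{\mathcal P}$ satisfies $(*)$ a.e. on $\Theta$ for some $\lambda_0,\dots,\lambda_p\in\mathbb{R}$ with $\lambda_0+\sum_{j}\lambda_jg_j\ge0$ a.e. on $\Theta$, then $\pi^*$ is the $D_\alpha$-reference prior over $\tilde{\mathcal P}$. -/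

import Mathlib

open MeasureTheory Set Filter Topology

noncomputable section

namespace RefPrior

variable {𝒴 : Type*} [MeasurableSpace 𝒴] {d p : ℕ}

/-- Measurable, locally bounded, and a.e. continuous functions `Θ → ℝ` (the values of `f` outside
`Θ` are irrelevant; continuity is relative to `Θ`). -/
structure IsLocBddAECont (Θ : Set (EuclideanSpace ℝ (Fin d)))
    (f : EuclideanSpace ℝ (Fin d) → ℝ) : Prop where
  measurable : Measurable (Θ.domRestrict f)
  locallyBounded : ∀ θ ∈ Θ, ∃ M : ℝ, ∀ᶠ θ' in 𝓝[Θ] θ, |f θ'| ≤ M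
  aeContinuous : ∀ᵐ θ ∂(volume.restrict Θ), ContinuousWithinAt f Θ θ

/-- Prior densities on `Θ`: non-negative, non-null, measurable, locally bounded and a.e. continuous
functions on `Θ`. -/
structure IsPriorDensity (Θ : Set (EuclideanSpace ℝ (Fin d)))
    (f : EuclideanSpace ℝ (Fin d) → ℝ) : Prop where
  locBddAECont : IsLocBddAECont Θ f
  nonneg : ∀ θ ∈ Θ, 0 ≤ f θ
  nonnull : ¬ f =ᵐ[volume.restrict Θ] 0

/-- The measure on `Θ` with density `f` with respect to the Lebesgue measure. -/
def priorMeasure (Θ : Set (EuclideanSpace ℝ (Fin d))) (f : EuclideanSpace ℝ (Fin d) → ℝ) :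
    Measure (EuclideanSpace ℝ (Fin d)) :=
  (volume.restrict Θ).withDensity fun θ => ENNReal.ofReal (f θ)

/-- The measures that represent a prior on `Θ` (in general, up to a positive factor). -/
def IsPrior (Θ : Set (EuclideanSpace ℝ (Fin d))) (ν : Measure (EuclideanSpace ℝ (Fin d))) : Prop :=
  ∃ f, IsPriorDensity Θ f ∧ ν = priorMeasure Θ f

/-- The class of priors on `Θ` with `∫ ν g_j = c_j`. A proper prior is represented by its
representative of total mass one; on a compact `Θ` every prior is proper. -/
def constrainedPriors (Θ : Set (EuclideanSpace ℝ (Fin d)))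
    (g : Fin p → EuclideanSpace ℝ (Fin d) → ℝ) (c : Fin p → ℝ) :
    Set (Measure (EuclideanSpace ℝ (Fin d))) :=
  {ν | IsPrior Θ ν ∧ IsProbabilityMeasure ν ∧ ∀ j, ∫ θ, g j θ ∂ν = c j}

/-- The likelihood of `k` independent observations. -/
def likelihood (ℓ : EuclideanSpace ℝ (Fin d) → 𝒴 → ℝ) (k : ℕ)
    (θ : EuclideanSpace ℝ (Fin d)) (y : Fin k → 𝒴) : ℝ :=
  ∏ i, ℓ θ (y i)

/-- The density of the marginal distribution of `k` observations under the proper prior `ν`. -/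
def marginal (ℓ : EuclideanSpace ℝ (Fin d) → 𝒴 → ℝ) (ν : Measure (EuclideanSpace ℝ (Fin d)))
    (k : ℕ) (y : Fin k → 𝒴) : ℝ :=
  ∫ θ, likelihood ℓ k θ y ∂ν

/-- The function `f_α` that generates the `α`-divergence. -/
def fAlpha (α x : ℝ) : ℝ := (x ^ α - α * x - (1 - α)) / (α * (α - 1))

/-- The `α`-divergence between the law of `k` observations given `θ` and their marginal law. -/
def alphaDivergence (μ : Measure 𝒴) (ℓ : EuclideanSpace ℝ (Fin d) → 𝒴 → ℝ) (α : ℝ)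
    (ν : Measure (EuclideanSpace ℝ (Fin d))) (k : ℕ) (θ : EuclideanSpace ℝ (Fin d)) : ℝ :=
  ∫ y, fAlpha α (marginal ℓ ν k y / likelihood ℓ k θ y) * likelihood ℓ k θ y
    ∂(Measure.pi fun _ : Fin k => μ)

/-- The `D_α`-mutual information of the proper prior `ν` for `k` observations. -/
def mutualInformation (μ : Measure 𝒴) (ℓ : EuclideanSpace ℝ (Fin d) → 𝒴 → ℝ) (α : ℝ)
    (ν : Measure (EuclideanSpace ℝ (Fin d))) (k : ℕ) : ℝ :=
  ∫ θ, alphaDivergence μ ℓ α ν k θ ∂ν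

/-- Openly increasing sequences of subsets of `Θ`; the `V i` are open for the topology of `Θ`. -/
def IsOpenlyIncreasing (Θ : Set (EuclideanSpace ℝ (Fin d)))
    (K : ℕ → Set (EuclideanSpace ℝ (Fin d))) : Prop :=
  Monotone K ∧ ∃ (i₀ : ℕ) (V : ℕ → Set (EuclideanSpace ℝ (Fin d))), ∀ i ≥ i₀,
    (∃ O, IsOpen O ∧ V i = O ∩ Θ) ∧ K i ⊆ V i ∧ V i ⊆ K (i + 1)

/-- `ν` is a `D_α`-reference prior over the class `P` of priors on `Θ`, with rate `φ`. The
re-normalized restriction of a measure to a set is `ProbabilityTheory.cond`. -/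
def IsReferencePriorWithRate (μ : Measure 𝒴) (ℓ : EuclideanSpace ℝ (Fin d) → 𝒴 → ℝ) (α : ℝ)
    (φ : ℕ → ℝ) (Θ : Set (EuclideanSpace ℝ (Fin d)))
    (P : Set (Measure (EuclideanSpace ℝ (Fin d)))) (ν : Measure (EuclideanSpace ℝ (Fin d))) :
    Prop :=
  ν ∈ P ∧ ∃ K : ℕ → Set (EuclideanSpace ℝ (Fin d)),
    IsOpenlyIncreasing Θ K ∧ (∀ i, IsCompact (K i) ∧ K i ⊆ Θ ∧ 0 < ν (K i)) ∧ (⋃ i, K i) = Θ ∧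
    ∀ i, ∀ ν' ∈ P, 0 < ν' (K i) →
      ∃ L : ℝ, 0 ≤ L ∧
        Tendsto (fun k : ℕ => φ k *
          (mutualInformation μ ℓ α (ProbabilityTheory.cond ν (K i)) k
            - mutualInformation μ ℓ α (ProbabilityTheory.cond ν' (K i)) k)) atTop (𝓝 L)

/-- `D_α`-reference priors, with the rate `k ^ (d α / 2)` of the `D_α`-mutual information. -/
def IsReferencePrior (μ : Measure 𝒴) (ℓ : EuclideanSpace ℝ (Fin d) → 𝒴 → ℝ) (α : ℝ)
    (Θ : Set (EuclideanSpace ℝ (Fin d))) (P : Set (Measure (EuclideanSpace ℝ (Fin d))))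
    (ν : Measure (EuclideanSpace ℝ (Fin d))) : Prop :=
  IsReferencePriorWithRate μ ℓ α (fun k : ℕ => (k : ℝ) ^ ((d : ℝ) * α / 2)) Θ P ν

/-- The log-likelihood of one observation `y`, as a function of the parameter. -/
def logLik (ℓ : EuclideanSpace ℝ (Fin d) → 𝒴 → ℝ) (y : 𝒴) (θ : EuclideanSpace ℝ (Fin d)) : ℝ :=
  Real.log (ℓ θ y)

/-- The Fisher information matrix, `-∫ [∂_i ∂_j log ℓ(y|θ)] ℓ(y|θ) dμ(y)`. -/
def fisherInformation (μ : Measure 𝒴) (ℓ : EuclideanSpace ℝ (Fin d) → 𝒴 → ℝ)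
    (θ : EuclideanSpace ℝ (Fin d)) : Matrix (Fin d) (Fin d) ℝ :=
  Matrix.of fun i j =>
    - ∫ y, fderiv ℝ (fderiv ℝ (logLik ℓ y)) θ
        (EuclideanSpace.single i 1) (EuclideanSpace.single j 1) * ℓ θ y ∂μ

/-- The density of the Jeffreys prior. -/
def jeffreys (μ : Measure 𝒴) (ℓ : EuclideanSpace ℝ (Fin d) → 𝒴 → ℝ)
    (θ : EuclideanSpace ℝ (Fin d)) : ℝ :=
  Real.sqrt |(fisherInformation μ ℓ θ).det|

/-- Classical regularity of a statistical model given by the densities `ℓ θ` with respect to `μ`,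
for `θ` in an open neighbourhood `U` of the parameter set `Θ`. -/
structure IsRegularModel (μ : Measure 𝒴) (ℓ : EuclideanSpace ℝ (Fin d) → 𝒴 → ℝ)
    (U Θ : Set (EuclideanSpace ℝ (Fin d))) : Prop where
  isOpen : IsOpen U
  subset : Θ ⊆ U
  measurable : Measurable (Function.uncurry ℓ)
  nonneg : ∀ θ ∈ U, ∀ y, 0 ≤ ℓ θ y
  integral_eq_one : ∀ θ ∈ U, ∫ y, ℓ θ y ∂μ = 1
  /-- The support does not depend on the parameter. -/
  commonSupport : ∀ᵐ y ∂μ, (∀ θ ∈ U, 0 < ℓ θ y) ∨ (∀ θ ∈ U, ℓ θ y = 0)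
  contDiff : ∀ᵐ y ∂μ, ContDiffOn ℝ 2 (logLik ℓ y) U
  /-- Local domination of the first two derivatives of the log-likelihood. -/
  dominated : ∀ θ₀ ∈ Θ, ∃ r > 0, ∃ H : 𝒴 → ℝ, Metric.ball θ₀ r ⊆ U ∧ Integrable H μ ∧
    ∀ᵐ y ∂μ, ∀ θ ∈ Metric.ball θ₀ r, ∀ θ' ∈ Metric.ball θ₀ r,
      (1 + ‖fderiv ℝ (logLik ℓ y) θ'‖ ^ 2 + ‖fderiv ℝ (fderiv ℝ (logLik ℓ y)) θ'‖) * ℓ θ y ≤ H y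
  identifiable : ∀ θ ∈ Θ, ∀ θ' ∈ Θ, ℓ θ =ᵐ[μ] ℓ θ' → θ = θ'
  fisher_posDef : ∀ θ ∈ Θ, (fisherInformation μ ℓ θ).PosDef

/-- `f = J · (λ_0 + ∑ λ_j g_j) ^ (1 / α)` a.e. on `Θ`, for some real `λ_0, …, λ_p`, where the base of
the real power is non-negative. -/
def HasConstrainedForm (μ : Measure 𝒴) (ℓ : EuclideanSpace ℝ (Fin d) → 𝒴 → ℝ) (α : ℝ)
    (Θ : Set (EuclideanSpace ℝ (Fin d))) (g : Fin p → EuclideanSpace ℝ (Fin d) → ℝ)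
    (f : EuclideanSpace ℝ (Fin d) → ℝ) : Prop :=
  ∃ (lam₀ : ℝ) (lam : Fin p → ℝ), ∀ᵐ θ ∂(volume.restrict Θ),
    0 ≤ lam₀ + ∑ j, lam j * g j θ ∧
      f θ = jeffreys μ ℓ θ * (lam₀ + ∑ j, lam j * g j θ) ^ (1 / α)

end RefPrior

end

/-! For $\alpha\in(0,1)$ the affine part of $f_\alpha$ integrates to a constant, so
$I_{D_\alpha}(\pi\mid k)=(1-\int A_k\,d\pi)/(\alpha(1-\alpha))$ with the Hellinger integral
$A_k(\theta)=\int p_k^\alpha\,\ell_k(\cdot\mid\theta)^{1-\alpha}$ (`affinity`). The analytic core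
(`tendsto_rate_mul_affinity`) is that, for a bounded density $f$ on $\Theta$ and a.e. $\theta$,
$k^{d\alpha/2}A_k(\theta)\to G\,(f(\theta)/J(\theta))^\alpha$ with a constant $0<G<\infty$. A
uniform bound allows integration of this limit, so normalized differences of informations converge
to $G/(\alpha(1-\alpha))$ times a difference of values of $\Phi(f)=\int_\Theta f\,(f/J)^\alpha$,
with the opposite sign. Since $\Theta$ is compact, an openly increasing exhaustion contains $\Theta$
itself (`IsOpenlyIncreasing.exists_eq`). Hence reference priors are exactly the minimizers of $\Phi$
under the constraints (`isReferencePrior_iff`).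

The functional $\Phi$ is strictly convex, being the integral of $J\,(f/J)^{1+\alpha}$. Uniqueness
follows by comparison with the midpoint. For a positive minimizer, perturbations $f(1+t\varphi)$
with bounded $\varphi$ show that $\varphi\mapsto\int f(f/J)^\alpha\varphi$ vanishes where the
constraint functionals $\int f\varphi$, $\int fg_j\varphi$ vanish. It is therefore a linear
combination of them, which says $(f/J)^\alpha=\lambda_0+\sum_j\lambda_jg_j$. Conversely this
equation makes the tangent term of the convexity inequality vanish on the constraint set.

For the limit of $A_k(\theta)$, the parameters are split at distance $M/\sqrt k$ from $\theta$. This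
is possible because $x\mapsto x^\alpha$ is subadditive.

Near $\theta$, the coordinates are standardized by a linear map $A$ with $|\det A|=1/J(\theta)$. A
second-order expansion of the log-likelihood, uniform in bounded local coordinates
(`ae_logLik_expansion`), and the central limit theorem turn the mixture of likelihood ratios into
$\int_{\|u\|\le M}e^{\langle Z,u\rangle-\|u\|^2/2}\,du$ with $Z$ standard Gaussian. Moments of order
$\alpha<1$ pass to the limit because first moments are bounded (`tendsto_lintegral_rpow`). At a
Lebesgue point the density may be replaced by its value.

Far from $\theta$, dyadic shells are cut into boundedly many pieces that are small compared with
their distance $s$ to $\theta$. Identifiability, positive definiteness and compactness bound the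
one-observation Hellinger integral of every mixture over such a piece by $e^{-cs^2}$
(`exists_separation`). Tensorization gives $e^{-cks^2}$, and the shells sum to $O(1/M)$ after
normalization (`exists_tail_le`). -/

noncomputable section

namespace RefPrior

open scoped ENNReal

set_option linter.unusedSectionVars false

/-! ### Hellinger integrals between mixtures and product laws. -/

section Affinity

variable {X 𝒴 : Type*} [MeasurableSpace X] [MeasurableSpace 𝒴]

/-- The joint density of `k` independent observations, as an extended non-negative number. -/
def prodDensity (L : X → 𝒴 → ℝ≥0∞) (k : ℕ) (x : X) (y : Fin k → 𝒴) : ℝ≥0∞ := ∏ i, L x (y i)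

/-- The density of `k` observations when the parameter is drawn from `ρ`. -/
def mixture (L : X → 𝒴 → ℝ≥0∞) (ρ : Measure X) (k : ℕ) (y : Fin k → 𝒴) : ℝ≥0∞ :=
  ∫⁻ x, prodDensity L k x y ∂ρ

/-- The Hellinger integral of order `α` between the `ρ`-mixture and the law with parameter `x₀`. -/
def affinity (μ : Measure 𝒴) (L : X → 𝒴 → ℝ≥0∞) (α : ℝ) (ρ : Measure X) (k : ℕ) (x₀ : X) : ℝ≥0∞ :=
  ∫⁻ y, mixture L ρ k y ^ α * prodDensity L k x₀ y ^ (1 - α) ∂(Measure.pi fun _ : Fin k => μ)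

variable {μ : Measure 𝒴} {L : X → 𝒴 → ℝ≥0∞} {α : ℝ} {ρ ρ' : Measure X} {k : ℕ} {x₀ : X}

lemma measurable_uncurry_prodDensity (hL : Measurable (Function.uncurry L)) (k : ℕ) :
    Measurable (Function.uncurry (prodDensity L k)) := by
  unfold prodDensity Function.uncurry
  refine Finset.measurable_prod _ fun i _ => ?_
  exact hL.comp (measurable_fst.prodMk ((measurable_pi_apply i).comp measurable_snd))

lemma measurable_prodDensity (hL : Measurable (Function.uncurry L)) (k : ℕ) (x : X) :
    Measurable (prodDensity L k x) :=
  (measurable_uncurry_prodDensity hL k).of_uncurry_left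

lemma measurable_prodDensity_left (hL : Measurable (Function.uncurry L)) (k : ℕ) (y : Fin k → 𝒴) :
    Measurable fun x => prodDensity L k x y :=
  (measurable_uncurry_prodDensity hL k).of_uncurry_right

lemma measurable_mixture [SFinite ρ] (hL : Measurable (Function.uncurry L)) (k : ℕ) :
    Measurable (mixture L ρ k) :=
  ((measurable_uncurry_prodDensity hL k).comp measurable_swap).lintegral_prod_right'

lemma measurable_uncurry_affinity_integrand [SFinite ρ] (hL : Measurable (Function.uncurry L))
    (k : ℕ) : Measurable fun p : X × (Fin k → 𝒴) =>
      mixture L ρ k p.2 ^ α * prodDensity L k p.1 p.2 ^ (1 - α) :=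
  (((measurable_mixture hL k).comp measurable_snd).pow_const _).mul
    ((measurable_uncurry_prodDensity hL k).pow_const _)

lemma measurable_affinity_integrand [SFinite ρ] (hL : Measurable (Function.uncurry L)) (k : ℕ)
    (x₀ : X) : Measurable fun y : Fin k → 𝒴 =>
      mixture L ρ k y ^ α * prodDensity L k x₀ y ^ (1 - α) :=
  ((measurable_mixture hL k).pow_const _).mul ((measurable_prodDensity hL k x₀).pow_const _)

lemma measurable_affinity [SigmaFinite μ] [SFinite ρ] (hL : Measurable (Function.uncurry L))
    (k : ℕ) : Measurable (affinity μ L α ρ k) :=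
  (measurable_uncurry_affinity_integrand hL k).lintegral_prod_right'

lemma lintegral_pi_succ [SigmaFinite μ] (k : ℕ) {F : (Fin (k + 1) → 𝒴) → ℝ≥0∞}
    (hF : Measurable F) :
    ∫⁻ y, F y ∂(Measure.pi fun _ : Fin (k + 1) => μ) =
      ∫⁻ y, ∫⁻ a, F (Fin.cons a y) ∂μ ∂(Measure.pi fun _ : Fin k => μ) := by
  have h := (measurePreserving_piFinSuccAbove (fun _ : Fin (k + 1) => μ) 0).symm
  rw [← h.lintegral_comp hF, lintegral_prod_symm']
  · refine lintegral_congr fun y => lintegral_congr fun a => congrArg F ?_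
    simp [MeasurableEquiv.piFinSuccAbove]
    rfl
  · exact hF.comp (MeasurableEquiv.measurable _)

lemma prodDensity_cons (x : X) (a : 𝒴) (y : Fin k → 𝒴) :
    prodDensity L (k + 1) x (Fin.cons a y) = L x a * prodDensity L k x y := by
  simp [prodDensity, Fin.prod_univ_succ]

lemma lintegral_prodDensity [SigmaFinite μ] (hL : Measurable (Function.uncurry L)) (k : ℕ) (x : X) :
    ∫⁻ y, prodDensity L k x y ∂(Measure.pi fun _ : Fin k => μ) = (∫⁻ y, L x y ∂μ) ^ k := by
  induction k with
  | zero => simp [prodDensity]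
  | succ k ih =>
    rw [lintegral_pi_succ k (measurable_prodDensity hL _ x)]
    simp_rw [prodDensity_cons]
    have : ∀ y : Fin k → 𝒴, ∫⁻ a, L x a * prodDensity L k x y ∂μ
        = (∫⁻ a, L x a ∂μ) * prodDensity L k x y := fun y =>
      lintegral_mul_const _ hL.of_uncurry_left
    simp_rw [this]
    rw [lintegral_const_mul _ (measurable_prodDensity hL _ x), ih, pow_succ']

lemma lintegral_mixture [SigmaFinite μ] [SFinite ρ] (hL : Measurable (Function.uncurry L)) (k : ℕ) :
    ∫⁻ y, mixture L ρ k y ∂(Measure.pi fun _ : Fin k => μ) = ∫⁻ x, (∫⁻ y, L x y ∂μ) ^ k ∂ρ := by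
  unfold mixture
  rw [lintegral_lintegral_swap]
  · simp_rw [lintegral_prodDensity hL]
  · exact ((measurable_uncurry_prodDensity hL k).comp measurable_swap).aemeasurable

lemma mixture_mono (h : ρ ≤ ρ') (y : Fin k → 𝒴) : mixture L ρ k y ≤ mixture L ρ' k y :=
  lintegral_mono' h le_rfl

lemma affinity_mono (hα : 0 ≤ α) (h : ρ ≤ ρ') : affinity μ L α ρ k x₀ ≤ affinity μ L α ρ' k x₀ :=
  lintegral_mono fun y => by
    gcongr
    exact mixture_mono h y

lemma affinity_smul [SFinite ρ] (hL : Measurable (Function.uncurry L)) (hα : 0 ≤ α) (c : ℝ≥0∞) :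
    affinity μ L α (c • ρ) k x₀ = c ^ α * affinity μ L α ρ k x₀ := by
  unfold affinity
  rw [← lintegral_const_mul _ ?_]
  · refine lintegral_congr fun y => ?_
    rw [mixture, lintegral_smul_measure, smul_eq_mul, ENNReal.mul_rpow_of_nonneg _ _ hα, mul_assoc]
    rfl
  · exact measurable_affinity_integrand hL k x₀

/-- Subadditivity of $x\mapsto x^\alpha$ for $\alpha\le1$. It permits separate estimates on pieces
of the parameter set and turns perturbations of the density into additive errors. -/
lemma affinity_add_le [SFinite ρ] (hL : Measurable (Function.uncurry L)) (hα : 0 ≤ α) (hα1 : α ≤ 1) :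
    affinity μ L α (ρ + ρ') k x₀ ≤ affinity μ L α ρ k x₀ + affinity μ L α ρ' k x₀ := by
  unfold affinity
  rw [← lintegral_add_left]
  · refine lintegral_mono fun y => ?_
    rw [← add_mul]
    gcongr
    rw [mixture, lintegral_add_measure]
    exact ENNReal.rpow_add_le_add_rpow _ _ hα hα1
  · exact measurable_affinity_integrand hL k x₀

lemma rpow_sum_le_sum_rpow {ι : Type*} (s : Finset ι) (a : ι → ℝ≥0∞) (hα : 0 < α) (hα1 : α ≤ 1) :
    (∑ i ∈ s, a i) ^ α ≤ ∑ i ∈ s, a i ^ α := by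
  classical
  induction s using Finset.induction_on with
  | empty => simp [hα]
  | insert i s hi ih =>
    rw [Finset.sum_insert hi, Finset.sum_insert hi]
    exact (ENNReal.rpow_add_le_add_rpow _ _ hα.le hα1).trans (by gcongr)

lemma rpow_tsum_le_tsum_rpow {ι : Type*} (a : ι → ℝ≥0∞) (hα : 0 < α) (hα1 : α ≤ 1) :
    (∑' i, a i) ^ α ≤ ∑' i, a i ^ α := by
  have h : Tendsto (fun s : Finset ι => (∑ i ∈ s, a i) ^ α) atTop (𝓝 ((∑' i, a i) ^ α)) :=
    (ENNReal.continuous_rpow_const.tendsto _).comp ENNReal.summable.hasSum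
  exact le_of_tendsto' h fun s =>
    (rpow_sum_le_sum_rpow s a hα hα1).trans (ENNReal.sum_le_tsum s)

/-- The countable form of subadditivity, needed because the tail is cut into infinitely many dyadic
shells. -/
lemma affinity_sum_le {ι : Type*} [Countable ι] {ρ : ι → Measure X} [∀ i, SFinite (ρ i)]
    (hL : Measurable (Function.uncurry L)) (hα : 0 < α) (hα1 : α ≤ 1) :
    affinity μ L α (Measure.sum ρ) k x₀ ≤ ∑' i, affinity μ L α (ρ i) k x₀ := by
  unfold affinity
  rw [← lintegral_tsum]
  · refine lintegral_mono fun y => ?_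
    rw [ENNReal.tsum_mul_right]
    gcongr
    rw [mixture, lintegral_sum_measure]
    exact rpow_tsum_le_tsum_rpow _ hα hα1
  · exact fun i => (measurable_affinity_integrand hL k x₀).aemeasurable

/-- Hölder's inequality with exponents $1/\alpha$ and $1/(1-\alpha)$. This crude bound suffices on
sets of volume of order $k^{-d/2}$ and for error terms. -/
lemma affinity_le_measure_univ_rpow [SigmaFinite μ] [SFinite ρ] (hL : Measurable (Function.uncurry L))
    (hα : 0 < α) (hα1 : α < 1) (hρ : ∀ᵐ x ∂ρ, ∫⁻ y, L x y ∂μ = 1) (hx₀ : ∫⁻ y, L x₀ y ∂μ = 1) :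
    affinity μ L α ρ k x₀ ≤ ρ univ ^ α := by
  refine (ENNReal.lintegral_mul_norm_pow_le (measurable_mixture hL k).aemeasurable
    (measurable_prodDensity hL k x₀).aemeasurable hα.le (by linarith) (by ring)).trans ?_
  rw [lintegral_mixture hL, lintegral_prodDensity hL, hx₀]
  have : ∫⁻ x, (∫⁻ y, L x y ∂μ) ^ k ∂ρ = ρ univ := by
    rw [lintegral_congr_ae (g := fun _ => 1) (hρ.mono fun x hx => by simp [hx])]
    simp
  simp [this]

/-- Hellinger integrals between mixtures of product laws tensorize: a bound for all the mixtures of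
the laws of one observation, with parameters in `A`, is raised to the power `k`. -/
lemma affinity_le_pow_mul [SigmaFinite μ] [SFinite ρ] (hL : Measurable (Function.uncurry L))
    (hα : 0 < α) {A : Set X} {r : ℝ≥0∞} (hr : r ≠ 0)
    (h : ∀ ρ' : Measure X, IsFiniteMeasure ρ' → ρ' Aᶜ = 0 →
      ∫⁻ a, (∫⁻ x, L x a ∂ρ') ^ α * L x₀ a ^ (1 - α) ∂μ ≤ r * ρ' univ ^ α)
    (hρ : ρ Aᶜ = 0) (hα1 : α < 1) : affinity μ L α ρ k x₀ ≤ r ^ k * ρ univ ^ α := by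
  induction k with
  | zero => simp [affinity, mixture, prodDensity]
  | succ k ih =>
    unfold affinity
    rw [lintegral_pi_succ k (measurable_affinity_integrand hL _ x₀)]
    have key : ∀ y : Fin k → 𝒴,
        ∫⁻ a, mixture L ρ (k + 1) (Fin.cons a y) ^ α *
            prodDensity L (k + 1) x₀ (Fin.cons a y) ^ (1 - α) ∂μ
          ≤ r * (mixture L ρ k y ^ α * prodDensity L k x₀ y ^ (1 - α)) := by
      intro y
      -- With all observations but one fixed, the mixing measure is reweighted by their likelihood,
      -- like an unnormalized posterior. It remains carried by `A`, which is why the hypothesis must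
      -- hold for every finite measure carried by `A`.
      set ρ' := ρ.withDensity fun x => prodDensity L k x y with hρ'
      have hmass : ρ' univ = mixture L ρ k y := by simp [hρ', mixture]
      have hmix : ∀ a, mixture L ρ (k + 1) (Fin.cons a y) = ∫⁻ x, L x a ∂ρ' := by
        intro a
        rw [hρ', lintegral_withDensity_eq_lintegral_mul _ (measurable_prodDensity_left hL k y)
          hL.of_uncurry_right]
        simp [mixture, prodDensity_cons, mul_comm]
      have hm : Measurable fun a => (∫⁻ x, L x a ∂ρ') ^ α * L x₀ a ^ (1 - α) := by
        have : Measurable fun a => ∫⁻ x, L x a ∂ρ' :=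
          (hL.comp measurable_swap).lintegral_prod_right'
        exact (this.pow_const _).mul (hL.of_uncurry_left.pow_const _)
      have hle : ∫⁻ a, (∫⁻ x, L x a ∂ρ') ^ α * L x₀ a ^ (1 - α) ∂μ ≤ r * ρ' univ ^ α := by
        -- A reweighting of infinite mass is not covered by `h`, but then the right-hand side is
        -- infinite, since `r ≠ 0`.
        by_cases hfin : ρ' univ = ∞
        · rw [hfin, ENNReal.top_rpow_of_pos hα, ENNReal.mul_top hr]
          exact le_top
        · exact h ρ' ⟨lt_top_iff_ne_top.2 hfin⟩
            (withDensity_absolutelyContinuous _ _ hρ)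
      calc _ = ∫⁻ a, ((∫⁻ x, L x a ∂ρ') ^ α * L x₀ a ^ (1 - α)) * prodDensity L k x₀ y ^ (1 - α) ∂μ := by
              refine lintegral_congr fun a => ?_
              rw [hmix, prodDensity_cons, ENNReal.mul_rpow_of_nonneg _ _ (by linarith), mul_assoc]
        _ = (∫⁻ a, (∫⁻ x, L x a ∂ρ') ^ α * L x₀ a ^ (1 - α) ∂μ) * prodDensity L k x₀ y ^ (1 - α) :=
              lintegral_mul_const _ hm
        _ ≤ (r * ρ' univ ^ α) * prodDensity L k x₀ y ^ (1 - α) := by gcongr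
        _ = _ := by rw [hmass, mul_assoc]
    calc _ ≤ ∫⁻ y, r * (mixture L ρ k y ^ α * prodDensity L k x₀ y ^ (1 - α))
              ∂(Measure.pi fun _ : Fin k => μ) := lintegral_mono key
      _ = r * affinity μ L α ρ k x₀ := by
              rw [lintegral_const_mul _
                (measurable_affinity_integrand hL _ x₀)]
              rfl
      _ ≤ r * (r ^ k * ρ univ ^ α) := by gcongr
      _ = _ := by rw [pow_succ', mul_assoc]

end Affinity

/-! ### Measurability of derivatives with respect to an outer variable. -/

section Derivatives

variable {𝒴 : Type*} [MeasurableSpace 𝒴] {μ : Measure 𝒴} {d : ℕ}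

lemma aestronglyMeasurable_of_forall_apply {F : Type*} [NormedAddCommGroup F] [NormedSpace ℝ F]
    {f : 𝒴 → EuclideanSpace ℝ (Fin d) →L[ℝ] F}
    (h : ∀ v, AEStronglyMeasurable (fun y => f y v) μ) : AEStronglyMeasurable f μ := by
  have hf : f = fun y => ∑ i, (EuclideanSpace.proj (𝕜 := ℝ) i).smulRight
      (f y (EuclideanSpace.single i 1)) := by
    funext y
    ext v
    conv_lhs => rw [← (EuclideanSpace.basisFun (Fin d) ℝ).sum_repr v]
    simp
  rw [hf]
  refine Finset.aestronglyMeasurable_fun_sum _ fun i _ => ?_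
  exact (ContinuousLinearMap.smulRightL ℝ (EuclideanSpace ℝ (Fin d)) F
    (EuclideanSpace.proj i)).continuous.comp_aestronglyMeasurable (h _)

/-- Directional derivatives are limits of difference quotients along $1/n$, and in finite dimension
measurability can be checked direction by direction. -/
lemma aestronglyMeasurable_fderiv {F : Type*} [NormedAddCommGroup F] [NormedSpace ℝ F]
    {g : 𝒴 → EuclideanSpace ℝ (Fin d) → F} {θ : EuclideanSpace ℝ (Fin d)}
    (hm : ∀ᶠ θ' in 𝓝 θ, AEStronglyMeasurable (fun y => g y θ') μ)
    (hd : ∀ᵐ y ∂μ, DifferentiableAt ℝ (g y) θ) :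
    AEStronglyMeasurable (fun y => fderiv ℝ (g y) θ) μ := by
  refine aestronglyMeasurable_of_forall_apply fun v => ?_
  have hlim : Tendsto (fun n : ℕ => θ + ((n : ℝ))⁻¹ • v) atTop (𝓝 θ) := by
    have : Tendsto (fun n : ℕ => θ + ((n : ℝ))⁻¹ • v) atTop (𝓝 (θ + (0 : ℝ) • v)) :=
      tendsto_const_nhds.add ((tendsto_inv_atTop_nhds_zero_nat (𝕜 := ℝ)).smul_const v)
    simpa using this
  obtain ⟨N, hN⟩ := eventually_atTop.1 (hlim.eventually hm)
  -- Measurability is only known near `θ`, so the sequence of increments is shifted by `N`.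
  refine aestronglyMeasurable_of_tendsto_ae atTop
    (f := fun n y => ((n + N : ℕ) : ℝ) • (g y (θ + ((n + N : ℕ) : ℝ)⁻¹ • v) - g y θ)) ?_ ?_
  · exact fun n => ((hN _ (by lia)).sub hm.self_of_nhds).const_smul _
  · filter_upwards [hd] with y hy
    have hc : Tendsto (fun n : ℕ => ‖(n : ℝ)‖) atTop atTop := by
      simpa using tendsto_natCast_atTop_atTop (R := ℝ)
    exact (hy.hasFDerivAt.lim v hc).comp (tendsto_add_atTop_nat N)

end Derivatives

/-! ### Differentiation under the integral sign and moments of the score. -/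

section Model

variable {𝒴 : Type*} [MeasurableSpace 𝒴] {μ : Measure 𝒴} {d : ℕ}
  {ℓ : EuclideanSpace ℝ (Fin d) → 𝒴 → ℝ} {U Θ : Set (EuclideanSpace ℝ (Fin d))}

/-- The score at `θ`. -/
def score (ℓ : EuclideanSpace ℝ (Fin d) → 𝒴 → ℝ) (y : 𝒴) (θ : EuclideanSpace ℝ (Fin d)) :
    EuclideanSpace ℝ (Fin d) →L[ℝ] ℝ := fderiv ℝ (logLik ℓ y) θ

/-- The second derivative of the log-likelihood at `θ`. -/
def hess (ℓ : EuclideanSpace ℝ (Fin d) → 𝒴 → ℝ) (y : 𝒴) (θ : EuclideanSpace ℝ (Fin d)) :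
    EuclideanSpace ℝ (Fin d) →L[ℝ] EuclideanSpace ℝ (Fin d) →L[ℝ] ℝ :=
  fderiv ℝ (fderiv ℝ (logLik ℓ y)) θ

namespace IsRegularModel

variable (hℓ : IsRegularModel μ ℓ U Θ)
include hℓ

lemma measurable_density (θ : EuclideanSpace ℝ (Fin d)) : Measurable (ℓ θ) :=
  hℓ.measurable.of_uncurry_left

lemma measurable_logLik (θ : EuclideanSpace ℝ (Fin d)) : Measurable fun y => logLik ℓ y θ :=
  (hℓ.measurable_density θ).log

lemma ae_contDiffAt : ∀ᵐ y ∂μ, ∀ θ ∈ U, ContDiffAt ℝ 2 (logLik ℓ y) θ := by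
  filter_upwards [hℓ.contDiff] with y hy θ hθ
  exact hy.contDiffAt (hℓ.isOpen.mem_nhds hθ)

lemma ae_differentiableAt_logLik : ∀ᵐ y ∂μ, ∀ θ ∈ U, DifferentiableAt ℝ (logLik ℓ y) θ := by
  filter_upwards [hℓ.ae_contDiffAt] with y hy θ hθ
  exact (hy θ hθ).differentiableAt (by norm_num)

lemma ae_contDiffAt_score : ∀ᵐ y ∂μ, ∀ θ ∈ U, ContDiffAt ℝ 1 (score ℓ y) θ := by
  filter_upwards [hℓ.ae_contDiffAt] with y hy θ hθ
  exact (hy θ hθ).fderiv_right (by norm_num)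

lemma ae_hasFDerivAt_score : ∀ᵐ y ∂μ, ∀ θ ∈ U, HasFDerivAt (score ℓ y) (hess ℓ y θ) θ := by
  filter_upwards [hℓ.ae_contDiffAt_score] with y hy θ hθ
  exact ((hy θ hθ).differentiableAt (by norm_num)).hasFDerivAt

lemma ae_continuousAt_hess : ∀ᵐ y ∂μ, ∀ θ ∈ U, ContinuousAt (hess ℓ y) θ := by
  filter_upwards [hℓ.ae_contDiffAt_score] with y hy θ hθ
  exact ((hy θ hθ).fderiv_right (m := 0) (by norm_num)).continuousAt

lemma aestronglyMeasurable_score {θ : EuclideanSpace ℝ (Fin d)} (hθ : θ ∈ U) :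
    AEStronglyMeasurable (fun y => score ℓ y θ) μ :=
  aestronglyMeasurable_fderiv
    (Eventually.of_forall fun θ' => (hℓ.measurable_logLik θ').aestronglyMeasurable)
    (hℓ.ae_differentiableAt_logLik.mono fun _ h => h θ hθ)

lemma aestronglyMeasurable_hess {θ : EuclideanSpace ℝ (Fin d)} (hθ : θ ∈ U) :
    AEStronglyMeasurable (fun y => hess ℓ y θ) μ :=
  aestronglyMeasurable_fderiv (g := score ℓ)
    (by filter_upwards [hℓ.isOpen.mem_nhds hθ] with θ' hθ' using hℓ.aestronglyMeasurable_score hθ')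
    (hℓ.ae_hasFDerivAt_score.mono fun _ h => (h θ hθ).differentiableAt)

/-- The density is differentiable in the parameter, in the strict sense. -/
lemma ae_hasStrictFDerivAt : ∀ᵐ y ∂μ, ∀ θ ∈ U,
    HasStrictFDerivAt (fun θ => ℓ θ y) (ℓ θ y • score ℓ y θ) θ := by
  filter_upwards [hℓ.commonSupport, hℓ.ae_contDiffAt] with y hs hy θ hθ
  rcases hs with hs | hs
  · have h := ((hy θ hθ).hasStrictFDerivAt (by norm_num)).exp
    have he : Real.exp (logLik ℓ y θ) = ℓ θ y := Real.exp_log (hs θ hθ)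
    rw [he] at h
    refine h.congr_of_eventuallyEq ?_
    filter_upwards [hℓ.isOpen.mem_nhds hθ] with θ' hθ' using Real.exp_log (hs θ' hθ')
  · rw [hs θ hθ, zero_smul]
    refine (hasStrictFDerivAt_const (0 : ℝ) θ).congr_of_eventuallyEq ?_
    filter_upwards [hℓ.isOpen.mem_nhds hθ] with θ' hθ' using (hs θ' hθ').symm

/-- A non-integrable function has Bochner integral $0$, which contradicts total mass one. -/
lemma integrable_density {θ : EuclideanSpace ℝ (Fin d)} (hθ : θ ∈ U) : Integrable (ℓ θ) μ := by
  by_contra h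
  have := hℓ.integral_eq_one θ hθ
  rw [integral_undef h] at this
  norm_num at this

lemma lintegral_density {θ : EuclideanSpace ℝ (Fin d)} (hθ : θ ∈ U) :
    ∫⁻ y, ENNReal.ofReal (ℓ θ y) ∂μ = 1 := by
  rw [← ofReal_integral_eq_lintegral_ofReal (hℓ.integrable_density hθ)
    (Eventually.of_forall (hℓ.nonneg θ hθ)), hℓ.integral_eq_one θ hθ, ENNReal.ofReal_one]

/-- Domination of the derivatives on a ball, in the form in which it is used. -/
lemma exists_dominated {θ₀ : EuclideanSpace ℝ (Fin d)} (hθ₀ : θ₀ ∈ Θ) :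
    ∃ r > 0, ∃ H : 𝒴 → ℝ, Metric.ball θ₀ r ⊆ U ∧ Integrable H μ ∧
      ∀ᵐ y ∂μ, ∀ θ ∈ Metric.ball θ₀ r, ∀ θ' ∈ Metric.ball θ₀ r,
        ‖score ℓ y θ'‖ * ℓ θ y ≤ H y ∧ ‖score ℓ y θ'‖ ^ 2 * ℓ θ y ≤ H y ∧
        ‖hess ℓ y θ'‖ * ℓ θ y ≤ H y ∧
        (‖score ℓ y θ'‖ ^ 2 + ‖hess ℓ y θ'‖) * ℓ θ y ≤ H y := by
  obtain ⟨r, hr, H, hU, hH, h⟩ := hℓ.dominated θ₀ hθ₀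
  refine ⟨r, hr, H, hU, hH, ?_⟩
  filter_upwards [h] with y hy θ hθ θ' hθ'
  have h0 := hℓ.nonneg θ (hU hθ) y
  have h1 := hy θ hθ θ' hθ'
  change (1 + ‖score ℓ y θ'‖ ^ 2 + ‖hess ℓ y θ'‖) * ℓ θ y ≤ H y at h1
  have h2 := norm_nonneg (hess ℓ y θ')
  -- The bound on the unsquared score uses $2t\le1+t^2$.
  refine ⟨?_, ?_, ?_, ?_⟩ <;> refine le_trans (mul_le_mul_of_nonneg_right ?_ h0) h1 <;>
    nlinarith [sq_nonneg (‖score ℓ y θ'‖ - 1), sq_nonneg ‖score ℓ y θ'‖]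

/-- The score is centred, and its second moments are those of minus the second derivative. -/
lemma integral_score_eq_zero_and_sq {θ₀ : EuclideanSpace ℝ (Fin d)} (hθ₀ : θ₀ ∈ Θ)
    (v : EuclideanSpace ℝ (Fin d)) :
    ∫ y, score ℓ y θ₀ v * ℓ θ₀ y ∂μ = 0 ∧
      ∫ y, (score ℓ y θ₀ v ^ 2 + hess ℓ y θ₀ v v) * ℓ θ₀ y ∂μ = 0 := by
  obtain ⟨r, hr, H, hU, hH, hdom⟩ := hℓ.exists_dominated hθ₀
  -- Small enough for the segment in direction `v` to stay in the domination ball; the summand $1$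
  -- covers `v = 0`.
  set B : Set ℝ := Metric.ball 0 (r / (‖v‖ + 1)) with hB
  have hv : 0 < ‖v‖ + 1 := by positivity
  have hδ : 0 < r / (‖v‖ + 1) := by positivity
  have hline : ∀ t ∈ B, θ₀ + t • v ∈ Metric.ball θ₀ r := by
    intro t ht
    rw [hB, mem_ball_zero_iff, lt_div_iff₀ hv] at ht
    rw [mem_ball_iff_norm, add_sub_cancel_left, norm_smul]
    nlinarith [norm_nonneg t]
  have hBopen : ∀ t ∈ B, B ∈ 𝓝 t := fun t ht => Metric.isOpen_ball.mem_nhds ht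
  have hderivline : ∀ t : ℝ, HasDerivAt (fun t : ℝ => θ₀ + t • v) v t := fun t => by
    simpa using ((hasDerivAt_id t).smul_const v).const_add θ₀
  have hd1 : ∀ᵐ y ∂μ, ∀ t ∈ B, HasDerivAt (fun t => ℓ (θ₀ + t • v) y)
      (score ℓ y (θ₀ + t • v) v * ℓ (θ₀ + t • v) y) t := by
    filter_upwards [hℓ.ae_hasStrictFDerivAt] with y hy t ht
    have := (hy _ (hU (hline t ht))).hasFDerivAt.comp_hasDerivAt t (hderivline t)
    rw [mul_comm]
    exact this
  have hd2 : ∀ᵐ y ∂μ, ∀ t ∈ B, HasDerivAt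
      (fun t => score ℓ y (θ₀ + t • v) v * ℓ (θ₀ + t • v) y)
      ((score ℓ y (θ₀ + t • v) v ^ 2 + hess ℓ y (θ₀ + t • v) v v) * ℓ (θ₀ + t • v) y) t := by
    filter_upwards [hd1, hℓ.ae_hasFDerivAt_score] with y hy1 hy t ht
    have h1 := (hy _ (hU (hline t ht))).comp_hasDerivAt t (hderivline t)
    have h2 : HasDerivAt (fun t => score ℓ y (θ₀ + t • v) v) (hess ℓ y (θ₀ + t • v) v v) t := by
      simpa using h1.clm_apply (hasDerivAt_const t v)
    convert! h2.mul (hy1 t ht) using 1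
    ring
  have hmeas : ∀ t ∈ B, AEStronglyMeasurable (fun y => score ℓ y (θ₀ + t • v) v) μ :=
    fun t ht => (hℓ.aestronglyMeasurable_score (hU (hline t ht))).apply_continuousLinearMap v
  have hmeas2 : ∀ t ∈ B, AEStronglyMeasurable (fun y => hess ℓ y (θ₀ + t • v) v v) μ :=
    fun t ht => ((hℓ.aestronglyMeasurable_hess (hU (hline t ht))).apply_continuousLinearMap
      v).apply_continuousLinearMap v
  have hmd : ∀ t : ℝ, AEStronglyMeasurable (ℓ (θ₀ + t • v)) μ := fun t =>
    (hℓ.measurable_density _).aestronglyMeasurable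
  have h0 : (0 : ℝ) ∈ B := Metric.mem_ball_self hδ
  have hb1 : ∀ᵐ y ∂μ, ∀ t ∈ B,
      ‖score ℓ y (θ₀ + t • v) v * ℓ (θ₀ + t • v) y‖ ≤ ‖v‖ * H y := by
    filter_upwards [hdom] with y hy t ht
    have hn := hℓ.nonneg _ (hU (hline t ht)) y
    rw [norm_mul, Real.norm_of_nonneg hn]
    calc _ ≤ ‖score ℓ y (θ₀ + t • v)‖ * ‖v‖ * ℓ (θ₀ + t • v) y := by
            gcongr; exact ContinuousLinearMap.le_opNorm _ _
      _ = ‖v‖ * (‖score ℓ y (θ₀ + t • v)‖ * ℓ (θ₀ + t • v) y) := by ring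
      _ ≤ _ := by gcongr; exact (hy _ (hline t ht) _ (hline t ht)).1
  have hb2 : ∀ᵐ y ∂μ, ∀ t ∈ B,
      ‖(score ℓ y (θ₀ + t • v) v ^ 2 + hess ℓ y (θ₀ + t • v) v v) * ℓ (θ₀ + t • v) y‖
        ≤ ‖v‖ ^ 2 * H y := by
    filter_upwards [hdom] with y hy t ht
    have hn := hℓ.nonneg _ (hU (hline t ht)) y
    rw [norm_mul, Real.norm_of_nonneg hn]
    calc _ ≤ ((‖score ℓ y (θ₀ + t • v)‖ * ‖v‖) ^ 2 + ‖hess ℓ y (θ₀ + t • v)‖ * ‖v‖ * ‖v‖)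
            * ℓ (θ₀ + t • v) y := by
            gcongr
            refine (norm_add_le _ _).trans (add_le_add ?_ (ContinuousLinearMap.le_opNorm₂ _ _ _))
            rw [norm_pow]
            gcongr
            exact ContinuousLinearMap.le_opNorm _ _
      _ = ‖v‖ ^ 2 * ((‖score ℓ y (θ₀ + t • v)‖ ^ 2 + ‖hess ℓ y (θ₀ + t • v)‖)
            * ℓ (θ₀ + t • v) y) := by ring
      _ ≤ _ := by gcongr; exact (hy _ (hline t ht) _ (hline t ht)).2.2.2
  have hint : ∀ t ∈ B, ∫ y, score ℓ y (θ₀ + t • v) v * ℓ (θ₀ + t • v) y ∂μ = 0 ∧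
      Integrable (fun y => score ℓ y (θ₀ + t • v) v * ℓ (θ₀ + t • v) y) μ := by
    intro t ht
    have h := hasDerivAt_integral_of_dominated_loc_of_deriv_le
      (F := fun t y => ℓ (θ₀ + t • v) y) (x₀ := t) (hBopen t ht)
      (Eventually.of_forall hmd) (hℓ.integrable_density (hU (hline t ht)))
      ((hmeas t ht).mul (hmd t)) hb1 (hH.const_mul _) hd1
    -- The integral of the density is constantly $1$ along the line, so its derivative is also $0$.
    refine ⟨h.2.unique ?_, h.1⟩
    refine (hasDerivAt_const t (1 : ℝ)).congr_of_eventuallyEq ?_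
    filter_upwards [hBopen t ht] with t' ht'
    exact hℓ.integral_eq_one _ (hU (hline t' ht'))
  refine ⟨by simpa using (hint 0 h0).1, ?_⟩
  have h := hasDerivAt_integral_of_dominated_loc_of_deriv_le
    (F := fun t y => score ℓ y (θ₀ + t • v) v * ℓ (θ₀ + t • v) y) (x₀ := 0) (hBopen 0 h0)
    (by filter_upwards [hBopen 0 h0] with t ht using (hmeas t ht).mul (hmd t)) (hint 0 h0).2
    ((((hmeas 0 h0).pow 2).add (hmeas2 0 h0)).mul (hmd 0)) hb2 (hH.const_mul _) hd2
  -- Same argument one order higher: the mean of the score vanishes along the whole line, so its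
  -- derivative at $0$ does too.
  have h' := h.2.unique ((hasDerivAt_const (0 : ℝ) (0 : ℝ)).congr_of_eventuallyEq (by
    filter_upwards [hBopen 0 h0] with t ht using (hint t ht).1))
  simpa using h'

end IsRegularModel

end Model

set_option linter.unusedSectionVars false

/-! ### Fisher information, Jeffreys density and standardized coordinates. -/

section Fisher

variable {𝒴 : Type*} [MeasurableSpace 𝒴] {μ : Measure 𝒴} {d : ℕ}
  {ℓ : EuclideanSpace ℝ (Fin d) → 𝒴 → ℝ} {U Θ : Set (EuclideanSpace ℝ (Fin d))}

lemma hess_apply_eq_sum (y : 𝒴) (θ v w : EuclideanSpace ℝ (Fin d)) :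
    hess ℓ y θ v w = ∑ i, ∑ j, v i * w j *
      hess ℓ y θ (EuclideanSpace.single i 1) (EuclideanSpace.single j 1) := by
  have hv : ∀ v : EuclideanSpace ℝ (Fin d), v = ∑ i, v i • EuclideanSpace.single i (1 : ℝ) := by
    intro v
    conv_lhs => rw [← (EuclideanSpace.basisFun (Fin d) ℝ).sum_repr v]
    simp
  conv_lhs => rw [hv v, hv w]
  simp only [map_sum, map_smul, sum_apply, smul_apply, smul_eq_mul, Finset.mul_sum, mul_assoc]
  rw [Finset.sum_comm]
  refine Finset.sum_congr rfl fun i _ => Finset.sum_congr rfl fun j _ => by ring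

namespace IsRegularModel

variable (hℓ : IsRegularModel μ ℓ U Θ)
include hℓ

lemma aestronglyMeasurable_hess_apply {θ : EuclideanSpace ℝ (Fin d)} (hθ : θ ∈ U)
    (v w : EuclideanSpace ℝ (Fin d)) : AEStronglyMeasurable (fun y => hess ℓ y θ v w) μ :=
  ((hℓ.aestronglyMeasurable_hess hθ).apply_continuousLinearMap v).apply_continuousLinearMap w

lemma integrable_hess_apply {θ : EuclideanSpace ℝ (Fin d)} (hθ : θ ∈ Θ)
    (v w : EuclideanSpace ℝ (Fin d)) : Integrable (fun y => hess ℓ y θ v w * ℓ θ y) μ := by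
  obtain ⟨r, hr, H, hU, hH, hdom⟩ := hℓ.exists_dominated hθ
  refine (hH.const_mul (‖v‖ * ‖w‖)).mono' ((hℓ.aestronglyMeasurable_hess_apply (hℓ.subset hθ) v w).mul
    (hℓ.measurable_density θ).aestronglyMeasurable) ?_
  filter_upwards [hdom] with y hy
  have hb := Metric.mem_ball_self (x := θ) hr
  have hn := hℓ.nonneg θ (hℓ.subset hθ) y
  rw [norm_mul, Real.norm_of_nonneg hn]
  calc _ ≤ (‖hess ℓ y θ‖ * ‖v‖ * ‖w‖) * ℓ θ y := by
        gcongr; exact ContinuousLinearMap.le_opNorm₂ _ _ _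
    _ = ‖v‖ * ‖w‖ * (‖hess ℓ y θ‖ * ℓ θ y) := by ring
    _ ≤ _ := by gcongr; exact (hy θ hb θ hb).2.2.1

lemma integrable_score_sq {θ : EuclideanSpace ℝ (Fin d)} (hθ : θ ∈ Θ)
    (v : EuclideanSpace ℝ (Fin d)) : Integrable (fun y => score ℓ y θ v ^ 2 * ℓ θ y) μ := by
  obtain ⟨r, hr, H, hU, hH, hdom⟩ := hℓ.exists_dominated hθ
  refine (hH.const_mul (‖v‖ ^ 2)).mono'
    ((((hℓ.aestronglyMeasurable_score (hℓ.subset hθ)).apply_continuousLinearMap v).pow 2).mul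
      (hℓ.measurable_density θ).aestronglyMeasurable) ?_
  filter_upwards [hdom] with y hy
  have hb := Metric.mem_ball_self (x := θ) hr
  have hn := hℓ.nonneg θ (hℓ.subset hθ) y
  rw [norm_mul, Real.norm_of_nonneg hn, norm_pow]
  calc _ ≤ (‖score ℓ y θ‖ * ‖v‖) ^ 2 * ℓ θ y := by
        gcongr; exact ContinuousLinearMap.le_opNorm _ _
    _ = ‖v‖ ^ 2 * (‖score ℓ y θ‖ ^ 2 * ℓ θ y) := by ring
    _ ≤ _ := by gcongr; exact (hy θ hb θ hb).2.1

lemma fisherInformation_quadratic {θ : EuclideanSpace ℝ (Fin d)} (hθ : θ ∈ Θ)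
    (v : EuclideanSpace ℝ (Fin d)) :
    v.ofLp ⬝ᵥ (fisherInformation μ ℓ θ).mulVec v.ofLp = - ∫ y, hess ℓ y θ v v * ℓ θ y ∂μ := by
  have h1 : ∀ y, hess ℓ y θ v v * ℓ θ y = ∑ i, ∑ j, v i * v j *
      (hess ℓ y θ (EuclideanSpace.single i 1) (EuclideanSpace.single j 1) * ℓ θ y) := by
    intro y
    rw [hess_apply_eq_sum, Finset.sum_mul]
    refine Finset.sum_congr rfl fun i _ => ?_
    rw [Finset.sum_mul]
    exact Finset.sum_congr rfl fun j _ => by ring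
  simp_rw [h1]
  have hint := fun i j : Fin d => (hℓ.integrable_hess_apply hθ (EuclideanSpace.single i 1)
    (EuclideanSpace.single j 1)).const_mul (v i * v j)
  rw [integral_finsetSum _ fun i _ => integrable_finsetSum _ fun j _ => hint i j, dotProduct,
    ← Finset.sum_neg_distrib]
  refine Finset.sum_congr rfl fun i _ => ?_
  rw [integral_finsetSum _ fun j _ => hint i j, Matrix.mulVec, dotProduct, Finset.mul_sum,
    ← Finset.sum_neg_distrib]
  refine Finset.sum_congr rfl fun j _ => ?_
  rw [integral_const_mul]
  change v i * (-(∫ y, hess ℓ y θ _ _ * ℓ θ y ∂μ) * v j) = _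
  ring

/-- The variance of the score is given by the Fisher information. -/
lemma integral_score_sq {θ : EuclideanSpace ℝ (Fin d)} (hθ : θ ∈ Θ)
    (v : EuclideanSpace ℝ (Fin d)) :
    ∫ y, score ℓ y θ v ^ 2 * ℓ θ y ∂μ =
      v.ofLp ⬝ᵥ (fisherInformation μ ℓ θ).mulVec v.ofLp := by
  have h := (hℓ.integral_score_eq_zero_and_sq hθ v).2
  simp_rw [add_mul] at h
  rw [integral_add (hℓ.integrable_score_sq hθ v) (hℓ.integrable_hess_apply hθ v v)] at h
  rw [hℓ.fisherInformation_quadratic hθ]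
  linarith

lemma integral_score_sq_pos {θ : EuclideanSpace ℝ (Fin d)} (hθ : θ ∈ Θ)
    {v : EuclideanSpace ℝ (Fin d)} (hv : v ≠ 0) : 0 < ∫ y, score ℓ y θ v ^ 2 * ℓ θ y ∂μ := by
  rw [hℓ.integral_score_sq hθ]
  have := (hℓ.fisher_posDef θ hθ).dotProduct_mulVec_pos (x := v.ofLp) (by simpa using hv)
  simpa using this

/-- Dominated convergence: the integrand is continuous in the parameter and `H` dominates it on a
ball. -/
lemma continuousOn_fisherInformation : ContinuousOn (fisherInformation μ ℓ) Θ := by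
  intro θ₀ hθ₀
  obtain ⟨r, hr, H, hU, hH, hdom⟩ := hℓ.exists_dominated hθ₀
  have hball := Metric.ball_mem_nhds θ₀ hr
  refine ContinuousAt.continuousWithinAt ?_
  refine continuousAt_pi.2 fun i => continuousAt_pi.2 fun j => ?_
  refine ContinuousAt.neg ?_
  refine continuousAt_of_dominated (bound := H)
    (F := fun θ y => hess ℓ y θ (EuclideanSpace.single i 1) (EuclideanSpace.single j 1) * ℓ θ y)
    ?_ ?_ hH ?_
  · filter_upwards [hball] with θ hθ
    exact (((hℓ.aestronglyMeasurable_hess (hU hθ)).apply_continuousLinearMap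
      _).apply_continuousLinearMap _).mul (hℓ.measurable_density θ).aestronglyMeasurable
  · filter_upwards [hball] with θ hθ
    filter_upwards [hdom] with y hy
    have hn := hℓ.nonneg θ (hU hθ) y
    rw [norm_mul, Real.norm_of_nonneg hn]
    refine le_trans ?_ (hy θ hθ θ hθ).2.2.1
    gcongr
    refine (ContinuousLinearMap.le_opNorm₂ _ _ _).trans ?_
    simp
  · filter_upwards [hℓ.ae_continuousAt_hess, hℓ.ae_hasStrictFDerivAt] with y h1 h2
    have hc := h1 θ₀ (hℓ.subset hθ₀)
    exact ((hc.clm_apply continuousAt_const).clm_apply continuousAt_const).mul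
      (h2 θ₀ (hℓ.subset hθ₀)).continuousAt

lemma continuousOn_jeffreys : ContinuousOn (jeffreys μ ℓ) Θ := by
  unfold jeffreys
  have h : ContinuousOn (fun θ => (fisherInformation μ ℓ θ).det) Θ :=
    (continuous_id.matrix_det (A := fun M : Matrix (Fin d) (Fin d) ℝ => M)).comp_continuousOn
      hℓ.continuousOn_fisherInformation
  exact h.abs.sqrt

lemma jeffreys_pos {θ : EuclideanSpace ℝ (Fin d)} (hθ : θ ∈ Θ) : 0 < jeffreys μ ℓ θ :=
  Real.sqrt_pos.2 (abs_pos.2 (hℓ.fisher_posDef θ hθ).det_pos.ne')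

/-- A linear change of variables that standardizes the Fisher information. -/
lemma exists_standardization {θ : EuclideanSpace ℝ (Fin d)} (hθ : θ ∈ Θ) :
    ∃ A : EuclideanSpace ℝ (Fin d) ≃L[ℝ] EuclideanSpace ℝ (Fin d),
      |(A : EuclideanSpace ℝ (Fin d) →L[ℝ] EuclideanSpace ℝ (Fin d)).det| =
        (jeffreys μ ℓ θ)⁻¹ ∧
      (∀ v, ∫ y, score ℓ y θ (A v) ^ 2 * ℓ θ y ∂μ = ‖v‖ ^ 2) ∧
      ∀ v, ∫ y, hess ℓ y θ (A v) (A v) * ℓ θ y ∂μ = - ‖v‖ ^ 2 := by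
  set I := fisherInformation μ ℓ θ with hI
  have hpd := hℓ.fisher_posDef θ hθ
  -- A factor $B$ with $I=B^{\mathsf T}B$ gives the standardization $A=B^{-1}$, and $|\det
  -- B|=\sqrt{\det I}$ is the Jeffreys density.
  obtain ⟨B, hB⟩ : ∃ B : Matrix (Fin d) (Fin d) ℝ, I = B.transpose * B := by
    open scoped MatrixOrder in
    refine ⟨CFC.sqrt I, ?_⟩
    have h1 := (Matrix.nonneg_iff_posSemidef.1 (CFC.sqrt_nonneg I)).1
    rw [Matrix.IsHermitian, Matrix.conjTranspose_eq_transpose_of_trivial] at h1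
    rw [h1, CFC.sqrt_mul_sqrt_self I (Matrix.nonneg_iff_posSemidef.2 hpd.posSemidef)]
  have hdet : I.det = B.det ^ 2 := by rw [hB, Matrix.det_mul, Matrix.det_transpose, sq]
  have hB0 : IsUnit B.det := by
    rw [isUnit_iff_ne_zero]
    intro h
    have := hpd.det_pos
    rw [← hI, hdet, h] at this
    simp at this
  set A₀ : EuclideanSpace ℝ (Fin d) ≃ₗ[ℝ] EuclideanSpace ℝ (Fin d) :=
    LinearEquiv.ofLinearMap (B⁻¹.toLpLin 2 2) (B.toLpLin 2 2)
      (by rw [← Matrix.toLpLin_mul_same, Matrix.nonsing_inv_mul _ hB0, Matrix.toLpLin_one])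
      (by rw [← Matrix.toLpLin_mul_same, Matrix.mul_nonsing_inv _ hB0, Matrix.toLpLin_one])
    with hA₀
  have hquad : ∀ v, (A₀ v).ofLp ⬝ᵥ I.mulVec (A₀ v).ofLp = ‖v‖ ^ 2 := by
    intro v
    have h1 : (A₀ v).ofLp = B⁻¹.mulVec v.ofLp := rfl
    have h2 : B.mulVec (B⁻¹.mulVec v.ofLp) = v.ofLp := by
      rw [Matrix.mulVec_mulVec, Matrix.mul_nonsing_inv _ hB0, Matrix.one_mulVec]
    rw [h1, hB, ← Matrix.mulVec_mulVec, Matrix.dotProduct_mulVec, Matrix.vecMul_transpose, h2,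
      EuclideanSpace.norm_sq_eq, dotProduct]
    simp [sq]
  refine ⟨A₀.toContinuousLinearEquiv, ?_, ?_, ?_⟩
  · have h1 : (A₀.toContinuousLinearEquiv :
        EuclideanSpace ℝ (Fin d) →L[ℝ] EuclideanSpace ℝ (Fin d)).det = B⁻¹.det :=
      LinearMap.det_toLpLin 2 B⁻¹
    rw [h1, Matrix.det_nonsing_inv, Ring.inverse_eq_inv', abs_inv, jeffreys, ← hI, hdet, abs_pow,
      Real.sqrt_sq (abs_nonneg _)]
  · intro v
    rw [hℓ.integral_score_sq hθ, ← hI]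
    exact hquad v
  · intro v
    have := hℓ.fisherInformation_quadratic hθ (A₀ v)
    rw [← hI, hquad] at this
    rw [this, neg_neg]
    rfl

end IsRegularModel

end Fisher

/-! ### A refined mean inequality and limits of shrinking mixtures. -/

section Separation

set_option linter.unusedSectionVars false

/-- A refinement of the weighted inequality of arithmetic and geometric means. -/
lemma gap_add_geom_mean_le {α a b : ℝ} (hα : α ∈ Ioo (0 : ℝ) 1) (ha : 0 ≤ a) (hb : 0 ≤ b) :
    min α (1 - α) / 2 * ((a - b) ^ 2 / (a + b)) + a ^ α * b ^ (1 - α) ≤ α * a + (1 - α) * b := by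
  -- The inequality is invariant under exchanging $(\alpha,a)$ with $(1-\alpha,b)$.
  wlog h : α ≤ 1 / 2 generalizing α a b
  · have := this (α := 1 - α) (a := b) (b := a) ⟨by linarith [hα.2], by linarith [hα.1]⟩ hb ha
      (by linarith)
    rw [sub_sub_cancel, min_comm] at this
    rw [show (a - b) ^ 2 = (b - a) ^ 2 by ring, add_comm a b]
    linarith
  obtain ⟨hα0, hα1⟩ := hα
  rw [min_eq_left (by linarith)]
  set s := Real.sqrt a with hs
  set t := Real.sqrt b with ht
  have has : a = s ^ 2 := (Real.sq_sqrt ha).symm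
  have hbt : b = t ^ 2 := (Real.sq_sqrt hb).symm
  have hs0 : 0 ≤ s := Real.sqrt_nonneg _
  have ht0 : 0 ≤ t := Real.sqrt_nonneg _
  have h1 : (a - b) ^ 2 / (a + b) ≤ 2 * (s - t) ^ 2 := by
    refine div_le_of_le_mul₀ (by positivity) (by positivity) ?_
    rw [has, hbt]
    have : (s ^ 2 - t ^ 2) ^ 2 = (s - t) ^ 2 * (s + t) ^ 2 := by ring
    nlinarith [mul_nonneg (sq_nonneg (s - t)) (sq_nonneg (s - t))]
  -- Written as $(\sqrt{ab})^{2\alpha}\,b^{1-2\alpha}$, the geometric mean is bounded by the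
  -- weighted inequality. What is lost to $\alpha a+(1-\alpha)b$ is then exactly $\alpha(\sqrt
  -- a-\sqrt b)^2$, which `h1` compares with the gap.
  have h2 : a ^ α * b ^ (1 - α) ≤ 2 * α * (s * t) + (1 - 2 * α) * b := by
    have := Real.geom_mean_le_arith_mean2_weighted (w₁ := 2 * α) (w₂ := 1 - 2 * α)
      (p₁ := s * t) (p₂ := b) (by linarith) (by linarith) (by positivity) hb (by ring)
    refine le_trans (le_of_eq ?_) this
    have e1 : a ^ α = s ^ (2 * α) := by
      rw [has, ← Real.rpow_natCast s 2, ← Real.rpow_mul hs0]; norm_num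
    have e2 : ∀ γ : ℝ, b ^ γ = t ^ (2 * γ) := by
      intro γ
      rw [hbt, ← Real.rpow_natCast t 2, ← Real.rpow_mul ht0]; norm_num
    rw [e1, e2, e2, Real.mul_rpow hs0 ht0, mul_assoc, ← Real.rpow_add_of_nonneg ht0 (by linarith)
      (by linarith)]
    ring_nf
  nlinarith

variable {𝒴 : Type*} [MeasurableSpace 𝒴] {μ : Measure 𝒴} {d : ℕ}
  {ℓ : EuclideanSpace ℝ (Fin d) → 𝒴 → ℝ} {U Θ : Set (EuclideanSpace ℝ (Fin d))}

/-- The densities of the model as extended non-negative numbers. -/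
def edensity (ℓ : EuclideanSpace ℝ (Fin d) → 𝒴 → ℝ) (θ : EuclideanSpace ℝ (Fin d)) (y : 𝒴) :
    ℝ≥0∞ := ENNReal.ofReal (ℓ θ y)

lemma abs_toReal_lintegral_edensity_sub_le {A : Set (EuclideanSpace ℝ (Fin d))}
    {ρ : Measure (EuclideanSpace ℝ (Fin d))} [IsProbabilityMeasure ρ] (hρ : ρ Aᶜ = 0) {y : 𝒴}
    {a η : ℝ} (h0 : ∀ x ∈ A, 0 ≤ ℓ x y) (h : ∀ x ∈ A, |ℓ x y - a| ≤ η) :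
    |(∫⁻ x, edensity ℓ x y ∂ρ).toReal - a| ≤ η := by
  have hA : ∀ᵐ x ∂ρ, x ∈ A := mem_ae_iff.2 hρ
  have hle : ∫⁻ x, edensity ℓ x y ∂ρ ≤ ENNReal.ofReal (a + η) := by
    calc _ ≤ ∫⁻ _, ENNReal.ofReal (a + η) ∂ρ := by
          refine lintegral_mono_ae (hA.mono fun x hx => ENNReal.ofReal_le_ofReal ?_)
          linarith [(abs_le.1 (h x hx)).2]
      _ = _ := by simp
  have hge : ENNReal.ofReal (a - η) ≤ ∫⁻ x, edensity ℓ x y ∂ρ := by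
    calc _ = ∫⁻ _, ENNReal.ofReal (a - η) ∂ρ := by simp
      _ ≤ _ := by
          refine lintegral_mono_ae (hA.mono fun x hx => ENNReal.ofReal_le_ofReal ?_)
          linarith [(abs_le.1 (h x hx)).1]
  obtain ⟨x, hx⟩ := hA.exists
  have hpos : 0 ≤ a + η := by linarith [h0 x hx, (abs_le.1 (h x hx)).2]
  have hfin := ne_top_of_le_ne_top ENNReal.ofReal_ne_top hle
  have h1 := (ENNReal.toReal_le_of_le_ofReal hpos hle)
  have h2 := (ENNReal.ofReal_le_iff_le_toReal hfin).1 hge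
  exact abs_le.2 ⟨by linarith, by linarith⟩

/-- Likelihood ratios along a shrinking family of mixtures converge to the directional
derivative. -/
lemma tendsto_slope_mixture {y : 𝒴} {θ₀ v : EuclideanSpace ℝ (Fin d)}
    {D : EuclideanSpace ℝ (Fin d) →L[ℝ] ℝ} (hD : HasStrictFDerivAt (fun θ => ℓ θ y) D θ₀)
    {θ x : ℕ → EuclideanSpace ℝ (Fin d)} {δ ε : ℕ → ℝ} (hδ : ∀ n, 0 < δ n)
    (hδx : ∀ n, ‖x n - θ n‖ = δ n) (hθ : Tendsto θ atTop (𝓝 θ₀)) (hx : Tendsto x atTop (𝓝 θ₀))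
    (hε : Tendsto ε atTop (𝓝 0)) (hv : Tendsto (fun n => (δ n)⁻¹ • (x n - θ n)) atTop (𝓝 v))
    {A : ℕ → Set (EuclideanSpace ℝ (Fin d))} (hA : ∀ n, ∀ z ∈ A n, ‖z - x n‖ ≤ ε n * δ n)
    {ρ : ℕ → Measure (EuclideanSpace ℝ (Fin d))} (hρp : ∀ n, IsProbabilityMeasure (ρ n))
    (hρ : ∀ n, ρ n (A n)ᶜ = 0) (h0 : ∀ n, ∀ z ∈ A n, 0 ≤ ℓ z y) :
    Tendsto (fun n => ((∫⁻ z, edensity ℓ z y ∂(ρ n)).toReal - ℓ (θ n) y) / δ n) atTop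
      (𝓝 (D v)) := by
  have hDv : Tendsto (fun n => D ((δ n)⁻¹ • (x n - θ n))) atTop (𝓝 (D v)) :=
    (D.continuous.tendsto _).comp hv
  have hδ0 : Tendsto δ atTop (𝓝 0) := by
    have := (hx.sub hθ).norm
    simpa [hδx] using this
  refine tendsto_of_tendsto_of_dist hDv ?_
  rw [Metric.tendsto_atTop]
  intro η hη
  set η' := η / (4 * (‖D‖ + 1)) with hη'
  have hη'0 : 0 < η' := by positivity
  have hη1 : 0 < η / 8 := by positivity
  -- Strict differentiability is needed since both endpoints `z` and `θ n` move. The constant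
  -- $\eta/8$ absorbs $\|z-\theta_n\|\le2\delta_n$ and leaves $\eta/4$.
  have hs := (hasStrictFDerivAt_iff_isLittleO.1 hD).def hη1
  obtain ⟨W, hW, hW'⟩ := Metric.eventually_nhds_iff_ball.1 hs
  have e1 : ∀ᶠ n in atTop, dist (θ n) θ₀ < W := hθ (Metric.ball_mem_nhds θ₀ hW)
  have e2 : ∀ᶠ n in atTop, dist (x n) θ₀ < W / 2 := hx (Metric.ball_mem_nhds θ₀ (half_pos hW))
  have e3 : ∀ᶠ n in atTop, ε n < min η' 1 := hε.eventually (gt_mem_nhds (lt_min hη'0 one_pos))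
  have e4 : ∀ᶠ n in atTop, δ n < W / 2 := hδ0.eventually (gt_mem_nhds (half_pos hW))
  obtain ⟨N, hN⟩ := eventually_atTop.1 (e1.and (e2.and (e3.and e4)))
  refine ⟨N, fun n hn => ?_⟩
  obtain ⟨h1, h2, h3, h4⟩ := hN n hn
  have hp := hρp n
  have hδn := hδ n
  have key : ∀ z ∈ A n, |ℓ z y - (ℓ (θ n) y + D (x n - θ n))| ≤ η / 2 * δ n := by
    intro z hz
    have hzx := hA n z hz
    have hε1 : ε n * δ n ≤ 1 * δ n := by
      gcongr; exact (h3.le.trans (min_le_right _ _))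
    have hε2 : ε n * δ n ≤ η' * δ n := by
      gcongr; exact (h3.le.trans (min_le_left _ _))
    have hzW : dist z θ₀ < W := by
      calc dist z θ₀ ≤ dist z (x n) + dist (x n) θ₀ := dist_triangle _ _ _
        _ < W := by rw [dist_eq_norm]; linarith
    have hst := hW' (z, θ n) (by
      rw [Metric.mem_ball, Prod.dist_eq, max_lt_iff]
      exact ⟨hzW, h1⟩)
    have hzθ : ‖z - θ n‖ ≤ 2 * δ n := by
      calc ‖z - θ n‖ ≤ ‖z - x n‖ + ‖x n - θ n‖ := by
            simpa using norm_add_le (z - x n) (x n - θ n)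
        _ ≤ _ := by rw [hδx]; linarith
    have hst' : |ℓ z y - ℓ (θ n) y - D (z - θ n)| ≤ η / 4 * δ n := by
      refine (show _ ≤ η / 8 * ‖z - θ n‖ from hst).trans ?_
      nlinarith
    have hDz : |D (z - x n)| ≤ η / 4 * δ n := by
      calc |D (z - x n)| ≤ ‖D‖ * ‖z - x n‖ := D.le_opNorm _
        _ ≤ (‖D‖ + 1) * (η' * δ n) := by gcongr <;> linarith
        _ = η / 4 * δ n := by rw [hη']; field_simp
    have e : ℓ z y - (ℓ (θ n) y + D (x n - θ n)) =
        (ℓ z y - ℓ (θ n) y - D (z - θ n)) + D (z - x n) := by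
      rw [show z - θ n = (z - x n) + (x n - θ n) by abel, map_add]; ring
    rw [e]
    refine (abs_add_le _ _).trans ?_
    linarith
  have hfin := abs_toReal_lintegral_edensity_sub_le (hρ n) (h0 n) key
  have : dist (D ((δ n)⁻¹ • (x n - θ n)))
      (((∫⁻ z, edensity ℓ z y ∂(ρ n)).toReal - ℓ (θ n) y) / δ n) ≤ η / 2 := by
    rw [dist_comm, Real.dist_eq, map_smul, smul_eq_mul]
    have e : ((∫⁻ z, edensity ℓ z y ∂(ρ n)).toReal - ℓ (θ n) y) / δ n - (δ n)⁻¹ * D (x n - θ n)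
        = ((∫⁻ z, edensity ℓ z y ∂(ρ n)).toReal - (ℓ (θ n) y + D (x n - θ n))) / δ n := by
      field_simp; ring
    rw [e, abs_div, abs_of_pos hδn, div_le_iff₀ hδn]
    exact hfin
  rw [Real.dist_eq, sub_zero, abs_of_nonneg dist_nonneg]
  linarith

/-- The zeroth-order companion of `tendsto_slope_mixture`: continuity makes averages over sets
shrinking to `x₀` converge to the value there. -/
lemma tendsto_mixture {y : 𝒴} {x₀ : EuclideanSpace ℝ (Fin d)}
    (hc : ContinuousAt (fun θ => ℓ θ y) x₀)
    {x : ℕ → EuclideanSpace ℝ (Fin d)} {r : ℕ → ℝ} (hx : Tendsto x atTop (𝓝 x₀))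
    (hr : Tendsto r atTop (𝓝 0))
    {A : ℕ → Set (EuclideanSpace ℝ (Fin d))} (hA : ∀ n, ∀ z ∈ A n, ‖z - x n‖ ≤ r n)
    {ρ : ℕ → Measure (EuclideanSpace ℝ (Fin d))} (hρp : ∀ n, IsProbabilityMeasure (ρ n))
    (hρ : ∀ n, ρ n (A n)ᶜ = 0) (h0 : ∀ n, ∀ z ∈ A n, 0 ≤ ℓ z y) :
    Tendsto (fun n => (∫⁻ z, edensity ℓ z y ∂(ρ n)).toReal) atTop (𝓝 (ℓ x₀ y)) := by
  rw [Metric.tendsto_atTop]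
  intro η hη
  obtain ⟨W, hW, hW'⟩ := Metric.continuousAt_iff.1 hc (η / 2) (half_pos hη)
  have e2 : ∀ᶠ n in atTop, dist (x n) x₀ < W / 2 := hx (Metric.ball_mem_nhds x₀ (half_pos hW))
  have e4 : ∀ᶠ n in atTop, r n < W / 2 := hr.eventually (gt_mem_nhds (half_pos hW))
  obtain ⟨N, hN⟩ := eventually_atTop.1 (e2.and e4)
  refine ⟨N, fun n hn => ?_⟩
  have hp := hρp n
  obtain ⟨h2, h4⟩ := hN n hn
  have := abs_toReal_lintegral_edensity_sub_le (a := ℓ x₀ y) (η := η / 2) (hρ n) (h0 n) (by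
    intro z hz
    have hzx := hA n z hz
    have hzW : dist z x₀ < W := by
      calc dist z x₀ ≤ dist z (x n) + dist (x n) x₀ := dist_triangle _ _ _
        _ < W := by rw [dist_eq_norm]; linarith
    exact (hW' hzW).le)
  rw [Real.dist_eq]
  linarith

namespace IsRegularModel

variable (hℓ : IsRegularModel μ ℓ U Θ)
include hℓ

lemma measurable_edensity : Measurable (Function.uncurry (edensity ℓ)) :=
  hℓ.measurable.ennreal_ofReal

lemma lintegral_edensity {θ : EuclideanSpace ℝ (Fin d)} (hθ : θ ∈ U) :
    ∫⁻ y, edensity ℓ θ y ∂μ = 1 := hℓ.lintegral_density hθ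

/-- The refined mean inequality, integrated between two densities of mass one. A Hellinger integral
close to $1$ thus forces the weighted square distance between the densities to be small. -/
lemma lintegral_gap_add_affinity_le [SigmaFinite μ] {α : ℝ} (hα : α ∈ Ioo (0 : ℝ) 1)
    {θ : EuclideanSpace ℝ (Fin d)} (hθ : θ ∈ U) {ρ : Measure (EuclideanSpace ℝ (Fin d))}
    [IsProbabilityMeasure ρ] (hρ : ∀ᵐ x ∂ρ, x ∈ U) :
    ∫⁻ y, ENNReal.ofReal (min α (1 - α) / 2 *
        (((∫⁻ x, edensity ℓ x y ∂ρ).toReal - ℓ θ y) ^ 2 /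
          ((∫⁻ x, edensity ℓ x y ∂ρ).toReal + ℓ θ y))) ∂μ +
      ∫⁻ y, (∫⁻ x, edensity ℓ x y ∂ρ) ^ α * edensity ℓ θ y ^ (1 - α) ∂μ ≤ 1 := by
  have hL := hℓ.measurable_edensity
  have hq : Measurable fun y => ∫⁻ x, edensity ℓ x y ∂ρ :=
    (hL.comp measurable_swap).lintegral_prod_right'
  have hθm : Measurable (edensity ℓ θ) := hL.of_uncurry_left
  have hqint : ∫⁻ y, ∫⁻ x, edensity ℓ x y ∂ρ ∂μ = 1 := by
    rw [lintegral_lintegral_swap (f := fun y x => edensity ℓ x y)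
        (hL.comp measurable_swap).aemeasurable,
      lintegral_congr_ae (g := fun _ => 1) (hρ.mono fun x hx => hℓ.lintegral_edensity hx)]
    simp
  have hqfin : ∀ᵐ y ∂μ, ∫⁻ x, edensity ℓ x y ∂ρ < ∞ :=
    ae_lt_top hq (by rw [hqint]; exact ENNReal.one_ne_top)
  have hm : Measurable fun y => (∫⁻ x, edensity ℓ x y ∂ρ) ^ α * edensity ℓ θ y ^ (1 - α) :=
    (hq.pow_const _).mul (hθm.pow_const _)
  rw [← lintegral_add_right _ hm]
  calc _ ≤ ∫⁻ y, (ENNReal.ofReal α * ∫⁻ x, edensity ℓ x y ∂ρ) +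
        ENNReal.ofReal (1 - α) * edensity ℓ θ y ∂μ := by
        refine lintegral_mono_ae (hqfin.mono fun y hy => ?_)
        have hl0 := hℓ.nonneg θ hθ y
        set q := ∫⁻ x, edensity ℓ x y ∂ρ with hqdef
        have hq' : q = ENNReal.ofReal q.toReal := (ENNReal.ofReal_toReal hy.ne).symm
        have hα0 : 0 < 1 - α := by linarith [hα.2]
        have hg := gap_add_geom_mean_le hα (a := q.toReal) ENNReal.toReal_nonneg hl0
        have e1 : q ^ α * edensity ℓ θ y ^ (1 - α) =
            ENNReal.ofReal (q.toReal ^ α * ℓ θ y ^ (1 - α)) := by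
          conv_lhs => rw [hq']
          rw [edensity, ENNReal.ofReal_rpow_of_nonneg ENNReal.toReal_nonneg hα.1.le,
            ENNReal.ofReal_rpow_of_nonneg hl0 hα0.le, ENNReal.ofReal_mul (by positivity)]
        have e2 : ENNReal.ofReal α * q + ENNReal.ofReal (1 - α) * edensity ℓ θ y =
            ENNReal.ofReal (α * q.toReal + (1 - α) * ℓ θ y) := by
          conv_lhs => rw [hq']
          rw [edensity, ENNReal.ofReal_add (mul_nonneg hα.1.le ENNReal.toReal_nonneg)
            (by positivity), ENNReal.ofReal_mul hα.1.le, ENNReal.ofReal_mul hα0.le]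
        have hmin : 0 ≤ min α (1 - α) := le_min hα.1.le hα0.le
        rw [e1, e2, ← ENNReal.ofReal_add (by positivity) (by positivity)]
        exact ENNReal.ofReal_le_ofReal hg
    _ = 1 := by
        rw [lintegral_add_left (hq.const_mul _), lintegral_const_mul _ hq,
          lintegral_const_mul _ hθm, hqint, hℓ.lintegral_edensity hθ, mul_one, mul_one,
          ← ENNReal.ofReal_add hα.1.le (by linarith [hα.2])]
        simp

end IsRegularModel

end Separation

/-! ### Separation of a law from mixtures over small, distant sets. -/

section Separation

variable {𝒴 : Type*} [MeasurableSpace 𝒴] {μ : Measure 𝒴} {d : ℕ}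
  {ℓ : EuclideanSpace ℝ (Fin d) → 𝒴 → ℝ} {U Θ : Set (EuclideanSpace ℝ (Fin d))}

namespace IsRegularModel

variable (hℓ : IsRegularModel μ ℓ U Θ)
include hℓ

/-- Mixtures over a set that is small compared to its distance to `θ` are separated from the law
with parameter `θ`. -/
lemma exists_separation [SigmaFinite μ] (hΘ : IsCompact Θ) {α : ℝ} (hα : α ∈ Ioo (0 : ℝ) 1) :
    ∃ ε > 0, ∃ c > 0, ∀ θ ∈ Θ, ∀ s > 0, ∀ A ⊆ Θ, (∀ x ∈ A, s ≤ ‖x - θ‖) →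
      (∀ x ∈ A, ∀ z ∈ A, ‖z - x‖ ≤ ε * s) → ∀ ρ : Measure (EuclideanSpace ℝ (Fin d)),
        IsProbabilityMeasure ρ → ρ Aᶜ = 0 →
          ∫⁻ y, (∫⁻ x, edensity ℓ x y ∂ρ) ^ α * edensity ℓ θ y ^ (1 - α) ∂μ ≤
            ENNReal.ofReal (Real.exp (-(c * s ^ 2))) := by
  -- If no constants work, the choice $\varepsilon=c=1/(n+1)$ yields, for each $n$, a counterexample
  -- with a set `A n` and a mixture `ρ n`.
  by_contra! hcon
  set e : ℕ → ℝ := fun n => 1 / ((n : ℝ) + 1) with he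
  have he0 : ∀ n, 0 < e n := fun n => by positivity
  have helim : Tendsto e atTop (𝓝 0) := tendsto_one_div_add_atTop_nhds_zero_nat
  choose θ hθ s hs A hAΘ hAs hAd ρ hρp hρ hbig using
    fun n => hcon (e n) (he0 n) (e n) (he0 n)
  have hAne : ∀ n, (A n).Nonempty := by
    intro n
    have := hρp n
    have hA : ∀ᵐ x ∂(ρ n), x ∈ A n := mem_ae_iff.2 (hρ n)
    exact hA.exists
  choose x hx using hAne
  set δ : ℕ → ℝ := fun n => ‖x n - θ n‖ with hδdef
  have hδs : ∀ n, s n ≤ δ n := fun n => hAs n _ (hx n)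
  have hδ : ∀ n, 0 < δ n := fun n => (hs n).trans_le (hδs n)
  -- From $1-e^{-es^2}\le es^2\le e\delta^2$: the gap divided by $\delta_n^2$ has an integral
  -- tending to $0$, also when the points merge.
  have hgap : ∀ n, ∫⁻ y, ENNReal.ofReal (min α (1 - α) / 2 *
        (((∫⁻ z, edensity ℓ z y ∂(ρ n)).toReal - ℓ (θ n) y) ^ 2 /
          ((∫⁻ z, edensity ℓ z y ∂(ρ n)).toReal + ℓ (θ n) y)) / δ n ^ 2) ∂μ
      ≤ ENNReal.ofReal (e n) := by
    intro n
    have := hρp n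
    have h1 := hℓ.lintegral_gap_add_affinity_le hα (hℓ.subset (hθ n)) (ρ := ρ n)
      ((show ∀ᵐ z ∂(ρ n), z ∈ A n from mem_ae_iff.2 (hρ n)).mono
        fun z hz => hℓ.subset (hAΘ n hz))
    have hδ2 : 0 < δ n ^ 2 := pow_pos (hδ n) 2
    have h2 : ∫⁻ y, ENNReal.ofReal (min α (1 - α) / 2 *
        (((∫⁻ z, edensity ℓ z y ∂(ρ n)).toReal - ℓ (θ n) y) ^ 2 /
          ((∫⁻ z, edensity ℓ z y ∂(ρ n)).toReal + ℓ (θ n) y))) ∂μ ≤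
          ENNReal.ofReal (e n * δ n ^ 2) := by
      have h3 := (add_le_add_right (hbig n).le _).trans h1
      have h4 := ENNReal.le_sub_of_add_le_right ENNReal.ofReal_ne_top h3
      refine h4.trans ?_
      rw [← ENNReal.ofReal_one, ← ENNReal.ofReal_sub _ (Real.exp_nonneg _)]
      refine ENNReal.ofReal_le_ofReal ?_
      have h5 := Real.add_one_le_exp (-(e n * s n ^ 2))
      have h6 : e n * s n ^ 2 ≤ e n * δ n ^ 2 := by
        have := (hs n).le
        have := (he0 n).le
        gcongr
        exact hδs n
      linarith
    simp_rw [ENNReal.ofReal_div_of_pos hδ2]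
    simp_rw [div_eq_mul_inv]
    rw [lintegral_mul_const']
    · refine (mul_le_mul_left h2 _).trans ?_
      rw [← div_eq_mul_inv, ← ENNReal.ofReal_div_of_pos hδ2]
      refine ENNReal.ofReal_le_ofReal (le_of_eq ?_)
      exact mul_div_cancel_right₀ _ hδ2.ne'
    · exact ENNReal.inv_ne_top.2 (by simpa using (hδ n).ne')
  -- a convergent subsequence
  have hcpt : IsCompact (Θ ×ˢ Θ ×ˢ Metric.sphere (0 : EuclideanSpace ℝ (Fin d)) 1) :=
    hΘ.prod (hΘ.prod (isCompact_sphere _ _))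
  have hmem : ∀ n, (θ n, x n, (δ n)⁻¹ • (x n - θ n)) ∈
      Θ ×ˢ Θ ×ˢ Metric.sphere (0 : EuclideanSpace ℝ (Fin d)) 1 := by
    intro n
    refine ⟨hθ n, hAΘ n (hx n), ?_⟩
    rw [mem_sphere_zero_iff_norm, norm_smul, norm_inv, Real.norm_of_nonneg (hδ n).le]
    exact inv_mul_cancel₀ (hδ n).ne'
  obtain ⟨⟨θ₀, x₀, v⟩, ⟨hθ₀, hx₀, hv1⟩, φ, hφ, hlim⟩ := hcpt.tendsto_subseq hmem
  have hlimθ : Tendsto (fun n => θ (φ n)) atTop (𝓝 θ₀) := (continuous_fst.tendsto _).comp hlim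
  have hlimx : Tendsto (fun n => x (φ n)) atTop (𝓝 x₀) :=
    (continuous_fst.comp continuous_snd).continuousAt.tendsto.comp hlim
  have hlimv : Tendsto (fun n => (δ (φ n))⁻¹ • (x (φ n) - θ (φ n))) atTop (𝓝 v) :=
    (continuous_snd.comp continuous_snd).continuousAt.tendsto.comp hlim
  have hlimδ : Tendsto (fun n => δ (φ n)) atTop (𝓝 ‖x₀ - θ₀‖) := (hlimx.sub hlimθ).norm
  have hlime : Tendsto (fun n => e (φ n)) atTop (𝓝 0) := helim.comp hφ.tendsto_atTop
  have hAx : ∀ n, ∀ z ∈ A n, ‖z - x n‖ ≤ e n * δ n := fun n z hz =>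
    (hAd n _ (hx n) z hz).trans (by have := he0 n; gcongr; exact hδs n)
  have hv0 : v ≠ 0 := by
    rintro rfl
    simp at hv1
  -- Fatou's lemma
  set G : ℕ → 𝒴 → ℝ := fun n y => min α (1 - α) / 2 *
        (((∫⁻ z, edensity ℓ z y ∂(ρ n)).toReal - ℓ (θ n) y) ^ 2 /
          ((∫⁻ z, edensity ℓ z y ∂(ρ n)).toReal + ℓ (θ n) y)) / δ n ^ 2 with hG
  have hGm : ∀ n, Measurable (G n) := by
    intro n
    have := hρp n
    have hq : Measurable fun y => (∫⁻ z, edensity ℓ z y ∂(ρ n)).toReal :=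
      ((hℓ.measurable_edensity.comp measurable_swap).lintegral_prod_right').ennreal_toReal
    have hl := hℓ.measurable_density (θ n)
    exact ((((hq.sub hl).pow_const 2).div (hq.add hl)).const_mul _).div_const _
  have hfatou : ∫⁻ y, liminf (fun n => ENNReal.ofReal (G (φ n) y)) atTop ∂μ = 0 := by
    refine le_antisymm ?_ bot_le
    refine (lintegral_liminf_le fun n => (hGm _).ennreal_ofReal).trans ?_
    refine (liminf_le_liminf (Eventually.of_forall fun n => hgap (φ n))).trans (le_of_eq ?_)
    have := (ENNReal.continuous_ofReal.tendsto 0).comp hlime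
    rw [ENNReal.ofReal_zero] at this
    exact this.liminf_eq
  have hGlim : ∀ᵐ y ∂μ, ∀ a, Tendsto (fun n => G (φ n) y) atTop (𝓝 a) → a ≤ 0 := by
    have hm : Measurable fun y => liminf (fun n => ENNReal.ofReal (G (φ n) y)) atTop :=
      Measurable.liminf fun n => (hGm _).ennreal_ofReal
    filter_upwards [(lintegral_eq_zero_iff hm).1 hfatou] with y hy a ha
    have h1 := ((ENNReal.continuous_ofReal.tendsto a).comp ha).liminf_eq
    have h2 : ENNReal.ofReal a = 0 := h1.symm.trans hy
    exact ENNReal.ofReal_eq_zero.1 h2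
  have hm0 : 0 < min α (1 - α) := lt_min hα.1 (by linarith [hα.2])
  have hcont : ∀ᵐ y ∂μ, ∀ θ ∈ U, ContinuousAt (fun θ => ℓ θ y) θ :=
    hℓ.ae_hasStrictFDerivAt.mono fun y hy θ hθ => (hy θ hθ).continuousAt
  have hqlim : ∀ᵐ y ∂μ, Tendsto (fun n => (∫⁻ z, edensity ℓ z y ∂(ρ (φ n))).toReal) atTop
      (𝓝 (ℓ x₀ y)) := by
    filter_upwards [hcont] with y hy
    refine tendsto_mixture (hy x₀ (hℓ.subset hx₀)) hlimx (r := fun n => e (φ n) * δ (φ n)) ?_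
      (fun n => hAx _) (fun n => hρp _) (fun n => hρ _)
      (fun n z hz => hℓ.nonneg z (hℓ.subset (hAΘ _ hz)) y)
    simpa using hlime.mul hlimδ
  by_cases hne : x₀ = θ₀
  -- Merging points: the normalized gap converges to a multiple of $(\partial_v\log\ell)^2\,\ell$ at
  -- `x₀`, which must vanish a.e.; this contradicts positive definiteness of the Fisher information.
  · subst hne
    refine (hℓ.integral_score_sq_pos hθ₀ hv0).ne' ?_
    rw [integral_eq_zero_of_ae]
    filter_upwards [hGlim, hqlim, hcont, hℓ.ae_hasStrictFDerivAt] with y h1 h2 h3 h4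
    have hl0 := hℓ.nonneg x₀ (hℓ.subset hx₀) y
    rcases hl0.eq_or_lt with hl | hl
    · simp [← hl]
    have hs1 := tendsto_slope_mixture (h4 x₀ (hℓ.subset hx₀)) (δ := fun n => δ (φ n))
      (ε := fun n => e (φ n)) (fun n => hδ _)
      (fun n => rfl) hlimθ hlimx hlime hlimv (fun n => hAx _) (fun n => hρp _) (fun n => hρ _)
      (fun n z hz => hℓ.nonneg z (hℓ.subset (hAΘ _ hz)) y)
    have hθlim : Tendsto (fun n => ℓ (θ (φ n)) y) atTop (𝓝 (ℓ x₀ y)) :=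
      (h3 x₀ (hℓ.subset hx₀)).tendsto.comp hlimθ
    have hlimG := (((hs1.pow 2).div (h2.add hθlim) (by positivity)).const_mul
      (min α (1 - α) / 2))
    have h5 := h1 _ (hlimG.congr fun n => by
      simp only [hG, Pi.div_apply, div_pow]
      ring)
    have h6 : (ℓ x₀ y • score ℓ y x₀) v ^ 2 ≤ 0 := by
      by_contra hpos
      have : 0 < (ℓ x₀ y • score ℓ y x₀) v ^ 2 := not_le.1 hpos
      have : 0 < min α (1 - α) / 2 * ((ℓ x₀ y • score ℓ y x₀) v ^ 2 / (ℓ x₀ y + ℓ x₀ y)) := by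
        positivity
      linarith
    have h7 : (ℓ x₀ y • score ℓ y x₀) v = 0 := pow_eq_zero_iff two_ne_zero |>.1
      (le_antisymm h6 (sq_nonneg _))
    rw [smul_apply, smul_eq_mul] at h7
    have h8 := (mul_eq_zero.1 h7).resolve_left hl.ne'
    simp [h8]
  -- Distinct limit points: the vanishing gap makes the two densities equal a.e., which
  -- identifiability excludes.
  · refine hne (hℓ.identifiable x₀ hx₀ θ₀ hθ₀ ?_)
    filter_upwards [hGlim, hqlim, hcont] with y h1 h2 h3
    have hl0 := hℓ.nonneg x₀ (hℓ.subset hx₀) y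
    have hl1 := hℓ.nonneg θ₀ (hℓ.subset hθ₀) y
    rcases (add_nonneg hl0 hl1).eq_or_lt with hl | hl
    · linarith
    have hθlim : Tendsto (fun n => ℓ (θ (φ n)) y) atTop (𝓝 (ℓ θ₀ y)) :=
      (h3 θ₀ (hℓ.subset hθ₀)).tendsto.comp hlimθ
    have hδ0 : 0 < ‖x₀ - θ₀‖ := norm_pos_iff.2 (sub_ne_zero.2 hne)
    have hlimG := ((((h2.sub hθlim).pow 2).div (h2.add hθlim) hl.ne').const_mul
      (min α (1 - α) / 2)).div (hlimδ.pow 2) (by positivity)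
    have h5 := h1 _ hlimG
    by_contra hd
    have : 0 < (ℓ x₀ y - ℓ θ₀ y) ^ 2 := by
      have := sub_ne_zero.2 hd
      positivity
    have : 0 < min α (1 - α) / 2 * ((ℓ x₀ y - ℓ θ₀ y) ^ 2 / (ℓ x₀ y + ℓ θ₀ y)) / ‖x₀ - θ₀‖ ^ 2 := by
      positivity
    linarith

end IsRegularModel

end Separation

/-! ### Negligibility of parameters far from $\theta$ on the scale $1/\sqrt k$. -/

section Tail

/-- Gaussian decay beats every power. The form $C/x$ is chosen so that summation over $x=2^jM$ is
geometric with total $O(1/M)$. -/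
lemma exists_rpow_mul_exp_neg_mul_sq_le {β : ℝ} (hβ : 0 ≤ β) {c : ℝ} (hc : 0 < c) :
    ∃ C > 0, ∀ x : ℝ, 0 < x → x ^ β * Real.exp (-(c * x ^ 2)) ≤ C / x := by
  obtain ⟨n, hn⟩ := exists_nat_ge ((β + 1) / 2)
  have hn1 : β + 1 ≤ 2 * n := by linarith
  refine ⟨1 + n.factorial / c ^ n, by positivity, fun x hx => ?_⟩
  rw [le_div_iff₀ hx]
  have h1 : x ^ β * Real.exp (-(c * x ^ 2)) * x = x ^ (β + 1) * Real.exp (-(c * x ^ 2)) := by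
    rw [Real.rpow_add_one hx.ne']; ring
  have hexp : Real.exp (-(c * x ^ 2)) ≤ 1 := Real.exp_le_one_iff.2 (by
    have : 0 ≤ c * x ^ 2 := by positivity
    linarith)
  have h2 : x ^ (β + 1) ≤ 1 + (x ^ 2) ^ n := by
    rcases le_total x 1 with h | h
    · have := Real.rpow_le_one hx.le h (show 0 ≤ β + 1 by linarith)
      have : 0 ≤ (x ^ 2) ^ n := by positivity
      linarith
    · have := Real.rpow_le_rpow_of_exponent_le h hn1
      rw [show (2 * n : ℝ) = ((2 * n : ℕ) : ℝ) by push_cast; ring, Real.rpow_natCast,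
        pow_mul] at this
      linarith
  have h3 : (x ^ 2) ^ n * Real.exp (-(c * x ^ 2)) ≤ n.factorial / c ^ n := by
    have := Real.pow_div_factorial_le_exp (x := c * x ^ 2) (by positivity) n
    rw [Real.exp_neg, ← div_eq_mul_inv, div_le_div_iff₀ (Real.exp_pos _) (by positivity)]
    rw [div_le_iff₀ (by positivity), mul_pow] at this
    linarith
  calc _ = x ^ (β + 1) * Real.exp (-(c * x ^ 2)) := h1
    _ ≤ (1 + (x ^ 2) ^ n) * Real.exp (-(c * x ^ 2)) := by gcongr
    _ ≤ _ := by rw [add_mul]; linarith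

/-- The rate of the mutual information. -/
def rate (d : ℕ) (α : ℝ) (k : ℕ) : ℝ := (k : ℝ) ^ ((d : ℝ) * α / 2)

lemma rate_nonneg (d : ℕ) (α : ℝ) (k : ℕ) : 0 ≤ rate d α k := by unfold rate; positivity

lemma rate_eq (d : ℕ) (α : ℝ) (k : ℕ) : rate d α k = (Real.sqrt k ^ d) ^ α := by
  rw [rate, Real.sqrt_eq_rpow, ← Real.rpow_natCast, ← Real.rpow_mul (by positivity),
    ← Real.rpow_mul (by positivity)]
  ring_nf

/-- The rate exactly cancels the $\alpha$-th power of the factor $k^{-d/2}$ in the volume of a ball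
of radius $X/\sqrt k$. -/
lemma rate_mul_rpow (d : ℕ) {α : ℝ} (hα : 0 < α) {k : ℕ} (hk : 0 < k) (X : ℝ)
    (V : ℝ≥0∞) : ENNReal.ofReal (rate d α k) * (ENNReal.ofReal ((X / Real.sqrt k) ^ d) * V) ^ α =
      (ENNReal.ofReal (X ^ d) * V) ^ α := by
  have hs : 0 < Real.sqrt k := by positivity
  rw [rate_eq, ← ENNReal.ofReal_rpow_of_nonneg (by positivity) hα.le,
    ← ENNReal.mul_rpow_of_nonneg _ _ hα.le, ← mul_assoc, ← ENNReal.ofReal_mul (by positivity),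
    div_pow, mul_div_cancel₀ _ (by positivity)]

variable {𝒴 : Type*} [MeasurableSpace 𝒴] {μ : Measure 𝒴} {d : ℕ}
  {ℓ : EuclideanSpace ℝ (Fin d) → 𝒴 → ℝ} {U Θ : Set (EuclideanSpace ℝ (Fin d))}

namespace IsRegularModel

variable (hℓ : IsRegularModel μ ℓ U Θ)
include hℓ

/-- The contribution to the Hellinger integral of a small set of parameters far from `θ`. -/
lemma exists_affinity_le [SigmaFinite μ] (hΘ : IsCompact Θ) {α : ℝ} (hα : α ∈ Ioo (0 : ℝ) 1) :
    ∃ ε > 0, ∃ c > 0, ∀ θ ∈ Θ, ∀ s > 0, ∀ A ⊆ Θ, MeasurableSet A → (∀ x ∈ A, s ≤ ‖x - θ‖) →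
      (∀ x ∈ A, ∀ z ∈ A, ‖z - x‖ ≤ ε * s) → ∀ k : ℕ,
          affinity μ (edensity ℓ) α (volume.restrict A) k θ ≤
            ENNReal.ofReal (Real.exp (-(c * (k * s ^ 2)))) * volume A ^ α := by
  obtain ⟨ε, hε, c, hc, h⟩ := hℓ.exists_separation hΘ hα
  refine ⟨ε, hε, c, hc, fun θ hθ s hs A hA hAm hAs hAd k => ?_⟩
  have h1 := affinity_le_pow_mul (μ := μ) (L := edensity ℓ) (ρ := volume.restrict A) (x₀ := θ)
    (k := k) hℓ.measurable_edensity hα.1 (A := A)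
    (r := ENNReal.ofReal (Real.exp (-(c * s ^ 2))))
    (by simpa using Real.exp_pos _) ?_ ?_ hα.2
  · rw [← ENNReal.ofReal_pow (Real.exp_nonneg _), ← Real.exp_nat_mul,
      Measure.restrict_apply_univ] at h1
    convert! h1 using 4
    ring
  · intro ρ' hfin hρ'
    by_cases h0 : ρ' univ = 0
    · rw [Measure.measure_univ_eq_zero.1 h0]
      simp [hα.1]
    -- Separation is stated for probability measures; both sides are homogeneous of degree $\alpha$
    -- in the mixing measure, so normalization gives the general case.
    · have hp : IsProbabilityMeasure ((ρ' univ)⁻¹ • ρ') :=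
        ⟨by simp [ENNReal.inv_mul_cancel h0 (measure_ne_top _ _)]⟩
      have h2 := h θ hθ s hs A hA hAs hAd ((ρ' univ)⁻¹ • ρ') hp (by simp [hρ'])
      have hq : Measurable fun y => ∫⁻ x, edensity ℓ x y ∂ρ' :=
        (hℓ.measurable_edensity.comp measurable_swap).lintegral_prod_right'
      have hθm : Measurable (edensity ℓ θ) := hℓ.measurable_edensity.of_uncurry_left
      simp_rw [lintegral_smul_measure, smul_eq_mul, ENNReal.mul_rpow_of_nonneg _ _ hα.1.le,
        mul_assoc] at h2
      have hm : Measurable fun y => (∫⁻ x, edensity ℓ x y ∂ρ') ^ α * edensity ℓ θ y ^ (1 - α) :=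
        (hq.pow_const _).mul (hθm.pow_const _)
      rw [lintegral_const_mul _ hm, ENNReal.inv_rpow,
        mul_comm, ← div_eq_mul_inv] at h2
      refine (ENNReal.div_le_iff ?_ ?_).1 h2
      · simp [h0]
      · exact ENNReal.rpow_ne_top_of_nonneg hα.1.le (measure_ne_top _ _)
  · rw [Measure.restrict_apply hAm.compl]
    simp

/-- Parameters that are far from `θ`, on the scale `1 / √k`, do not contribute. -/
lemma exists_tail_le [SigmaFinite μ] (hΘ : IsCompact Θ) {α : ℝ} (hα : α ∈ Ioo (0 : ℝ) 1) :
    ∃ C : ℝ, ∀ θ ∈ Θ, ∀ k : ℕ, 0 < k → ∀ M : ℝ, 0 < M →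
      ENNReal.ofReal (rate d α k) * affinity μ (edensity ℓ) α
        (volume.restrict (Θ ∩ {x | M / Real.sqrt k ≤ ‖x - θ‖})) k θ ≤ ENNReal.ofReal (C / M) := by
  obtain ⟨ε, hε, c, hc, haff⟩ := hℓ.exists_affinity_le hΘ hα
  have hβ : 0 ≤ (d : ℝ) * α := mul_nonneg (by positivity) hα.1.le
  obtain ⟨C, hC, hCx⟩ := exists_rpow_mul_exp_neg_mul_sq_le hβ hc
  -- A fixed finite cover of the ball of radius $2$. Scaled by $s_j$, it cuts the shell
  -- $s_j\le\|x-\theta\|\le2s_j$ into pieces of diameter at most $\varepsilon s_j$, in a number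
  -- independent of $j$, $k$ and $\theta$.
  obtain ⟨F, hF, hFcov⟩ := (isCompact_closedBall (0 : EuclideanSpace ℝ (Fin d)) 2).elim_nhds_subcover
    (fun v => Metric.ball v (ε / 2)) (fun v _ => Metric.ball_mem_nhds v (half_pos hε))
  set V : ℝ≥0∞ := volume (Metric.ball (0 : EuclideanSpace ℝ (Fin d)) 1) with hV
  have hVtop : V ≠ ∞ := measure_ball_lt_top.ne
  set W : ℝ := (ENNReal.ofReal ((ε / 2) ^ d) * V).toReal with hW
  have hWV : ENNReal.ofReal ((ε / 2) ^ d) * V = ENNReal.ofReal W :=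
    (ENNReal.ofReal_toReal (ENNReal.mul_ne_top ENNReal.ofReal_ne_top hVtop)).symm
  have hW0 : 0 ≤ W := ENNReal.toReal_nonneg
  -- `F.card` counts the pieces of a shell, `W` bounds their rescaled volume, and the factor $2$ is
  -- $\sum_j2^{-j}$.
  refine ⟨F.card * (W ^ α * C) * 2, fun θ hθ k hk M hM => ?_⟩
  have hsk : 0 < Real.sqrt k := by positivity
  set s : ℕ → ℝ := fun j => 2 ^ j * M / Real.sqrt k with hs
  have hs0 : ∀ j, 0 < s j := fun j => by positivity
  set A : ℕ × F → Set (EuclideanSpace ℝ (Fin d)) := fun i =>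
    Θ ∩ ({x | s i.1 ≤ ‖x - θ‖} ∩ Metric.ball (θ + s i.1 • (i.2 : EuclideanSpace ℝ (Fin d)))
      (s i.1 * (ε / 2))) with hA
  have hAm : ∀ i, MeasurableSet (A i) := fun i =>
    hΘ.measurableSet.inter ((isClosed_le continuous_const (by fun_prop)).measurableSet.inter
      measurableSet_ball)
  have hcov : Θ ∩ {x | M / Real.sqrt k ≤ ‖x - θ‖} ⊆ ⋃ i, A i := by
    rintro x ⟨hxΘ, hx⟩
    have hx' : M / Real.sqrt k ≤ ‖x - θ‖ := hx
    have h1 : 1 ≤ ‖x - θ‖ / (M / Real.sqrt k) := (one_le_div (by positivity)).2 hx'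
    obtain ⟨j, hj1, hj2⟩ := exists_nat_pow_near h1 one_lt_two
    rw [le_div_iff₀ (by positivity)] at hj1
    rw [div_lt_iff₀ (by positivity)] at hj2
    have hj1' : s j ≤ ‖x - θ‖ := by rw [hs]; simpa [mul_div_assoc] using hj1
    have hj2' : ‖x - θ‖ ≤ 2 * s j := by
      rw [hs]
      refine hj2.le.trans (le_of_eq ?_)
      ring
    have hmem : (s j)⁻¹ • (x - θ) ∈ Metric.closedBall (0 : EuclideanSpace ℝ (Fin d)) 2 := by
      rw [mem_closedBall_zero_iff, norm_smul, norm_inv, Real.norm_of_nonneg (hs0 j).le,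
        inv_mul_le_iff₀ (hs0 j)]
      linarith
    obtain ⟨v, hvF, hv⟩ := mem_iUnion₂.1 (hFcov hmem)
    refine mem_iUnion.2 ⟨(j, ⟨v, hvF⟩), hxΘ, hj1', ?_⟩
    rw [mem_ball_iff_norm] at hv ⊢
    have e : x - (θ + s j • v) = s j • ((s j)⁻¹ • (x - θ) - v) := by
      rw [smul_sub, smul_inv_smul₀ (hs0 j).ne']; abel
    change ‖x - (θ + s j • v)‖ < s j * (ε / 2)
    rw [e, norm_smul, Real.norm_of_nonneg (hs0 j).le]
    exact mul_lt_mul_of_pos_left hv (hs0 j)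
  have hterm : ∀ i : ℕ × F, ENNReal.ofReal (rate d α k) *
      affinity μ (edensity ℓ) α (volume.restrict (A i)) k θ ≤
        ENNReal.ofReal (W ^ α * C / M * (1 / 2) ^ i.1) := by
    rintro ⟨j, v⟩
    have hX : 0 < 2 ^ j * M := by positivity
    have h1 := haff θ hθ (s j) (hs0 j) (A (j, v)) inter_subset_left (hAm _) (fun x hx => hx.2.1)
      (fun x hx z hz => by
        have h1 := hx.2.2
        have h2 := hz.2.2
        rw [mem_ball_iff_norm] at h1 h2
        have : z - x = (z - (θ + s j • (v : EuclideanSpace ℝ (Fin d)))) -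
          (x - (θ + s j • (v : EuclideanSpace ℝ (Fin d)))) := by abel
        rw [this]
        refine (norm_sub_le _ _).trans ?_
        dsimp only at h1 h2
        linarith) k
    have h2 : volume (A (j, v)) ≤ ENNReal.ofReal ((2 ^ j * M * (ε / 2) / Real.sqrt k) ^ d) * V := by
      refine (measure_mono (inter_subset_right.trans inter_subset_right)).trans ?_
      rw [Measure.addHaar_ball_of_pos _ _ (mul_pos (hs0 j) (half_pos hε)), finrank_euclideanSpace_fin]
      refine le_of_eq ?_
      have e : s j * (ε / 2) = 2 ^ j * M * (ε / 2) / Real.sqrt k := by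
        simp only [hs]
        ring
      rw [← e]
    have hks : (k : ℝ) * s j ^ 2 = (2 ^ j * M) ^ 2 := by
      rw [hs, div_pow, Real.sq_sqrt (by positivity)]
      field_simp
    calc _ ≤ ENNReal.ofReal (rate d α k) * (ENNReal.ofReal (Real.exp (-(c * (k * s j ^ 2)))) *
          (ENNReal.ofReal ((2 ^ j * M * (ε / 2) / Real.sqrt k) ^ d) * V) ^ α) := by
            gcongr
            exact h1.trans (by have := hα.1.le; gcongr)
      _ = ENNReal.ofReal (Real.exp (-(c * (2 ^ j * M) ^ 2))) *
          (ENNReal.ofReal ((2 ^ j * M * (ε / 2)) ^ d) * V) ^ α := by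
            rw [mul_left_comm, rate_mul_rpow d hα.1 hk, hks]
      _ = ENNReal.ofReal (Real.exp (-(c * (2 ^ j * M) ^ 2)) * (((2 ^ j * M) ^ d * W) ^ α)) := by
            rw [mul_pow (2 ^ j * M) (ε / 2), ENNReal.ofReal_mul (by positivity), mul_assoc _ _ V, hWV,
              ← ENNReal.ofReal_mul (by positivity),
              ENNReal.ofReal_rpow_of_nonneg (by positivity) hα.1.le,
              ← ENNReal.ofReal_mul (by positivity)]
      _ ≤ _ := by
            refine ENNReal.ofReal_le_ofReal ?_
            have h3 := hCx _ hX
            rw [Real.mul_rpow (by positivity) hW0, ← Real.rpow_natCast _ d,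
              ← Real.rpow_mul (by positivity)]
            calc _ = W ^ α * ((2 ^ j * M) ^ ((d : ℝ) * α) *
                  Real.exp (-(c * (2 ^ j * M) ^ 2))) := by ring
              _ ≤ W ^ α * (C / (2 ^ j * M)) := by gcongr
              _ = _ := by
                  rw [one_div, inv_pow]
                  field_simp
  calc _ ≤ ENNReal.ofReal (rate d α k) *
        ∑' i, affinity μ (edensity ℓ) α (volume.restrict (A i)) k θ := by
        gcongr
        refine (affinity_mono hα.1.le ((Measure.restrict_mono hcov le_rfl).trans
          Measure.restrict_iUnion_le)).trans ?_
        exact affinity_sum_le hℓ.measurable_edensity hα.1 hα.2.le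
    _ ≤ ∑' i : ℕ × F, ENNReal.ofReal (W ^ α * C / M * (1 / 2) ^ i.1) := by
        rw [← ENNReal.tsum_mul_left]
        exact ENNReal.tsum_le_tsum hterm
    _ = ENNReal.ofReal (F.card * (W ^ α * C) * 2 / M) := by
        rw [ENNReal.tsum_prod (f := fun j (_ : F) => ENNReal.ofReal (W ^ α * C / M * (1 / 2) ^ j))]
        simp_rw [tsum_fintype, Finset.sum_const, Finset.card_univ, Fintype.card_coe,
          nsmul_eq_mul]
        rw [ENNReal.tsum_mul_left, ← ENNReal.ofReal_tsum_of_nonneg (fun j => by positivity)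
          ((summable_geometric_of_lt_one (by norm_num) (by norm_num)).mul_left _), tsum_mul_left,
          tsum_geometric_two, ← ENNReal.ofReal_natCast, ← ENNReal.ofReal_mul (Nat.cast_nonneg _)]
        congr 1
        ring

/-- The Hellinger integrals are bounded, at the rate `k ^ (d α / 2)`. -/
lemma exists_rate_mul_affinity_le [SigmaFinite μ] (hΘ : IsCompact Θ) {α : ℝ}
    (hα : α ∈ Ioo (0 : ℝ) 1) :
    ∃ C : ℝ≥0∞, C ≠ ∞ ∧ ∀ θ ∈ Θ, ∀ k : ℕ, 0 < k →
      ENNReal.ofReal (rate d α k) * affinity μ (edensity ℓ) α (volume.restrict Θ) k θ ≤ C := by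
  obtain ⟨C, hC⟩ := hℓ.exists_tail_le hΘ hα
  set V : ℝ≥0∞ := volume (Metric.ball (0 : EuclideanSpace ℝ (Fin d)) 1) with hV
  have hVtop : V ≠ ∞ := measure_ball_lt_top.ne
  refine ⟨V ^ α + ENNReal.ofReal (C / 1), ENNReal.add_ne_top.2
    ⟨ENNReal.rpow_ne_top_of_nonneg hα.1.le hVtop, ENNReal.ofReal_ne_top⟩, fun θ hθ k hk => ?_⟩
  have hsk : 0 < Real.sqrt k := by positivity
  -- Inside radius $1/\sqrt k$ the Hölder bound gives $V^\alpha$; outside, the tail estimate applies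
  -- with $M=1$.
  have hsub : Θ ⊆ (Θ ∩ Metric.ball θ (1 / Real.sqrt k)) ∪
      (Θ ∩ {x | 1 / Real.sqrt k ≤ ‖x - θ‖}) := by
    intro x hx
    rcases lt_or_ge ‖x - θ‖ (1 / Real.sqrt k) with h | h
    · exact Or.inl ⟨hx, mem_ball_iff_norm.2 h⟩
    · exact Or.inr ⟨hx, h⟩
  calc _ ≤ ENNReal.ofReal (rate d α k) *
        (affinity μ (edensity ℓ) α (volume.restrict (Θ ∩ Metric.ball θ (1 / Real.sqrt k))) k θ +
          affinity μ (edensity ℓ) α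
            (volume.restrict (Θ ∩ {x | 1 / Real.sqrt k ≤ ‖x - θ‖})) k θ) := by
        gcongr
        exact (affinity_mono hα.1.le ((Measure.restrict_mono hsub le_rfl).trans
          (Measure.restrict_union_le _ _))).trans
            (affinity_add_le hℓ.measurable_edensity hα.1.le hα.2.le)
    _ ≤ _ := by
        rw [mul_add]
        refine add_le_add ?_ (hC θ hθ k hk 1 one_pos)
        refine (mul_le_mul_right (affinity_le_measure_univ_rpow hℓ.measurable_edensity hα.1 hα.2 ?_
          (hℓ.lintegral_edensity (hℓ.subset hθ))) _).trans ?_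
        · filter_upwards [ae_restrict_mem (hΘ.measurableSet.inter measurableSet_ball)] with x hx
          exact hℓ.lintegral_edensity (hℓ.subset hx.1)
        · rw [Measure.restrict_apply_univ]
          have h1 : volume (Θ ∩ Metric.ball θ (1 / Real.sqrt k)) ≤
              ENNReal.ofReal ((1 / Real.sqrt k) ^ d) * V := by
            refine (measure_mono inter_subset_right).trans ?_
            rw [Measure.addHaar_ball_of_pos _ _ (by positivity), finrank_euclideanSpace_fin]
          calc _ ≤ ENNReal.ofReal (rate d α k) *
                (ENNReal.ofReal ((1 / Real.sqrt k) ^ d) * V) ^ α := by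
                have := hα.1.le
                gcongr
            _ = _ := by
                rw [rate_mul_rpow d hα.1 hk, one_pow, ENNReal.ofReal_one, one_mul]

end IsRegularModel

end Tail

/-! ### Laws of large numbers and the central limit theorem for infinite samples. -/

section Limits

open ProbabilityTheory

variable {𝒴 : Type*} [MeasurableSpace 𝒴] (P : Measure 𝒴) [IsProbabilityMeasure P]

/-- The law of an infinite sequence of independent observations. -/
abbrev sampleLaw : Measure (ℕ → 𝒴) := Measure.infinitePi fun _ => P

variable {P}

lemma ae_sampleLaw_forall {p : 𝒴 → Prop} (hp : ∀ᵐ y ∂P, p y) :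
    ∀ᵐ ω ∂(sampleLaw P), ∀ i, p (ω i) :=
  ae_all_iff.2 fun i =>
    (measurePreserving_eval_infinitePi (fun _ : ℕ => P) i).quasiMeasurePreserving.ae hp

lemma map_comp_eval_sampleLaw {h : 𝒴 → ℝ} (hh : Measurable h) (i : ℕ) :
    (sampleLaw P).map (fun ω => h (ω i)) = P.map h := by
  have := (measurePreserving_eval_infinitePi (fun _ : ℕ => P) i).map_eq
  conv_rhs => rw [← this]
  exact (Measure.map_map hh (measurable_pi_apply i)).symm

lemma identDistrib_sampleLaw {h : 𝒴 → ℝ} (hh : Measurable h) (i : ℕ) :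
    IdentDistrib (fun ω : ℕ → 𝒴 => h (ω i)) (fun ω => h (ω 0)) (sampleLaw P) (sampleLaw P) :=
  ⟨(hh.comp (measurable_pi_apply i)).aemeasurable, (hh.comp (measurable_pi_apply 0)).aemeasurable,
    by rw [map_comp_eval_sampleLaw hh, map_comp_eval_sampleLaw hh]⟩

/-- The strong law of large numbers for the coordinates of a product measure. -/
lemma strong_law_sampleLaw {h : 𝒴 → ℝ} (hh : Integrable h P) :
    ∀ᵐ ω ∂(sampleLaw P), Tendsto (fun k : ℕ => (∑ i ∈ Finset.range k, h (ω i)) / k) atTop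
      (𝓝 (∫ y, h y ∂P)) := by
  -- An integrable function is only a.e. measurable, whereas independence and identical distribution
  -- of the samples are established for a measurable representative.
  set h' := hh.1.mk h with hh'
  have hm : Measurable h' := hh.1.stronglyMeasurable_mk.measurable
  have hae : h =ᵐ[P] h' := hh.1.ae_eq_mk
  have hmp := measurePreserving_eval_infinitePi (fun _ : ℕ => P) 0
  have hint : Integrable h' P := hh.congr hae
  have hslln := strong_law_ae_real (μ := sampleLaw P) (fun i ω => h' (ω i))
    (hmp.integrable_comp_of_integrable hint)
    (fun i j hij => (iIndepFun_infinitePi (P := fun _ : ℕ => P) fun _ => hm).indepFun hij)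
    (identDistrib_sampleLaw hm)
  have hmean : ∫ ω, h' (ω 0) ∂(sampleLaw P) = ∫ y, h y ∂P := by
    rw [integral_congr_ae hae]
    have h1 := integral_map (μ := sampleLaw P) (f := id)
      (hm.comp (measurable_pi_apply 0)).aemeasurable aestronglyMeasurable_id
    have h2 := integral_map (μ := P) (f := id) hm.aemeasurable aestronglyMeasurable_id
    have h3 := map_comp_eval_sampleLaw (P := P) hm 0
    change ∫ x, id x ∂((sampleLaw P).map fun ω => h' (ω 0)) = _ at h1
    rw [h3, h2] at h1
    exact h1.symm
  filter_upwards [hslln, ae_sampleLaw_forall hae] with ω h1 h2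
  rw [hmean] at h1
  simpa only [h2] using h1

variable {d : ℕ}

/-- The normalized sum of the first `k` values of `T`. -/
def normalizedSum (T : 𝒴 → EuclideanSpace ℝ (Fin d)) (k : ℕ) (ω : ℕ → 𝒴) :
    EuclideanSpace ℝ (Fin d) := (Real.sqrt k)⁻¹ • ∑ i ∈ Finset.range k, T (ω i)

lemma measurable_normalizedSum {T : 𝒴 → EuclideanSpace ℝ (Fin d)} (hT : Measurable T) (k : ℕ) :
    Measurable (normalizedSum T k) :=
  (Finset.measurable_fun_sum _ fun i _ => hT.comp (measurable_pi_apply i)).const_smul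
    (Real.sqrt k)⁻¹

/-- The multivariate central limit theorem. -/
lemma tendsto_integral_normalizedSum {T : 𝒴 → EuclideanSpace ℝ (Fin d)} (hT : Measurable T)
    (h0 : ∀ u, ∫ y, inner ℝ (T y) u ∂P = 0) (h1 : ∀ u, ∫ y, inner ℝ (T y) u ^ 2 ∂P = ‖u‖ ^ 2)
    (f : BoundedContinuousFunction (EuclideanSpace ℝ (Fin d)) ℝ) :
    Tendsto (fun k => ∫ ω, f (normalizedSum T k ω) ∂(sampleLaw P)) atTop
      (𝓝 (∫ z, f z ∂(stdGaussian (EuclideanSpace ℝ (Fin d))))) := by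
  have hS := measurable_normalizedSum hT
  set ν : ℕ → ProbabilityMeasure (EuclideanSpace ℝ (Fin d)) := fun k =>
    ⟨(sampleLaw P).map (normalizedSum T k), Measure.isProbabilityMeasure_map (hS k).aemeasurable⟩
    with hν
  set ν₀ : ProbabilityMeasure (EuclideanSpace ℝ (Fin d)) := ⟨stdGaussian _, inferInstance⟩ with hν₀
  have hlim : Tendsto ν atTop (𝓝 ν₀) := by
    refine ProbabilityMeasure.tendsto_iff_tendsto_charFun.2 fun t => ?_
    change Tendsto (fun k => charFun ((sampleLaw P).map (normalizedSum T k)) t) atTop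
      (𝓝 (charFun (stdGaussian _) t))
    rcases eq_or_ne t 0 with rfl | ht
    · simp only [charFun_zero, measureReal_def]
      have : ∀ k, ((sampleLaw P).map (normalizedSum T k)) univ = 1 := fun k => by
        rw [Measure.map_apply (hS k) MeasurableSet.univ]; simp
      simp [this]
    have ht' : ‖t‖ ≠ 0 := norm_ne_zero_iff.2 ht
    -- Reduction to dimension one: the characteristic function at `t` is that of the projection on
    -- the unit vector `e`, at $\|t\|$. This is why `t = 0` is treated apart.
    set e := (‖t‖⁻¹ : ℝ) • t with he
    have het : ‖t‖ • e = t := smul_inv_smul₀ ht' t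
    have hen : ‖e‖ = 1 := by rw [he, norm_smul, norm_inv, norm_norm, inv_mul_cancel₀ ht']
    set X : 𝒴 → ℝ := fun y => inner ℝ (T y) e with hX
    have hXm : Measurable X := hT.inner_const
    have hindep := iIndepFun_infinitePi (P := fun _ : ℕ => P) (X := fun _ => X) fun _ => hXm
    have key : ∀ k, charFun ((sampleLaw P).map (normalizedSum T k)) t =
        (charFun (P.map X) ((Real.sqrt k)⁻¹ * ‖t‖)) ^ k := by
      intro k
      have h3 := charFun_inv_sqrt_mul_sum (n := k) (t := ‖t‖) hindep (identDistrib_sampleLaw hXm)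
      rw [map_comp_eval_sampleLaw hXm] at h3
      rw [← h3, charFun_apply, charFun_apply_real,
        integral_map (hS k).aemeasurable (by fun_prop), integral_map ?_ (by fun_prop)]
      · refine integral_congr_ae (Eventually.of_forall fun ω => ?_)
        dsimp only
        congr 2
        rw [← Complex.ofReal_mul]
        congr 1
        conv_lhs => rw [← het]
        rw [normalizedSum, real_inner_smul_left, real_inner_smul_right, sum_inner]
        ring
      · exact ((Finset.measurable_fun_sum _ fun i _ =>
          hXm.comp (measurable_pi_apply i)).const_mul _).aemeasurable
    simp_rw [key]
    have h5 := tendsto_charFun_inv_sqrt_mul_pow (P := P) hXm.aemeasurable (h0 e)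
      (by simpa [hen] using h1 e) ‖t‖
    rw [charFun_stdGaussian]
    exact h5
  have := (ProbabilityMeasure.tendsto_iff_forall_integral_tendsto.1 hlim) f
  refine this.congr fun k => ?_
  change ∫ z, f z ∂((sampleLaw P).map (normalizedSum T k)) = _
  rw [integral_map (hS k).aemeasurable (by fun_prop)]

end Limits

/-! ### Convergence of moments of order $\alpha<1$. -/

section Truncation

/-- The limit in `k` is taken at a fixed truncation level `L`, and only then does `L` tend to
infinity. It serves both for truncated moments and for windows of growing radius. -/
lemma tendsto_of_approximation {a : ℕ → ℝ≥0∞} {b : ℕ → ℕ → ℝ≥0∞} {c e : ℕ → ℝ≥0∞} {I : ℝ≥0∞}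
    (hb : ∀ L, Tendsto (b L) atTop (𝓝 (c L)))
    (hab : ∀ᶠ L in atTop, ∀ᶠ k in atTop, b L k ≤ a k ∧ a k ≤ b L k + e L)
    (hc : Tendsto c atTop (𝓝 I)) (he : Tendsto e atTop (𝓝 0)) : Tendsto a atTop (𝓝 I) := by
  refine tendsto_of_le_liminf_of_limsup_le ?_ ?_
  · refine le_of_tendsto hc ?_
    filter_upwards [hab] with L hL
    rw [← (hb L).liminf_eq]
    exact liminf_le_liminf (hL.mono fun k h => h.1)
  · have hce : Tendsto (fun L => c L + e L) atTop (𝓝 I) := by simpa using hc.add he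
    refine ge_of_tendsto hce ?_
    filter_upwards [hab] with L hL
    rw [← ((hb L).add_const (e L)).limsup_eq]
    exact limsup_le_limsup (hL.mono fun k h => h.2)

/-- Above the level `l`, the negative exponent $\alpha-1$ gives $w^{\alpha-1}\le l^{\alpha-1}$. A
bounded first moment therefore controls the truncation error. -/
lemma rpow_le_min_rpow_add {α : ℝ} (hα : α ∈ Ioo (0 : ℝ) 1) {w l : ℝ≥0∞} (hl0 : l ≠ 0)
    (hl : l ≠ ∞) : w ^ α ≤ min w l ^ α + l ^ (α - 1) * w := by
  rcases le_total w l with h | h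
  · rw [min_eq_left h]
    exact le_self_add
  · refine le_add_left ?_
    by_cases hw : w = ∞
    · rw [hw, ENNReal.mul_top]
      · exact le_top
      · simp [ENNReal.rpow_eq_zero_iff, hl0, hl]
    have hw0 : w ≠ 0 := fun h0 => hl0 (le_antisymm (h0 ▸ h) bot_le)
    calc w ^ α = w ^ (α - 1) * w := by
          conv_lhs => rw [show α = (α - 1) + 1 by ring, ENNReal.rpow_add _ _ hw0 hw,
            ENNReal.rpow_one]
      _ ≤ l ^ (α - 1) * w := by
          gcongr ?_ * w
          rw [← neg_sub 1 α, ENNReal.rpow_neg, ENNReal.rpow_neg, ENNReal.inv_le_inv]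
          exact ENNReal.rpow_le_rpow h (by linarith [hα.2])

variable {Ω E : Type*} [MeasurableSpace Ω] {ℙ : Measure Ω} [IsProbabilityMeasure ℙ]
  [TopologicalSpace E] [MeasurableSpace E] [BorelSpace E] {γ : Measure E} [IsProbabilityMeasure γ]

/-- Convergence of moments of order `α < 1` for variables that are asymptotically equivalent to
continuous functions of variables which converge in law. -/
lemma tendsto_lintegral_rpow {α : ℝ} (hα : α ∈ Ioo (0 : ℝ) 1) {S : ℕ → Ω → E}
    (hS : ∀ k, Measurable (S k))
    (hconv : ∀ f : BoundedContinuousFunction E ℝ,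
      Tendsto (fun k => ∫ ω, f (S k ω) ∂ℙ) atTop (𝓝 (∫ z, f z ∂γ)))
    {F : E → ℝ} (hF : Continuous F) (hF0 : ∀ z, 0 ≤ F z)
    {W : ℕ → Ω → ℝ≥0∞} (hW : ∀ k, Measurable (W k)) {V : ℝ≥0∞} (hV : V ≠ ∞)
    (hWV : ∀ᶠ k in atTop, ∫⁻ ω, W k ω ∂ℙ ≤ V)
    (hWF : ∀ᵐ ω ∂ℙ, ∀ η > 0, ∀ᶠ k in atTop, ENNReal.ofReal (Real.exp (-η) * F (S k ω)) ≤ W k ω ∧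
      W k ω ≤ ENNReal.ofReal (Real.exp η * F (S k ω))) :
    Tendsto (fun k => ∫⁻ ω, W k ω ^ α ∂ℙ) atTop (𝓝 (∫⁻ z, ENNReal.ofReal (F z) ^ α ∂γ)) := by
  have hα0 := hα.1.le
  -- truncated moments
  have htrunc : ∀ L : ℝ, 0 < L → Tendsto (fun k => ∫⁻ ω, min (W k ω) (ENNReal.ofReal L) ^ α ∂ℙ)
      atTop (𝓝 (∫⁻ z, min (ENNReal.ofReal (F z)) (ENNReal.ofReal L) ^ α ∂γ)) := by
    intro L hL
    have hhc : Continuous fun z => min (F z) L ^ α :=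
      (hF.min continuous_const).rpow_const fun z => Or.inr hα0
    have hmin0 : ∀ z, 0 ≤ min (F z) L := fun z => le_min (hF0 z) hL.le
    have hhb : ∀ z, ‖min (F z) L ^ α‖ ≤ L ^ α := fun z => by
      rw [Real.norm_of_nonneg (Real.rpow_nonneg (hmin0 z) _)]
      exact Real.rpow_le_rpow (hmin0 z) (min_le_right _ _) hα0
    set h : BoundedContinuousFunction E ℝ := BoundedContinuousFunction.ofNormedAddCommGroup
      (fun z => min (F z) L ^ α) hhc (L ^ α) hhb with hh
    set w : ℕ → Ω → ℝ := fun k ω => (min (W k ω) (ENNReal.ofReal L)).toReal ^ α with hw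
    have hwm : ∀ k, Measurable (w k) := fun k =>
      (((hW k).min measurable_const).ennreal_toReal).pow_const _
    have hwb : ∀ k ω, ‖w k ω‖ ≤ L ^ α := fun k ω => by
      rw [Real.norm_of_nonneg (Real.rpow_nonneg ENNReal.toReal_nonneg _)]
      exact Real.rpow_le_rpow ENNReal.toReal_nonneg
        (ENNReal.toReal_le_of_le_ofReal hL.le (min_le_right _ _)) hα0
    have hhS : ∀ k, Measurable fun ω => h (S k ω) := fun k => h.continuous.measurable.comp (hS k)
    have hwi : ∀ k, Integrable (w k) ℙ := fun k =>
      Integrable.of_bound (hwm k).aestronglyMeasurable _ (Eventually.of_forall (hwb k))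
    have hhi : ∀ k, Integrable (fun ω => h (S k ω)) ℙ := fun k =>
      Integrable.of_bound (hhS k).aestronglyMeasurable _ (Eventually.of_forall fun ω => hhb _)
    -- Truncation at `L` preserves the factors $e^{\pm\eta}$ as $e^{-\eta}\le1\le e^\eta$. After
    -- taking the power $\alpha$, the error is at most $L^\alpha(e^{\alpha\eta}-1)$.
    have hdiff : ∀ᵐ ω ∂ℙ, Tendsto (fun k => w k ω - h (S k ω)) atTop (𝓝 0) := by
      filter_upwards [hWF] with ω hω
      rw [Metric.tendsto_nhds]
      intro δ hδ
      have hcont : Tendsto (fun η : ℝ => L ^ α * (Real.exp (α * η) - 1)) (𝓝[>] 0) (𝓝 0) := by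
        have : Continuous fun η : ℝ => L ^ α * (Real.exp (α * η) - 1) := by fun_prop
        have h0 := this.tendsto 0
        simp only [mul_zero, Real.exp_zero, sub_self] at h0
        exact h0.mono_left nhdsWithin_le_nhds
      obtain ⟨η, hη1, hη⟩ := ((hcont.eventually (gt_mem_nhds hδ)).and self_mem_nhdsWithin).exists
      have hη : 0 < η := hη
      filter_upwards [hω η hη] with k hk
      obtain ⟨hk1, hk2⟩ := hk
      have hfin : W k ω ≠ ∞ := ne_top_of_le_ne_top ENNReal.ofReal_ne_top hk2
      set x := (W k ω).toReal with hx
      set f := F (S k ω) with hf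
      have hf0 : 0 ≤ f := hF0 _
      have hx1 : Real.exp (-η) * f ≤ x := (ENNReal.ofReal_le_iff_le_toReal hfin).1 hk1
      have hx2 : x ≤ Real.exp η * f := ENNReal.toReal_le_of_le_ofReal (by positivity) hk2
      have hx0 : 0 ≤ x := ENNReal.toReal_nonneg
      have hmin : (min (W k ω) (ENNReal.ofReal L)).toReal = min x L := by
        rw [ENNReal.toReal_min hfin ENNReal.ofReal_ne_top, ENNReal.toReal_ofReal hL.le]
      have hexp1 : 1 ≤ Real.exp η := Real.one_le_exp hη.le
      have hexp2 : Real.exp (-η) ≤ 1 := Real.exp_le_one_iff.2 (by linarith)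
      have hm0 : 0 ≤ min f L := le_min hf0 hL.le
      have hup : min x L ≤ Real.exp η * min f L := by
        rw [mul_min_of_nonneg _ _ (Real.exp_nonneg _)]
        exact min_le_min hx2 (by nlinarith)
      have hlo : Real.exp (-η) * min f L ≤ min x L := by
        rw [mul_min_of_nonneg _ _ (Real.exp_nonneg _)]
        exact min_le_min hx1 (by nlinarith)
      have hup' : min x L ^ α ≤ Real.exp (α * η) * min f L ^ α := by
        have := Real.rpow_le_rpow (le_min hx0 hL.le) hup hα0
        rwa [Real.mul_rpow (Real.exp_nonneg _) hm0, ← Real.exp_mul, mul_comm η] at this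
      have hlo' : Real.exp (-(α * η)) * min f L ^ α ≤ min x L ^ α := by
        have := Real.rpow_le_rpow (by positivity) hlo hα0
        rwa [Real.mul_rpow (Real.exp_nonneg _) hm0, ← Real.exp_mul,
          show -η * α = -(α * η) by ring] at this
      have hmL : min f L ^ α ≤ L ^ α := Real.rpow_le_rpow hm0 (min_le_right _ _) hα0
      have hm0' : 0 ≤ min f L ^ α := Real.rpow_nonneg hm0 _
      have hαη : 0 < α * η := mul_pos hα.1 hη
      have he1 := Real.add_one_le_exp (α * η)
      have he2 := Real.add_one_le_exp (-(α * η))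
      have hee : 1 - Real.exp (-(α * η)) ≤ Real.exp (α * η) - 1 := by linarith
      rw [Real.dist_eq, sub_zero]
      refine lt_of_le_of_lt ?_ hη1
      change |(min (W k ω) (ENNReal.ofReal L)).toReal ^ α - min f L ^ α| ≤ _
      rw [hmin, abs_le]
      constructor <;> nlinarith
    have hlim0 : Tendsto (fun k => ∫ ω, (w k ω - h (S k ω)) ∂ℙ) atTop (𝓝 (∫ _, (0 : ℝ) ∂ℙ)) := by
      refine tendsto_integral_of_dominated_convergence (fun _ => L ^ α + L ^ α)
        (fun k => ((hwi k).sub (hhi k)).1) (integrable_const _)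
        (fun k => Eventually.of_forall fun ω => ?_) hdiff
      exact (norm_sub_le _ _).trans (add_le_add (hwb k ω) (hhb _))
    have hlim : Tendsto (fun k => ∫ ω, w k ω ∂ℙ) atTop (𝓝 (∫ z, h z ∂γ)) := by
      have := hlim0.add (hconv h)
      simp only [integral_zero, zero_add] at this
      refine this.congr fun k => ?_
      rw [integral_sub (hwi k) (hhi k)]
      ring
    have hlim' := (ENNReal.continuous_ofReal.tendsto _).comp hlim
    have e1 : ∀ k, ENNReal.ofReal (∫ ω, w k ω ∂ℙ) =
        ∫⁻ ω, min (W k ω) (ENNReal.ofReal L) ^ α ∂ℙ := by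
      intro k
      rw [ofReal_integral_eq_lintegral_ofReal (hwi k)
        (Eventually.of_forall fun ω => Real.rpow_nonneg ENNReal.toReal_nonneg _)]
      refine lintegral_congr fun ω => ?_
      rw [hw]
      dsimp only
      rw [← ENNReal.ofReal_rpow_of_nonneg ENNReal.toReal_nonneg hα0, ENNReal.ofReal_toReal]
      exact ne_top_of_le_ne_top ENNReal.ofReal_ne_top (min_le_right _ _)
    have e2 : ENNReal.ofReal (∫ z, h z ∂γ) =
        ∫⁻ z, min (ENNReal.ofReal (F z)) (ENNReal.ofReal L) ^ α ∂γ := by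
      have hint : Integrable h γ := Integrable.of_bound h.continuous.aestronglyMeasurable _
        (Eventually.of_forall hhb)
      rw [ofReal_integral_eq_lintegral_ofReal hint
        (Eventually.of_forall fun z => Real.rpow_nonneg (hmin0 z) _)]
      refine lintegral_congr fun z => ?_
      change ENNReal.ofReal (min (F z) L ^ α) = _
      rw [← ENNReal.ofReal_rpow_of_nonneg (hmin0 z) hα0, ENNReal.ofReal_min]
    rw [← e2]
    exact hlim'.congr e1
  have hL : ∀ L : ℕ, (0 : ℝ) < (L : ℝ) + 1 := fun L => by positivity
  -- The error $(L+1)^{\alpha-1}V$ tends to $0$ because $\alpha<1$; the shift keeps the level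
  -- positive at `L = 0`.
  refine tendsto_of_approximation
    (b := fun L k => ∫⁻ ω, min (W k ω) (ENNReal.ofReal ((L : ℝ) + 1)) ^ α ∂ℙ)
    (e := fun L => ENNReal.ofReal ((L : ℝ) + 1) ^ (α - 1) * V)
    (fun L => htrunc _ (hL L)) (Eventually.of_forall fun L => ?_) ?_ ?_
  · filter_upwards [hWV] with k hk
    refine ⟨lintegral_mono fun ω => ENNReal.rpow_le_rpow (min_le_left _ _) hα0, ?_⟩
    calc _ ≤ ∫⁻ ω, (min (W k ω) (ENNReal.ofReal ((L : ℝ) + 1)) ^ α +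
          ENNReal.ofReal ((L : ℝ) + 1) ^ (α - 1) * W k ω) ∂ℙ :=
          lintegral_mono fun ω => rpow_le_min_rpow_add hα (by simpa using hL L)
            ENNReal.ofReal_ne_top
      _ ≤ _ := by
          rw [lintegral_add_right _ ((hW k).const_mul _), lintegral_const_mul _ (hW k)]
          gcongr
  · have hmono : Monotone fun L : ℕ => ENNReal.ofReal ((L : ℝ) + 1) := fun a b hab =>
      ENNReal.ofReal_le_ofReal (by have : (a : ℝ) ≤ b := by exact_mod_cast hab
                                   linarith)
    refine lintegral_tendsto_of_tendsto_of_monotone (fun L => ?_)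
      (Eventually.of_forall fun z a b hab => ENNReal.rpow_le_rpow
        (min_le_min le_rfl (hmono hab)) hα0) (Eventually.of_forall fun z => ?_)
    · exact ((hF.measurable.ennreal_ofReal.min measurable_const).pow_const _).aemeasurable
    · refine tendsto_const_nhds.congr' ?_
      obtain ⟨N, hN⟩ := exists_nat_ge (F z)
      filter_upwards [eventually_ge_atTop N] with L hLN
      rw [min_eq_left]
      refine ENNReal.ofReal_le_ofReal ?_
      have : (N : ℝ) ≤ L := by exact_mod_cast hLN
      linarith
  · have hlim : Tendsto (fun L : ℕ => ((L : ℝ) + 1) ^ (α - 1)) atTop (𝓝 0) := by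
      have h1 : Tendsto (fun L : ℕ => (L : ℝ) + 1) atTop atTop :=
        tendsto_atTop_add_const_right _ _ tendsto_natCast_atTop_atTop
      have h2 := (tendsto_rpow_neg_atTop (y := 1 - α) (by linarith [hα.2])).comp h1
      rw [neg_sub] at h2
      exact h2
    have h3 := (ENNReal.continuous_ofReal.tendsto _).comp hlim
    rw [ENNReal.ofReal_zero] at h3
    have h4 := ENNReal.Tendsto.mul_const (b := V) h3 (Or.inr hV)
    rw [zero_mul] at h4
    refine h4.congr fun L => ?_
    simp only [Function.comp]
    rw [← ENNReal.ofReal_rpow_of_pos (hL L)]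

end Truncation

/-! ### Taylor expansion of the log-likelihood and control of its remainder. -/

section LAN

set_option linter.unusedSectionVars false

variable {𝒴 : Type*} [MeasurableSpace 𝒴] {μ : Measure 𝒴} {d : ℕ}
  {ℓ : EuclideanSpace ℝ (Fin d) → 𝒴 → ℝ} {U Θ : Set (EuclideanSpace ℝ (Fin d))}

/-- The law of one observation with parameter `θ`. -/
def law (μ : Measure 𝒴) (ℓ : EuclideanSpace ℝ (Fin d) → 𝒴 → ℝ) (θ : EuclideanSpace ℝ (Fin d)) :
    Measure 𝒴 := μ.withDensity (edensity ℓ θ)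

lemma law_absolutelyContinuous (θ : EuclideanSpace ℝ (Fin d)) : law μ ℓ θ ≪ μ :=
  withDensity_absolutelyContinuous _ _

/-- The variation of the second derivative, measured entrywise. -/
def hessVar (ℓ : EuclideanSpace ℝ (Fin d) → 𝒴 → ℝ) (y : 𝒴) (θ₀ θ : EuclideanSpace ℝ (Fin d)) : ℝ :=
  ∑ i, ∑ j, |hess ℓ y θ (EuclideanSpace.single i 1) (EuclideanSpace.single j 1) -
    hess ℓ y θ₀ (EuclideanSpace.single i 1) (EuclideanSpace.single j 1)|

lemma hessVar_nonneg (y : 𝒴) (θ₀ θ : EuclideanSpace ℝ (Fin d)) : 0 ≤ hessVar ℓ y θ₀ θ :=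
  Finset.sum_nonneg fun _ _ => Finset.sum_nonneg fun _ _ => abs_nonneg _

lemma abs_sum_mul_mul_le (v : EuclideanSpace ℝ (Fin d)) (a : Fin d → Fin d → ℝ) :
    |∑ i, ∑ j, v i * v j * a i j| ≤ ‖v‖ ^ 2 * ∑ i, ∑ j, |a i j| := by
  rw [Finset.mul_sum]
  refine (Finset.abs_sum_le_sum_abs _ _).trans (Finset.sum_le_sum fun i _ => ?_)
  rw [Finset.mul_sum]
  refine (Finset.abs_sum_le_sum_abs _ _).trans (Finset.sum_le_sum fun j _ => ?_)
  rw [abs_mul, abs_mul, sq]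
  have h : ∀ i, |v i| ≤ ‖v‖ := fun i => PiLp.norm_apply_le v i
  gcongr <;> exact h _

lemma abs_hess_sub_le (y : 𝒴) (θ₀ θ v : EuclideanSpace ℝ (Fin d)) :
    |hess ℓ y θ v v - hess ℓ y θ₀ v v| ≤ hessVar ℓ y θ₀ θ * ‖v‖ ^ 2 := by
  rw [hess_apply_eq_sum y θ v v, hess_apply_eq_sum y θ₀ v v, ← Finset.sum_sub_distrib]
  simp_rw [← Finset.sum_sub_distrib, ← mul_sub]
  rw [mul_comm]
  exact abs_sum_mul_mul_le v _

lemma hessVar_le (y : 𝒴) (θ₀ θ : EuclideanSpace ℝ (Fin d)) :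
    hessVar ℓ y θ₀ θ ≤ d ^ 2 * (‖hess ℓ y θ‖ + ‖hess ℓ y θ₀‖) := by
  have h : ∀ θ i j, |hess ℓ y θ (EuclideanSpace.single i 1) (EuclideanSpace.single j 1)| ≤
      ‖hess ℓ y θ‖ := fun θ i j => by
    refine (ContinuousLinearMap.le_opNorm₂ (hess ℓ y θ) _ _).trans ?_
    simp
  calc _ ≤ ∑ _i : Fin d, ∑ _j : Fin d, (‖hess ℓ y θ‖ + ‖hess ℓ y θ₀‖) :=
        Finset.sum_le_sum fun i _ => Finset.sum_le_sum fun j _ =>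
          (abs_sub _ _).trans (add_le_add (h _ _ _) (h _ _ _))
    _ = _ := by simp; ring

/-- A second-order Taylor expansion of the log-likelihood. -/
lemma abs_logLik_sub_le {y : 𝒴} {θ₀ v : EuclideanSpace ℝ (Fin d)} {K : ℝ}
    (h1 : ∀ t ∈ Icc (0 : ℝ) 1, HasFDerivAt (logLik ℓ y) (score ℓ y (θ₀ + t • v)) (θ₀ + t • v))
    (h2 : ∀ t ∈ Icc (0 : ℝ) 1, HasFDerivAt (score ℓ y) (hess ℓ y (θ₀ + t • v)) (θ₀ + t • v))
    (hK : ∀ t ∈ Icc (0 : ℝ) 1, hessVar ℓ y θ₀ (θ₀ + t • v) ≤ K) :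
    |logLik ℓ y (θ₀ + v) - logLik ℓ y θ₀ - (score ℓ y θ₀ v + hess ℓ y θ₀ v v / 2)| ≤
      K * ‖v‖ ^ 2 := by
  have hline : ∀ t : ℝ, HasDerivAt (fun t : ℝ => θ₀ + t • v) v t := fun t => by
    simpa using ((hasDerivAt_id t).smul_const v).const_add θ₀
  have hK0 : 0 ≤ K := (hessVar_nonneg y θ₀ _).trans (hK 0 (by simp))
  -- Two mean value inequalities along the segment, first for the score and then for the
  -- log-likelihood. The factor $1/2$ in the remainder is given away.
  have hd1 : ∀ t ∈ Icc (0 : ℝ) 1, HasDerivAt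
      (fun t => score ℓ y (θ₀ + t • v) v - t * hess ℓ y θ₀ v v)
      (hess ℓ y (θ₀ + t • v) v v - hess ℓ y θ₀ v v) t := by
    intro t ht
    have h3 := (h2 t ht).comp_hasDerivAt t (hline t)
    have h4 : HasDerivAt (fun t => score ℓ y (θ₀ + t • v) v) (hess ℓ y (θ₀ + t • v) v v) t := by
      simpa using h3.clm_apply (hasDerivAt_const t v)
    have h5 := h4.sub ((hasDerivAt_id t).mul_const (hess ℓ y θ₀ v v))
    rw [one_mul] at h5
    exact h5
  have hb1 : ∀ t ∈ Icc (0 : ℝ) 1,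
      ‖(score ℓ y (θ₀ + t • v) v - t * hess ℓ y θ₀ v v) - score ℓ y θ₀ v‖ ≤ K * ‖v‖ ^ 2 := by
    intro t ht
    have := norm_image_sub_le_of_norm_deriv_le_segment' (C := K * ‖v‖ ^ 2)
      (fun s hs => (hd1 s hs).hasDerivWithinAt) (fun s hs => by
        have hs' := Ico_subset_Icc_self hs
        refine (abs_hess_sub_le y θ₀ _ v).trans ?_
        gcongr
        exact hK s hs') t ht
    simp only [zero_smul, add_zero, zero_mul, sub_zero] at this
    refine this.trans ?_
    exact mul_le_of_le_one_right (by positivity) ht.2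
  have hd2 : ∀ t ∈ Icc (0 : ℝ) 1, HasDerivAt
      (fun t => logLik ℓ y (θ₀ + t • v) - t * score ℓ y θ₀ v - t ^ 2 / 2 * hess ℓ y θ₀ v v)
      ((score ℓ y (θ₀ + t • v) v - t * hess ℓ y θ₀ v v) - score ℓ y θ₀ v) t := by
    intro t ht
    have h3 := (h1 t ht).comp_hasDerivAt t (hline t)
    have h4 : HasDerivAt (fun t : ℝ => t ^ 2 / 2) t t := by
      convert! ((hasDerivAt_id t).pow 2).div_const 2 using 1
      simp
    convert! (h3.sub ((hasDerivAt_id t).mul_const (score ℓ y θ₀ v))).sub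
      (h4.mul_const (hess ℓ y θ₀ v v)) using 1
    ring
  have := norm_image_sub_le_of_norm_deriv_le_segment_01' (C := K * ‖v‖ ^ 2)
    (fun s hs => (hd2 s hs).hasDerivWithinAt) (fun s hs => hb1 s (Ico_subset_Icc_self hs))
  rw [Real.norm_eq_abs] at this
  convert! this using 2
  simp
  ring

namespace IsRegularModel

variable (hℓ : IsRegularModel μ ℓ U Θ)
include hℓ

lemma isProbabilityMeasure_law {θ : EuclideanSpace ℝ (Fin d)} (hθ : θ ∈ U) :
    IsProbabilityMeasure (law μ ℓ θ) :=
  ⟨by rw [law, withDensity_apply _ MeasurableSet.univ, Measure.restrict_univ,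
    hℓ.lintegral_edensity hθ]⟩

lemma integral_law {θ : EuclideanSpace ℝ (Fin d)} (hθ : θ ∈ U) (h : 𝒴 → ℝ) :
    ∫ y, h y ∂(law μ ℓ θ) = ∫ y, h y * ℓ θ y ∂μ := by
  rw [law, integral_withDensity_eq_integral_toReal_smul hℓ.measurable_edensity.of_uncurry_left
    (Eventually.of_forall fun y => ENNReal.ofReal_lt_top)]
  refine integral_congr_ae (Eventually.of_forall fun y => ?_)
  simp [edensity, ENNReal.toReal_ofReal (hℓ.nonneg θ hθ y), mul_comm]

lemma integrable_law {θ : EuclideanSpace ℝ (Fin d)} (hθ : θ ∈ U) {h : 𝒴 → ℝ}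
    (hh : Integrable (fun y => h y * ℓ θ y) μ) : Integrable h (law μ ℓ θ) := by
  rw [law, integrable_withDensity_iff hℓ.measurable_edensity.of_uncurry_left
    (Eventually.of_forall fun y => ENNReal.ofReal_lt_top)]
  refine hh.congr (Eventually.of_forall fun y => ?_)
  simp [edensity, ENNReal.toReal_ofReal (hℓ.nonneg θ hθ y)]

/-- The law does not charge the zeros of its own density, and the support is common to all
parameters. Hence likelihood ratios are well defined along almost every sample. -/
lemma ae_law_pos {θ : EuclideanSpace ℝ (Fin d)} (hθ : θ ∈ U) :
    ∀ᵐ y ∂(law μ ℓ θ), ∀ θ' ∈ U, 0 < ℓ θ' y := by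
  rw [law, ae_withDensity_iff hℓ.measurable_edensity.of_uncurry_left]
  filter_upwards [hℓ.commonSupport] with y hy hne
  refine hy.resolve_right fun h0 => hne ?_
  simp [edensity, h0 θ hθ]

/-- Integrable bounds for the local variation of the second derivative. -/
lemma exists_hessVar_le {θ₀ : EuclideanSpace ℝ (Fin d)} (hθ₀ : θ₀ ∈ Θ) :
    ∃ r > 0, ∃ h : ℕ → 𝒴 → ℝ, Metric.ball θ₀ r ⊆ U ∧ (∀ n, Integrable (h n) (law μ ℓ θ₀)) ∧
      Tendsto (fun n => ∫ y, h n y ∂(law μ ℓ θ₀)) atTop (𝓝 0) ∧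
      ∀ᵐ y ∂(law μ ℓ θ₀), ∀ n : ℕ, ∀ v : EuclideanSpace ℝ (Fin d), ‖v‖ < r / (n + 1) →
        hessVar ℓ y θ₀ (θ₀ + v) ≤ h n y := by
  have hθU := hℓ.subset hθ₀
  obtain ⟨r, hr, H, hU, hH, hdom⟩ := hℓ.exists_dominated hθ₀
  have hrn : ∀ n : ℕ, 0 < r / ((n : ℝ) + 1) := fun n => by positivity
  have hrle : ∀ n : ℕ, r / ((n : ℝ) + 1) ≤ r := fun n =>
    div_le_self hr.le (by linarith [(Nat.cast_nonneg n : (0 : ℝ) ≤ n)])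
  have hball : ∀ n : ℕ, ∀ v : EuclideanSpace ℝ (Fin d), ‖v‖ < r / (n + 1) →
      θ₀ + v ∈ Metric.ball θ₀ r := fun n v hv => by
    rw [mem_ball_iff_norm, add_sub_cancel_left]
    exact hv.trans_le (hrle n)
  -- The supremum of the variation is taken over a countable dense set of increments, so that it is
  -- measurable.
  set x := TopologicalSpace.denseSeq (EuclideanSpace ℝ (Fin d)) with hx
  classical
  set g : ℕ → ℕ → 𝒴 → ℝ≥0∞ := fun n m y =>
    if ‖x m‖ < r / (n + 1) then ENNReal.ofReal (hessVar ℓ y θ₀ (θ₀ + x m)) else 0 with hg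
  have hgm : ∀ n m, AEMeasurable (g n m) (law μ ℓ θ₀) := by
    intro n m
    by_cases hm : ‖x m‖ < r / (n + 1)
    · simp only [hg, hm, if_true]
      refine AEMeasurable.ennreal_ofReal ?_
      refine Finset.aemeasurable_fun_sum _ fun i _ => Finset.aemeasurable_fun_sum _ fun j _ => ?_
      have h1 := (hℓ.aestronglyMeasurable_hess_apply (hU (hball n _ hm))
        (EuclideanSpace.single i 1) (EuclideanSpace.single j 1)).sub
        (hℓ.aestronglyMeasurable_hess_apply hθU (EuclideanSpace.single i 1)
          (EuclideanSpace.single j 1))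
      exact h1.norm.aemeasurable.mono_ac (law_absolutelyContinuous θ₀)
    · simp only [hg, hm, if_false]
      exact aemeasurable_const
  -- Integrability under the law of `θ₀` restores the factor `ℓ θ₀ y`, which cancels the denominator
  -- and leaves `H`.
  set b : 𝒴 → ℝ := fun y => 2 * d ^ 2 * H y / ℓ θ₀ y with hb
  have hpos := hℓ.ae_law_pos hθU
  have hle : ∀ᵐ y ∂(law μ ℓ θ₀), ∀ θ ∈ Metric.ball θ₀ r, hessVar ℓ y θ₀ θ ≤ b y := by
    filter_upwards [hpos, (law_absolutelyContinuous θ₀).ae_le hdom] with y hy1 hy2 θ hθ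
    have hl := hy1 θ₀ hθU
    have h0 := Metric.mem_ball_self (x := θ₀) hr
    have h1 := (hy2 θ₀ h0 θ hθ).2.2.1
    have h2 := (hy2 θ₀ h0 θ₀ h0).2.2.1
    rw [hb, le_div_iff₀ hl]
    calc _ ≤ d ^ 2 * (‖hess ℓ y θ‖ + ‖hess ℓ y θ₀‖) * ℓ θ₀ y := by
          gcongr; exact hessVar_le y θ₀ θ
      _ = d ^ 2 * (‖hess ℓ y θ‖ * ℓ θ₀ y + ‖hess ℓ y θ₀‖ * ℓ θ₀ y) := by ring
      _ ≤ d ^ 2 * (H y + H y) := by gcongr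
      _ = _ := by ring
  have hbint : Integrable b (law μ ℓ θ₀) := by
    refine hℓ.integrable_law hθU ((hH.const_mul (2 * (d : ℝ) ^ 2)).mono ?_ ?_)
    · exact (((hH.1.const_mul _).aemeasurable.div
        (hℓ.measurable_density θ₀).aemeasurable).mul
          (hℓ.measurable_density θ₀).aemeasurable).aestronglyMeasurable
    · refine Eventually.of_forall fun y => ?_
      by_cases h0 : ℓ θ₀ y = 0
      · simp only [hb, h0, mul_zero, norm_zero]
        exact norm_nonneg _
      · simp only [hb]
        rw [div_mul_cancel₀ _ h0]
  have hsup : ∀ᵐ y ∂(law μ ℓ θ₀), ∀ n, ⨆ m, g n m y ≤ ENNReal.ofReal (b y) := by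
    filter_upwards [hle] with y hy n
    refine iSup_le fun m => ?_
    by_cases hm : ‖x m‖ < r / (n + 1)
    · simp only [hg, hm, if_true]
      exact ENNReal.ofReal_le_ofReal (hy _ (hball n _ hm))
    · simp [hg, hm]
  have hb0 : ∀ᵐ y ∂(law μ ℓ θ₀), 0 ≤ b y := by
    filter_upwards [hle] with y hy
    exact (hessVar_nonneg y θ₀ θ₀).trans (hy θ₀ (Metric.mem_ball_self hr))
  have hcont : ∀ᵐ y ∂(law μ ℓ θ₀), ∀ θ ∈ U, ContinuousAt (fun θ => hessVar ℓ y θ₀ θ) θ := by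
    filter_upwards [(law_absolutelyContinuous θ₀).ae_le hℓ.ae_continuousAt_hess] with y hy θ hθ
    refine tendsto_finsetSum _ fun i _ => tendsto_finsetSum _ fun j _ => ?_
    exact ((((hy θ hθ).clm_apply continuousAt_const).clm_apply continuousAt_const).sub
      continuousAt_const).abs
  have hhm : ∀ n, AEStronglyMeasurable (fun y => (⨆ m, g n m y).toReal) (law μ ℓ θ₀) := fun n =>
    (AEMeasurable.iSup (hgm n)).ennreal_toReal.aestronglyMeasurable
  have hhb : ∀ n, ∀ᵐ y ∂(law μ ℓ θ₀), ‖(⨆ m, g n m y).toReal‖ ≤ b y := fun n => by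
    filter_upwards [hsup, hb0] with y hy hy0
    rw [Real.norm_of_nonneg ENNReal.toReal_nonneg]
    exact ENNReal.toReal_le_of_le_ofReal hy0 (hy n)
  refine ⟨r, hr, fun n y => (⨆ m, g n m y).toReal, hU, fun n => hbint.mono' (hhm n) (hhb n), ?_, ?_⟩
  · rw [← integral_zero 𝒴 ℝ (μ := law μ ℓ θ₀)]
    refine tendsto_integral_of_dominated_convergence b hhm hbint hhb ?_
    filter_upwards [hcont] with y hy
    have hc := hy θ₀ hθU
    have h0 : hessVar ℓ y θ₀ θ₀ = 0 := by simp [hessVar]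
    rw [Metric.tendsto_atTop]
    intro η hη
    obtain ⟨δ, hδ, hδ'⟩ := Metric.continuousAt_iff.1 hc (η / 2) (half_pos hη)
    have hlim : Tendsto (fun n : ℕ => r / ((n : ℝ) + 1)) atTop (𝓝 0) :=
      tendsto_const_nhds.div_atTop (tendsto_atTop_add_const_right _ _ tendsto_natCast_atTop_atTop)
    obtain ⟨N, hN⟩ := eventually_atTop.1 (hlim.eventually (gt_mem_nhds hδ))
    refine ⟨N, fun n hn => ?_⟩
    rw [Real.dist_eq, sub_zero, abs_of_nonneg ENNReal.toReal_nonneg]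
    refine lt_of_le_of_lt (ENNReal.toReal_le_of_le_ofReal (half_pos hη).le
      (iSup_le fun m => ?_)) (half_lt_self hη)
    by_cases hm : ‖x m‖ < r / (n + 1)
    · simp only [hg, hm, if_true]
      refine ENNReal.ofReal_le_ofReal ?_
      have := hδ' (x := θ₀ + x m) (by simpa using hm.trans (hN n hn))
      rw [h0, Real.dist_eq, sub_zero] at this
      exact (le_abs_self _).trans this.le
    · simp [hg, hm]
  -- Exceeding the supremum and lying in the ball are open conditions on the increment, so a
  -- violation would already occur at a point of the dense sequence.
  · filter_upwards [hcont, hsup] with y hy hs n v hv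
    by_contra! hlt
    have hcv : ContinuousAt (fun v => hessVar ℓ y θ₀ (θ₀ + v)) v := by
      have := hy (θ₀ + v) (hU (hball n v hv))
      exact ContinuousAt.comp (f := fun v => θ₀ + v) this (by fun_prop)
    have hev : ∀ᶠ w in 𝓝 v, (⨆ m, g n m y).toReal < hessVar ℓ y θ₀ (θ₀ + w) ∧ ‖w‖ < r / (n + 1) :=
      (hcv.eventually (lt_mem_nhds hlt)).and (continuous_norm.continuousAt.eventually
        (gt_mem_nhds hv))
    obtain ⟨m, hw⟩ := (TopologicalSpace.denseRange_denseSeq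
      (EuclideanSpace ℝ (Fin d))).exists_mem_open isOpen_interior
        ⟨v, mem_interior_iff_mem_nhds.2 hev⟩
    have hw' := interior_subset hw
    have h1 : ENNReal.ofReal (hessVar ℓ y θ₀ (θ₀ + x m)) ≤ ⨆ m, g n m y := by
      refine le_trans (le_of_eq ?_) (le_iSup _ m)
      simp only [hg]
      rw [if_pos hw'.2]
    have h2 := (ENNReal.ofReal_le_iff_le_toReal
      (ne_top_of_le_ne_top ENNReal.ofReal_ne_top (hs n))).1 h1
    exact absurd hw'.1 (not_lt.2 h2)

end IsRegularModel

end LAN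

/-! ### Local asymptotic normality. -/

section LAN

variable {𝒴 : Type*} [MeasurableSpace 𝒴] {μ : Measure 𝒴} {d : ℕ}
  {ℓ : EuclideanSpace ℝ (Fin d) → 𝒴 → ℝ} {U Θ : Set (EuclideanSpace ℝ (Fin d))}

namespace IsRegularModel

variable (hℓ : IsRegularModel μ ℓ U Θ)
include hℓ

/-- The score in standardized coordinates. -/
lemma exists_standardized_score {θ₀ : EuclideanSpace ℝ (Fin d)} (hθ₀ : θ₀ ∈ Θ)
    {A : EuclideanSpace ℝ (Fin d) ≃L[ℝ] EuclideanSpace ℝ (Fin d)}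
    (hA : ∀ v, ∫ y, score ℓ y θ₀ (A v) ^ 2 * ℓ θ₀ y ∂μ = ‖v‖ ^ 2) :
    ∃ T : 𝒴 → EuclideanSpace ℝ (Fin d), Measurable T ∧
      (∀ᵐ y ∂(law μ ℓ θ₀), ∀ u, inner ℝ (T y) u = score ℓ y θ₀ (A u)) ∧
      (∀ u, ∫ y, inner ℝ (T y) u ∂(law μ ℓ θ₀) = 0) ∧
      ∀ u, ∫ y, inner ℝ (T y) u ^ 2 ∂(law μ ℓ θ₀) = ‖u‖ ^ 2 := by
  have hθU := hℓ.subset hθ₀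
  set T₀ : 𝒴 → EuclideanSpace ℝ (Fin d) := fun y =>
    (InnerProductSpace.toDual ℝ (EuclideanSpace ℝ (Fin d))).symm
      ((score ℓ y θ₀).comp (A : EuclideanSpace ℝ (Fin d) →L[ℝ] EuclideanSpace ℝ (Fin d))) with hT₀
  have hT₀i : ∀ y u, inner ℝ (T₀ y) u = score ℓ y θ₀ (A u) := fun y u => by
    rw [hT₀, InnerProductSpace.toDual_symm_apply]
    rfl
  have hm : AEStronglyMeasurable T₀ (law μ ℓ θ₀) := by
    refine (InnerProductSpace.toDual ℝ (EuclideanSpace ℝ (Fin d))).symm.continuous.comp_aestronglyMeasurable ?_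
    have h := (hℓ.aestronglyMeasurable_score hθU).mono_ac (law_absolutelyContinuous (ℓ := ℓ) θ₀)
    have hc : Continuous fun D : EuclideanSpace ℝ (Fin d) →L[ℝ] ℝ =>
        D.comp (A : EuclideanSpace ℝ (Fin d) →L[ℝ] EuclideanSpace ℝ (Fin d)) :=
      continuous_id.clm_comp continuous_const
    exact hc.comp_aestronglyMeasurable h
  have hae : ∀ᵐ y ∂(law μ ℓ θ₀), ∀ u, inner ℝ (hm.mk T₀ y) u = score ℓ y θ₀ (A u) := by
    filter_upwards [hm.ae_eq_mk] with y hy u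
    rw [← hy, hT₀i]
  -- The Riesz representative of the score is only a.e. measurable; the central limit theorem is
  -- applied to a measurable modification.
  refine ⟨hm.mk T₀, hm.stronglyMeasurable_mk.measurable, hae, fun u => ?_, fun u => ?_⟩
  · rw [integral_congr_ae (g := fun y => score ℓ y θ₀ (A u)) (hae.mono fun y hy => hy u),
      hℓ.integral_law hθU]
    exact (hℓ.integral_score_eq_zero_and_sq hθ₀ (A u)).1
  · rw [integral_congr_ae (g := fun y => score ℓ y θ₀ (A u) ^ 2)
      (hae.mono fun y hy => by dsimp only; rw [hy u]), hℓ.integral_law hθU]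
    exact hA u

/-- Local asymptotic normality, uniformly on bounded sets of local parameters. -/
lemma ae_logLik_expansion {θ₀ : EuclideanSpace ℝ (Fin d)} (hθ₀ : θ₀ ∈ Θ)
    [IsProbabilityMeasure (law μ ℓ θ₀)]
    {A : EuclideanSpace ℝ (Fin d) ≃L[ℝ] EuclideanSpace ℝ (Fin d)}
    (hA : ∀ v, ∫ y, hess ℓ y θ₀ (A v) (A v) * ℓ θ₀ y ∂μ = - ‖v‖ ^ 2)
    {T : 𝒴 → EuclideanSpace ℝ (Fin d)}
    (hT : ∀ᵐ y ∂(law μ ℓ θ₀), ∀ u, inner ℝ (T y) u = score ℓ y θ₀ (A u)) (M : ℝ) :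
    ∀ᵐ ω ∂(sampleLaw (law μ ℓ θ₀)), ∀ η > 0, ∀ᶠ k : ℕ in atTop,
      ∀ u : EuclideanSpace ℝ (Fin d), ‖u‖ ≤ M →
        |∑ i ∈ Finset.range k, (logLik ℓ (ω i) (θ₀ + (Real.sqrt k)⁻¹ • A u) - logLik ℓ (ω i) θ₀) -
          (inner ℝ (normalizedSum T k ω) u - ‖u‖ ^ 2 / 2)| ≤ η := by
  have hθU := hℓ.subset hθ₀
  obtain ⟨r, hr, h, hU, hint, hlim, hh⟩ := hℓ.exists_hessVar_le hθ₀
  set e : Fin d → EuclideanSpace ℝ (Fin d) := fun i => EuclideanSpace.single i 1 with he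
  have hq : ∀ i j, Integrable (fun y => hess ℓ y θ₀ (e i) (e j)) (law μ ℓ θ₀) := fun i j =>
    hℓ.integrable_law hθU (hℓ.integrable_hess_apply hθ₀ _ _)
  set D : Fin d → Fin d → ℝ := fun i j => ∫ y, hess ℓ y θ₀ (e i) (e j) ∂(law μ ℓ θ₀) with hD
  have hDquad : ∀ u, ∑ i, ∑ j, A u i * A u j * D i j = - ‖u‖ ^ 2 := by
    intro u
    rw [← hA u, ← hℓ.integral_law hθU]
    simp_rw [hess_apply_eq_sum _ θ₀ (A u) (A u)]
    rw [integral_finsetSum _ fun i _ => integrable_finsetSum _ fun j _ => (hq i j).const_mul _]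
    refine Finset.sum_congr rfl fun i _ => ?_
    rw [integral_finsetSum _ fun j _ => (hq i j).const_mul _]
    refine Finset.sum_congr rfl fun j _ => ?_
    rw [integral_const_mul]
  -- One null set serves all radii `r / (n + 1)`, so that `n` may later depend on `η`.
  have hslln1 : ∀ᵐ ω ∂(sampleLaw (law μ ℓ θ₀)), ∀ n, Tendsto
      (fun k : ℕ => (∑ i ∈ Finset.range k, h n (ω i)) / k) atTop
        (𝓝 (∫ y, h n y ∂(law μ ℓ θ₀))) := ae_all_iff.2 fun n => strong_law_sampleLaw (hint n)
  have hslln2 : ∀ᵐ ω ∂(sampleLaw (law μ ℓ θ₀)), ∀ a b, Tendsto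
      (fun k : ℕ => (∑ i ∈ Finset.range k, hess ℓ (ω i) θ₀ (e a) (e b)) / k) atTop
        (𝓝 (D a b)) :=
    ae_all_iff.2 fun a => ae_all_iff.2 fun b => strong_law_sampleLaw (hq a b)
  have hgood : ∀ᵐ y ∂(law μ ℓ θ₀), (∀ θ ∈ U, HasFDerivAt (logLik ℓ y) (score ℓ y θ) θ) ∧
      ∀ θ ∈ U, HasFDerivAt (score ℓ y) (hess ℓ y θ) θ := by
    filter_upwards [(law_absolutelyContinuous θ₀).ae_le hℓ.ae_differentiableAt_logLik,
      (law_absolutelyContinuous θ₀).ae_le hℓ.ae_hasFDerivAt_score] with y h1 h2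
    exact ⟨fun θ hθ => (h1 θ hθ).hasFDerivAt, h2⟩
  filter_upwards [hslln1, hslln2, ae_sampleLaw_forall hgood, ae_sampleLaw_forall hh,
    ae_sampleLaw_forall hT] with ω h1 h2 h3 h4 h5 η hη
  set a := ‖(A : EuclideanSpace ℝ (Fin d) →L[ℝ] EuclideanSpace ℝ (Fin d))‖ with ha
  -- Bounds $\|Au\|^2$ for $\|u\|\le M$; the summand $1$ makes division by `C` legitimate. The
  -- threshold $\eta/(2C)$ gives $\eta/2$ each to the Taylor remainder and to the averaged second
  -- derivative.
  set C : ℝ := (a * M) ^ 2 + 1 with hC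
  have hC0 : 0 < C := by positivity
  obtain ⟨n, hn⟩ := (hlim.eventually (gt_mem_nhds (show 0 < η / (2 * C) by positivity))).exists
  have ev1 := (h1 n).eventually (gt_mem_nhds hn)
  have hη2 : Tendsto (fun k : ℕ => ∑ i, ∑ j,
      |(∑ m ∈ Finset.range k, hess ℓ (ω m) θ₀ (e i) (e j)) / k - D i j|) atTop (𝓝 0) := by
    have : Tendsto (fun k : ℕ => ∑ i, ∑ j,
        |(∑ m ∈ Finset.range k, hess ℓ (ω m) θ₀ (e i) (e j)) / k - D i j|) atTop
          (𝓝 (∑ i : Fin d, ∑ j : Fin d, |D i j - D i j|)) :=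
      tendsto_finsetSum _ fun i _ => tendsto_finsetSum _ fun j _ =>
        ((h2 i j).sub tendsto_const_nhds).abs
    simpa using this
  have ev2 := hη2.eventually (gt_mem_nhds (show 0 < η / (2 * C) by positivity))
  have hsq : Tendsto (fun k : ℕ => (Real.sqrt k)⁻¹ * (a * M)) atTop (𝓝 0) := by
    have := (tendsto_inv_atTop_zero.comp (Real.tendsto_sqrt_atTop.comp
      (tendsto_natCast_atTop_atTop (R := ℝ)))).mul_const (a * M)
    simpa using this
  have ev3 := hsq.eventually (gt_mem_nhds (show 0 < r / ((n : ℝ) + 1) by positivity))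
  filter_upwards [ev1, ev2, ev3, eventually_gt_atTop 0] with k hk1 hk2 hk3 hk0 u hu
  have hk0' : (0 : ℝ) < k := by exact_mod_cast hk0
  set v := A u with hv
  have hvn : ‖v‖ ≤ a * M := by
    refine ((A : EuclideanSpace ℝ (Fin d) →L[ℝ] EuclideanSpace ℝ (Fin d)).le_opNorm u).trans ?_
    gcongr
  set w := (Real.sqrt k)⁻¹ • v with hw
  have hwn : ‖w‖ < r / (n + 1) := by
    rw [hw, norm_smul, Real.norm_of_nonneg (by positivity)]
    refine lt_of_le_of_lt ?_ hk3
    gcongr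
  have hwsq : ‖w‖ ^ 2 = ‖v‖ ^ 2 / k := by
    rw [hw, norm_smul, mul_pow, Real.norm_of_nonneg (by positivity), inv_pow,
      Real.sq_sqrt hk0'.le]
    ring
  have hwt : ∀ t ∈ Icc (0 : ℝ) 1, ‖t • w‖ < r / (n + 1) := fun t ht => by
    rw [norm_smul, Real.norm_of_nonneg ht.1]
    exact lt_of_le_of_lt (mul_le_of_le_one_left (norm_nonneg _) ht.2) hwn
  have hwU : ∀ t ∈ Icc (0 : ℝ) 1, θ₀ + t • w ∈ U := fun t ht => hU (by
    rw [mem_ball_iff_norm, add_sub_cancel_left]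
    exact (hwt t ht).trans_le (div_le_self hr.le (by linarith [(Nat.cast_nonneg n : (0 : ℝ) ≤ n)])))
  have hterm : ∀ i, |logLik ℓ (ω i) (θ₀ + w) - logLik ℓ (ω i) θ₀ -
      (score ℓ (ω i) θ₀ w + hess ℓ (ω i) θ₀ w w / 2)| ≤ h n (ω i) * ‖w‖ ^ 2 := fun i =>
    abs_logLik_sub_le (fun t ht => (h3 i).1 _ (hwU t ht)) (fun t ht => (h3 i).2 _ (hwU t ht))
      (fun t ht => h4 i n _ (hwt t ht))
  have hsum : |∑ i ∈ Finset.range k, (logLik ℓ (ω i) (θ₀ + w) - logLik ℓ (ω i) θ₀ -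
      (score ℓ (ω i) θ₀ w + hess ℓ (ω i) θ₀ w w / 2))| ≤
        ‖v‖ ^ 2 * ((∑ i ∈ Finset.range k, h n (ω i)) / k) := by
    refine (Finset.abs_sum_le_sum_abs _ _).trans ((Finset.sum_le_sum fun i _ => hterm i).trans ?_)
    rw [← Finset.sum_mul, hwsq]
    exact le_of_eq (by ring)
  have hscore : ∑ i ∈ Finset.range k, score ℓ (ω i) θ₀ w = inner ℝ (normalizedSum T k ω) u := by
    rw [normalizedSum, real_inner_smul_left, sum_inner, Finset.mul_sum]
    refine Finset.sum_congr rfl fun i _ => ?_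
    rw [h5 i u, hw, map_smul, smul_eq_mul]
  have hhess : ∑ i ∈ Finset.range k, hess ℓ (ω i) θ₀ w w =
      ∑ a, ∑ b, v a * v b * ((∑ m ∈ Finset.range k, hess ℓ (ω m) θ₀ (e a) (e b)) / k) := by
    have : ∀ i, hess ℓ (ω i) θ₀ w w = ∑ a, ∑ b, v a * v b * (hess ℓ (ω i) θ₀ (e a) (e b) / k) := by
      intro i
      have hww : hess ℓ (ω i) θ₀ w w = hess ℓ (ω i) θ₀ v v / k := by
        rw [hw, map_smul, map_smul, smul_apply, smul_eq_mul, smul_eq_mul, ← mul_assoc,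
          ← mul_inv, Real.mul_self_sqrt hk0'.le]
        ring
      rw [hww, hess_apply_eq_sum, Finset.sum_div]
      refine Finset.sum_congr rfl fun a _ => ?_
      rw [Finset.sum_div]
      exact Finset.sum_congr rfl fun b _ => by ring
    simp_rw [this]
    rw [Finset.sum_comm]
    refine Finset.sum_congr rfl fun a _ => ?_
    rw [Finset.sum_comm]
    refine Finset.sum_congr rfl fun b _ => ?_
    rw [← Finset.mul_sum, Finset.sum_div]
  have hhess' : |∑ i ∈ Finset.range k, hess ℓ (ω i) θ₀ w w - -‖u‖ ^ 2| ≤ ‖v‖ ^ 2 * ∑ i, ∑ j,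
      |(∑ m ∈ Finset.range k, hess ℓ (ω m) θ₀ (e i) (e j)) / k - D i j| := by
    have hDq : ∑ i, ∑ j, v i * v j * D i j = -‖u‖ ^ 2 := hDquad u
    rw [hhess, ← hDq, ← Finset.sum_sub_distrib]
    simp_rw [← Finset.sum_sub_distrib, ← mul_sub]
    exact abs_sum_mul_mul_le v _
  rw [Finset.sum_sub_distrib, Finset.sum_add_distrib, hscore, ← Finset.sum_div] at hsum
  have hvC : ‖v‖ ^ 2 ≤ C := by
    have : ‖v‖ ^ 2 ≤ (a * M) ^ 2 := by gcongr
    linarith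
  have hb1 : ‖v‖ ^ 2 * ((∑ i ∈ Finset.range k, h n (ω i)) / k) ≤ η / 2 := by
    rcases le_total 0 ((∑ i ∈ Finset.range k, h n (ω i)) / k) with hs | hs
    · calc _ ≤ C * (η / (2 * C)) := by gcongr
        _ = η / 2 := by field_simp
    · exact (mul_nonpos_of_nonneg_of_nonpos (sq_nonneg _) hs).trans (half_pos hη).le
  have hb2 : ‖v‖ ^ 2 * ∑ i, ∑ j,
      |(∑ m ∈ Finset.range k, hess ℓ (ω m) θ₀ (e i) (e j)) / k - D i j| ≤ η / 2 := by
    calc _ ≤ C * (η / (2 * C)) := by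
          gcongr
      _ = η / 2 := by field_simp
  have h6 := abs_le.1 (hsum.trans hb1)
  have h7 := abs_le.1 (hhess'.trans hb2)
  refine abs_le.2 ⟨?_, ?_⟩ <;> linarith [h6.1, h6.2, h7.1, h7.2]

end IsRegularModel

end LAN

/-! ### The affinity of a window of size $1/\sqrt k$ and its Gaussian limit. -/

section LocalLimit

variable {𝒴 : Type*} [MeasurableSpace 𝒴] {μ : Measure 𝒴} {d : ℕ}
  {ℓ : EuclideanSpace ℝ (Fin d) → 𝒴 → ℝ} {U Θ : Set (EuclideanSpace ℝ (Fin d))}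

/-- The parameter with local coordinate `u` around `θ₀`, on the scale `1 / √k`. -/
def localMap (A : EuclideanSpace ℝ (Fin d) ≃L[ℝ] EuclideanSpace ℝ (Fin d))
    (θ₀ : EuclideanSpace ℝ (Fin d)) (k : ℕ) (u : EuclideanSpace ℝ (Fin d)) :
    EuclideanSpace ℝ (Fin d) := θ₀ + (Real.sqrt k)⁻¹ • A u

variable (A : EuclideanSpace ℝ (Fin d) ≃L[ℝ] EuclideanSpace ℝ (Fin d))
  (θ₀ : EuclideanSpace ℝ (Fin d)) (M : ℝ)

lemma continuous_localMap (k : ℕ) : Continuous (localMap A θ₀ k) := by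
  unfold localMap
  fun_prop

/-- The image of the ball of radius `M` in local coordinates. -/
def window (k : ℕ) : Set (EuclideanSpace ℝ (Fin d)) :=
  localMap A θ₀ k '' Metric.closedBall 0 M

/-- The Lebesgue measure in local coordinates. -/
def localMeasure (k : ℕ) : Measure (EuclideanSpace ℝ (Fin d)) :=
  (volume.restrict (Metric.closedBall 0 M)).map (localMap A θ₀ k)

instance (k : ℕ) : IsFiniteMeasure (localMeasure A θ₀ M k) := by
  have : IsFiniteMeasure (volume.restrict (Metric.closedBall (0 : EuclideanSpace ℝ (Fin d)) M)) :=
    ⟨by rw [Measure.restrict_apply_univ]; exact measure_closedBall_lt_top⟩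
  unfold localMeasure
  infer_instance

/-- Change of variables with Jacobian $k^{-d/2}|\det A|$. The first factor accounts for the rate,
and the second becomes $1/J$ for the standardizing map. -/
lemma restrict_window {k : ℕ} (hk : 0 < k) : volume.restrict (window A θ₀ M k) =
    (ENNReal.ofReal ((1 / Real.sqrt k) ^ d) * ENNReal.ofReal
      |(A : EuclideanSpace ℝ (Fin d) →L[ℝ] EuclideanSpace ℝ (Fin d)).det|) •
        localMeasure A θ₀ M k := by
  have hsk : 0 < Real.sqrt k := by positivity
  have hder : ∀ u ∈ Metric.closedBall (0 : EuclideanSpace ℝ (Fin d)) M,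
      HasFDerivWithinAt (localMap A θ₀ k)
        ((Real.sqrt k)⁻¹ • (A : EuclideanSpace ℝ (Fin d) →L[ℝ] EuclideanSpace ℝ (Fin d)))
        (Metric.closedBall 0 M) u := fun u _ =>
    ((A.hasFDerivAt.const_smul (Real.sqrt k)⁻¹).const_add θ₀).hasFDerivWithinAt
  have hinj : InjOn (localMap A θ₀ k) (Metric.closedBall 0 M) := fun u _ v _ h => by
    have h1 := add_left_cancel h
    exact A.injective (smul_right_injective _ (inv_ne_zero hsk.ne') h1)
  have hdet : |((Real.sqrt k)⁻¹ •
      (A : EuclideanSpace ℝ (Fin d) →L[ℝ] EuclideanSpace ℝ (Fin d))).det| =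
      (1 / Real.sqrt k) ^ d *
        |(A : EuclideanSpace ℝ (Fin d) →L[ℝ] EuclideanSpace ℝ (Fin d)).det| := by
    have : ((Real.sqrt k)⁻¹ •
      (A : EuclideanSpace ℝ (Fin d) →L[ℝ] EuclideanSpace ℝ (Fin d))).det =
      (Real.sqrt k)⁻¹ ^ d *
        (A : EuclideanSpace ℝ (Fin d) →L[ℝ] EuclideanSpace ℝ (Fin d)).det := by
      have := LinearMap.det_smul (Real.sqrt k)⁻¹
        ((A : EuclideanSpace ℝ (Fin d) →L[ℝ] EuclideanSpace ℝ (Fin d)) :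
          EuclideanSpace ℝ (Fin d) →ₗ[ℝ] EuclideanSpace ℝ (Fin d))
      rw [finrank_euclideanSpace_fin] at this
      exact this
    rw [this, abs_mul, abs_of_nonneg (by positivity), one_div]
  ext s hs
  have hcont := (continuous_localMap A θ₀ k).measurable
  have hind : Measurable fun u => s.indicator (1 : EuclideanSpace ℝ (Fin d) → ℝ≥0∞)
      (localMap A θ₀ k u) := (measurable_one.indicator hs).comp hcont
  rw [← lintegral_indicator_one hs, ← lintegral_indicator_one hs, window,
    lintegral_image_eq_lintegral_abs_det_fderiv_mul volume Metric.isClosed_closedBall.measurableSet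
      hder hinj, lintegral_smul_measure, localMeasure,
    lintegral_map (measurable_one.indicator hs) hcont, hdet,
    lintegral_const_mul _ hind, ENNReal.ofReal_mul (by positivity), smul_eq_mul]

lemma map_restrict_sampleLaw {P : Measure 𝒴} [IsProbabilityMeasure P] (k : ℕ) :
    (sampleLaw P).map (fun ω (i : Fin k) => ω i) = Measure.pi fun _ : Fin k => P := by
  have := Measure.map_infinitePi_infinitePi_of_inj (P := fun _ : ℕ => P) (f := ((↑) : Fin k → ℕ))
    Fin.val_injective
  rw [sampleLaw, this, Measure.infinitePi_eq_pi]

lemma lintegral_mul_prodDensity {X : Type*} [MeasurableSpace X] [SigmaFinite μ] {L : X → 𝒴 → ℝ≥0∞}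
    (hL : Measurable (Function.uncurry L)) (x : X) [SigmaFinite (μ.withDensity (L x))] {k : ℕ}
    {F : (Fin k → 𝒴) → ℝ≥0∞} (hF : Measurable F) :
    ∫⁻ y, F y * prodDensity L k x y ∂(Measure.pi fun _ : Fin k => μ) =
      ∫⁻ y, F y ∂(Measure.pi fun _ : Fin k => μ.withDensity (L x)) := by
  induction k with
  | zero =>
    simp only [prodDensity, Finset.univ_eq_empty, Finset.prod_empty, mul_one]
    rw [Measure.pi_of_empty (fun _ : Fin 0 => μ) default,
      Measure.pi_of_empty (fun _ : Fin 0 => μ.withDensity (L x)) default]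
  | succ k ih =>
    have hm : Measurable fun p : (Fin k → 𝒴) × 𝒴 => F (Fin.cons p.2 p.1) :=
      hF.comp (by
        refine measurable_pi_lambda _ fun i => ?_
        refine Fin.cases ?_ (fun j => ?_) i
        · simpa using measurable_snd
        · exact (measurable_pi_apply j).comp measurable_fst)
    rw [lintegral_pi_succ k hF, lintegral_pi_succ k (F := fun y => F y * prodDensity L (k + 1) x y)
        (hF.mul (measurable_prodDensity hL _ x)),
      ← ih hm.lintegral_prod_right']
    refine lintegral_congr fun y => ?_
    have hmy : Measurable fun a => F (Fin.cons a y) := hm.comp measurable_prodMk_left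
    rw [lintegral_withDensity_eq_lintegral_mul _ hL.of_uncurry_left hmy,
      ← lintegral_mul_const _ (hL.of_uncurry_left.mul hmy)]
    refine lintegral_congr fun a => ?_
    rw [prodDensity_cons]
    simp only [Pi.mul_apply]
    ring

/-- Where the density $q$ at `x` is nonzero, $m^\alpha q^{1-\alpha}=(m/q)^\alpha q$, and both sides
vanish where it is zero. The affinity becomes a moment of a likelihood ratio on one probability
space common to all `k`, where almost sure limits make sense. -/
lemma affinity_eq_lintegral_sampleLaw {X : Type*} [MeasurableSpace X] [SigmaFinite μ]
    {L : X → 𝒴 → ℝ≥0∞} (hL : Measurable (Function.uncurry L)) {x : X} {ρ : Measure X} [SFinite ρ]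
    [IsProbabilityMeasure (μ.withDensity (L x))] (hx : ∀ y, L x y ≠ ∞) {α : ℝ}
    (hα : α ∈ Ioo (0 : ℝ) 1) (k : ℕ) :
    affinity μ L α ρ k x = ∫⁻ ω : ℕ → 𝒴, (mixture L ρ k (fun i => ω i) /
      prodDensity L k x fun i => ω i) ^ α ∂(sampleLaw (μ.withDensity (L x))) := by
  have hm : Measurable fun y => (mixture L ρ k y / prodDensity L k x y) ^ α :=
    ((measurable_mixture hL k).div (measurable_prodDensity hL k x)).pow_const _
  have h1 := lintegral_map (μ := sampleLaw (μ.withDensity (L x))) hm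
    (show Measurable (fun (ω : ℕ → 𝒴) (i : Fin k) => ω i) by fun_prop)
  rw [map_restrict_sampleLaw, ← lintegral_mul_prodDensity hL x hm] at h1
  rw [← h1]
  refine lintegral_congr fun y => ?_
  rw [ENNReal.div_rpow_of_nonneg _ _ hα.1.le]
  have hne : prodDensity L k x y ≠ ∞ := ENNReal.prod_ne_top fun i _ => hx _
  rcases eq_or_ne (prodDensity L k x y) 0 with h0 | h0
  · rw [h0, ENNReal.zero_rpow_of_pos (by linarith [hα.2]), mul_zero, mul_zero]
  · rw [ENNReal.rpow_sub _ _ h0 hne, ENNReal.rpow_one, div_eq_mul_inv, div_eq_mul_inv]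
    ring

/-- The first-moment bound that controls truncation. Mixture mass on the zeros of the reference
density may be lost, hence only an inequality. -/
lemma lintegral_mixture_div_le {X : Type*} [MeasurableSpace X] [SigmaFinite μ]
    {L : X → 𝒴 → ℝ≥0∞} (hL : Measurable (Function.uncurry L)) {x : X} {ρ : Measure X} [SFinite ρ]
    [IsProbabilityMeasure (μ.withDensity (L x))] (hρ : ∀ᵐ x ∂ρ, ∫⁻ y, L x y ∂μ = 1) (k : ℕ) :
    ∫⁻ ω : ℕ → 𝒴, mixture L ρ k (fun i => ω i) / prodDensity L k x (fun i => ω i)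
      ∂(sampleLaw (μ.withDensity (L x))) ≤ ρ univ := by
  have hm : Measurable fun y => mixture L ρ k y / prodDensity L k x y :=
    (measurable_mixture hL k).div (measurable_prodDensity hL k x)
  have h1 := lintegral_map (μ := sampleLaw (μ.withDensity (L x))) hm
    (show Measurable (fun (ω : ℕ → 𝒴) (i : Fin k) => ω i) by fun_prop)
  rw [map_restrict_sampleLaw, ← lintegral_mul_prodDensity hL x hm] at h1
  rw [← h1]
  calc _ ≤ ∫⁻ y, mixture L ρ k y ∂(Measure.pi fun _ : Fin k => μ) :=
        lintegral_mono fun y => ENNReal.mul_le_of_le_div le_rfl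
    _ = ρ univ := by
        rw [lintegral_mixture hL, lintegral_congr_ae (g := fun _ => 1), lintegral_one]
        filter_upwards [hρ] with x hx
        rw [hx, one_pow]

/-- The local likelihood ratio of the Gaussian shift experiment, integrated over a ball. -/
def gaussRatio (M : ℝ) (z : EuclideanSpace ℝ (Fin d)) : ℝ :=
  ∫ u in Metric.closedBall (0 : EuclideanSpace ℝ (Fin d)) M, Real.exp (inner ℝ z u - ‖u‖ ^ 2 / 2)

lemma continuous_gaussRatio : Continuous (gaussRatio (d := d) M) := by
  refine continuous_parametric_integral_of_continuous ?_ (isCompact_closedBall _ _)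
  unfold Function.uncurry
  fun_prop

lemma gaussRatio_nonneg (z : EuclideanSpace ℝ (Fin d)) : 0 ≤ gaussRatio M z :=
  integral_nonneg fun _ => (Real.exp_pos _).le

/-- The limit of the normalized affinity, for local coordinates in the ball of radius `M`. -/
def gaussConst (d : ℕ) (α M : ℝ) : ℝ≥0∞ :=
  ∫⁻ z, ENNReal.ofReal (gaussRatio M z) ^ α
    ∂(ProbabilityTheory.stdGaussian (EuclideanSpace ℝ (Fin d)))

lemma ofReal_mul_gaussRatio {c : ℝ} (hc : 0 ≤ c) (z : EuclideanSpace ℝ (Fin d)) :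
    ENNReal.ofReal (c * gaussRatio M z) = ∫⁻ u in Metric.closedBall (0 : EuclideanSpace ℝ (Fin d)) M,
      ENNReal.ofReal (c * Real.exp (inner ℝ z u - ‖u‖ ^ 2 / 2)) := by
  rw [gaussRatio, ← integral_const_mul, ofReal_integral_eq_lintegral_ofReal]
  · refine ContinuousOn.integrableOn_compact (isCompact_closedBall _ _) (Continuous.continuousOn ?_) 
    fun_prop
  · exact Eventually.of_forall fun u => by positivity

namespace IsRegularModel

variable (hℓ : IsRegularModel μ ℓ U Θ)
include hℓ

lemma eventually_localMap_mem {θ₀ : EuclideanSpace ℝ (Fin d)} (hθ₀ : θ₀ ∈ Θ)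
    (A : EuclideanSpace ℝ (Fin d) ≃L[ℝ] EuclideanSpace ℝ (Fin d)) (M : ℝ) :
    ∀ᶠ k : ℕ in atTop, ∀ u ∈ Metric.closedBall (0 : EuclideanSpace ℝ (Fin d)) M,
      localMap A θ₀ k u ∈ U := by
  obtain ⟨r, hr, hU⟩ := Metric.isOpen_iff.1 hℓ.isOpen θ₀ (hℓ.subset hθ₀)
  set a := ‖(A : EuclideanSpace ℝ (Fin d) →L[ℝ] EuclideanSpace ℝ (Fin d))‖ with ha
  have hsq : Tendsto (fun k : ℕ => (Real.sqrt k)⁻¹ * (a * M)) atTop (𝓝 0) := by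
    have := (tendsto_inv_atTop_zero.comp (Real.tendsto_sqrt_atTop.comp
      (tendsto_natCast_atTop_atTop (R := ℝ)))).mul_const (a * M)
    simpa using this
  filter_upwards [hsq.eventually (gt_mem_nhds hr)] with k hk u hu
  refine hU ?_
  rw [mem_ball_iff_norm, localMap, add_sub_cancel_left, norm_smul, Real.norm_of_nonneg (by positivity)]
  refine lt_of_le_of_lt ?_ hk
  have h1 := (A : EuclideanSpace ℝ (Fin d) →L[ℝ] EuclideanSpace ℝ (Fin d)).le_opNorm u
  have h2 : ‖u‖ ≤ M := by simpa using hu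
  gcongr
  exact h1.trans (by gcongr)

/-- The normalized mixture over a window is equivalent to its Gaussian counterpart. -/
lemma ae_mixture_div_bounds {θ₀ : EuclideanSpace ℝ (Fin d)} (hθ₀ : θ₀ ∈ Θ)
    [IsProbabilityMeasure (law μ ℓ θ₀)]
    {A : EuclideanSpace ℝ (Fin d) ≃L[ℝ] EuclideanSpace ℝ (Fin d)}
    (hA : ∀ v, ∫ y, hess ℓ y θ₀ (A v) (A v) * ℓ θ₀ y ∂μ = - ‖v‖ ^ 2)
    {T : 𝒴 → EuclideanSpace ℝ (Fin d)}
    (hT : ∀ᵐ y ∂(law μ ℓ θ₀), ∀ u, inner ℝ (T y) u = score ℓ y θ₀ (A u)) (M : ℝ) :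
    ∀ᵐ ω ∂(sampleLaw (law μ ℓ θ₀)), ∀ η > 0, ∀ᶠ k : ℕ in atTop,
      ENNReal.ofReal (Real.exp (-η) * gaussRatio M (normalizedSum T k ω)) ≤
        mixture (edensity ℓ) (localMeasure A θ₀ M k) k (fun i => ω i) /
          prodDensity (edensity ℓ) k θ₀ (fun i => ω i) ∧
      mixture (edensity ℓ) (localMeasure A θ₀ M k) k (fun i => ω i) /
          prodDensity (edensity ℓ) k θ₀ (fun i => ω i) ≤
        ENNReal.ofReal (Real.exp η * gaussRatio M (normalizedSum T k ω)) := by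
  have hθU := hℓ.subset hθ₀
  filter_upwards [hℓ.ae_logLik_expansion hθ₀ hA hT M, ae_sampleLaw_forall (hℓ.ae_law_pos hθU)]
    with ω hexp hpos η hη
  filter_upwards [hexp η hη, hℓ.eventually_localMap_mem hθ₀ A M] with k hk hkU
  have hratio : ∀ u ∈ Metric.closedBall (0 : EuclideanSpace ℝ (Fin d)) M,
      prodDensity (edensity ℓ) k (localMap A θ₀ k u) (fun i => ω i) /
        prodDensity (edensity ℓ) k θ₀ (fun i => ω i) =
      ENNReal.ofReal (Real.exp (∑ i ∈ Finset.range k,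
        (logLik ℓ (ω i) (localMap A θ₀ k u) - logLik ℓ (ω i) θ₀))) := by
    intro u hu
    simp only [prodDensity, edensity]
    rw [← ENNReal.ofReal_prod_of_nonneg (f := fun i : Fin k => ℓ (localMap A θ₀ k u) (ω i))
        fun i _ => (hpos i _ (hkU u hu)).le,
      ← ENNReal.ofReal_prod_of_nonneg (f := fun i : Fin k => ℓ θ₀ (ω i))
        fun i _ => (hpos i _ hθU).le,
      ← ENNReal.ofReal_div_of_pos (Finset.prod_pos fun (i : Fin k) _ => hpos i _ hθU),
      ← Finset.prod_div_distrib, Real.exp_sum,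
      Fin.prod_univ_eq_prod_range (fun i => ℓ (localMap A θ₀ k u) (ω i) / ℓ θ₀ (ω i)) k]
    congr 1
    refine Finset.prod_congr rfl fun i _ => ?_
    rw [logLik, logLik, Real.exp_sub, Real.exp_log (hpos i _ (hkU u hu)),
      Real.exp_log (hpos i _ hθU)]
  have hW : mixture (edensity ℓ) (localMeasure A θ₀ M k) k (fun i => ω i) /
      prodDensity (edensity ℓ) k θ₀ (fun i => ω i) =
      ∫⁻ u in Metric.closedBall (0 : EuclideanSpace ℝ (Fin d)) M,
        ENNReal.ofReal (Real.exp (∑ i ∈ Finset.range k,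
          (logLik ℓ (ω i) (localMap A θ₀ k u) - logLik ℓ (ω i) θ₀))) := by
    have hm := measurable_prodDensity_left hℓ.measurable_edensity k (fun i => ω i)
    have hm' : Measurable fun u => prodDensity (edensity ℓ) k (localMap A θ₀ k u) fun i => ω i :=
      hm.comp (continuous_localMap A θ₀ k).measurable
    rw [mixture, localMeasure, lintegral_map hm (continuous_localMap A θ₀ k).measurable,
      div_eq_mul_inv, ← lintegral_mul_const _ hm']
    refine setLIntegral_congr_fun Metric.isClosed_closedBall.measurableSet fun u hu => ?_
    rw [← hratio u hu, div_eq_mul_inv]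
  rw [hW, ofReal_mul_gaussRatio M (Real.exp_pos _).le, ofReal_mul_gaussRatio M (Real.exp_pos _).le]
  constructor <;> refine setLIntegral_mono' Metric.isClosed_closedBall.measurableSet fun u hu => ?_
  all_goals
    have h := abs_le.1 (hk u (by simpa using hu))
    refine ENNReal.ofReal_le_ofReal ?_
    rw [← Real.exp_add]
    refine Real.exp_le_exp.2 ?_
    unfold localMap
    linarith [h.1, h.2]

/-- The limit of the affinity with the Lebesgue measure on a window. -/
lemma exists_tendsto_window [SigmaFinite μ] {α : ℝ} (hα : α ∈ Ioo (0 : ℝ) 1)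
    {θ₀ : EuclideanSpace ℝ (Fin d)} (hθ₀ : θ₀ ∈ Θ) :
    ∃ A : EuclideanSpace ℝ (Fin d) ≃L[ℝ] EuclideanSpace ℝ (Fin d), ∀ M : ℝ,
      Tendsto (fun k : ℕ => ENNReal.ofReal (rate d α k) *
        affinity μ (edensity ℓ) α (volume.restrict (window A θ₀ M k)) k θ₀) atTop
        (𝓝 (ENNReal.ofReal (jeffreys μ ℓ θ₀)⁻¹ ^ α * gaussConst d α M)) := by
  have hθU := hℓ.subset hθ₀
  have hL := hℓ.measurable_edensity
  obtain ⟨A, hdet, hsc, hhe⟩ := hℓ.exists_standardization hθ₀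
  have hprob := hℓ.isProbabilityMeasure_law hθU
  have hprob' : IsProbabilityMeasure (μ.withDensity (edensity ℓ θ₀)) := hprob
  obtain ⟨T, hTm, hT, hT0, hT1⟩ := hℓ.exists_standardized_score hθ₀ hsc
  refine ⟨A, fun M => ?_⟩
  have key := tendsto_lintegral_rpow (ℙ := sampleLaw (law μ ℓ θ₀)) hα (measurable_normalizedSum hTm)
    (tendsto_integral_normalizedSum hTm hT0 hT1) (continuous_gaussRatio M) (gaussRatio_nonneg M)
    (W := fun k ω => mixture (edensity ℓ) (localMeasure A θ₀ M k) k (fun i => ω i) /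
      prodDensity (edensity ℓ) k θ₀ (fun i => ω i))
    (fun k => ((measurable_mixture hL k).div (measurable_prodDensity hL k θ₀)).comp (by fun_prop))
    (V := volume (Metric.closedBall (0 : EuclideanSpace ℝ (Fin d)) M))
    measure_closedBall_lt_top.ne ?_ (hℓ.ae_mixture_div_bounds hθ₀ hhe hT M)
  · refine (ENNReal.Tendsto.const_mul (a := ENNReal.ofReal (jeffreys μ ℓ θ₀)⁻¹ ^ α) key
      (Or.inr (ENNReal.rpow_ne_top_of_nonneg hα.1.le ENNReal.ofReal_ne_top))).congr' ?_
    filter_upwards [eventually_gt_atTop 0] with k hk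
    -- The power $k^{-d\alpha/2}$ of the Jacobian cancels the rate, and $|\det A|^\alpha$ becomes
    -- $J^{-\alpha}$.
    rw [restrict_window A θ₀ M hk, affinity_smul hL hα.1.le, ← mul_assoc, rate_mul_rpow d hα.1 hk,
      one_pow, ENNReal.ofReal_one, one_mul, hdet,
      affinity_eq_lintegral_sampleLaw hL (fun y => ENNReal.ofReal_ne_top) hα]
    rfl
  · filter_upwards [hℓ.eventually_localMap_mem hθ₀ A M] with k hk
    refine (lintegral_mixture_div_le (x := θ₀) hL ?_ k).trans_eq ?_
    · have hc := (continuous_localMap A θ₀ k).measurable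
      have hLm : Measurable fun x => ∫⁻ y, edensity ℓ x y ∂μ := hL.lintegral_prod_right'
      rw [localMeasure, ae_map_iff hc.aemeasurable (measurableSet_eq_fun hLm measurable_const)]
      filter_upwards [ae_restrict_mem Metric.isClosed_closedBall.measurableSet] with u hu
      exact hℓ.lintegral_edensity (hk u hu)
    · rw [localMeasure, Measure.map_apply (continuous_localMap A θ₀ k).measurable MeasurableSet.univ,
        preimage_univ, Measure.restrict_apply_univ]

end IsRegularModel

end LocalLimit

/-! ### Pointwise and integrated asymptotics of the affinity. -/

section Pointwise

variable {𝒴 : Type*} [MeasurableSpace 𝒴] {μ : Measure 𝒴} {d : ℕ}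
  {ℓ : EuclideanSpace ℝ (Fin d) → 𝒴 → ℝ} {U Θ : Set (EuclideanSpace ℝ (Fin d))}

lemma gaussRatio_mono {M M' : ℝ} (h : M ≤ M') (z : EuclideanSpace ℝ (Fin d)) :
    gaussRatio M z ≤ gaussRatio M' z := by
  refine setIntegral_mono_set ?_ (Eventually.of_forall fun u => (Real.exp_pos _).le)
    (Metric.closedBall_subset_closedBall h).eventuallyLE
  exact ContinuousOn.integrableOn_compact (isCompact_closedBall _ _)
    (Continuous.continuousOn (by fun_prop))

lemma gaussRatio_pos {M : ℝ} (hM : 0 < M) (z : EuclideanSpace ℝ (Fin d)) : 0 < gaussRatio M z := by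
  have : NeZero (volume.restrict (Metric.closedBall (0 : EuclideanSpace ℝ (Fin d)) M)) :=
    ⟨fun h => (Metric.measure_closedBall_pos volume (0 : EuclideanSpace ℝ (Fin d)) hM).ne'
      (Measure.restrict_eq_zero.1 h)⟩
  refine integral_exp_pos ?_
  exact ContinuousOn.integrableOn_compact (isCompact_closedBall _ _)
    (Continuous.continuousOn (by fun_prop))

lemma gaussConst_mono {α : ℝ} (hα : 0 ≤ α) : Monotone (gaussConst d α) := fun _ _ h =>
  lintegral_mono fun z =>
    ENNReal.rpow_le_rpow (ENNReal.ofReal_le_ofReal (gaussRatio_mono h z)) hα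

/-- The constant in the asymptotics of the affinity. -/
def gaussSup (d : ℕ) (α : ℝ) : ℝ≥0∞ := ⨆ n : ℕ, gaussConst d α n

lemma tendsto_gaussConst {α : ℝ} (hα : 0 ≤ α) :
    Tendsto (fun n : ℕ => gaussConst d α n) atTop (𝓝 (gaussSup d α)) :=
  tendsto_atTop_iSup fun _ _ h => gaussConst_mono hα (Nat.cast_le.2 h)

/-- The Gaussian ratio over the unit ball is everywhere positive. A nonzero constant is needed to
read the sign of the limit on the functional. -/
lemma gaussSup_ne_zero (d : ℕ) (α : ℝ) : gaussSup d α ≠ 0 := by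
  have h1 : gaussConst d α (1 : ℕ) ≠ 0 := by
    intro h
    rw [gaussConst, lintegral_eq_zero_iff
      ((continuous_gaussRatio _).measurable.ennreal_ofReal.pow_const _)] at h
    obtain ⟨z, hz⟩ := h.exists
    have : 0 < ENNReal.ofReal (gaussRatio ((1 : ℕ) : ℝ) z) ^ α :=
      ENNReal.rpow_pos (ENNReal.ofReal_pos.2 (gaussRatio_pos (by simp) z)) ENNReal.ofReal_ne_top
    exact this.ne' hz
  intro h
  exact h1 (le_antisymm (h ▸ le_iSup (fun n : ℕ => gaussConst d α n) 1) bot_le)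

/-- `x` is a Lebesgue point of `F`, for the averages over balls with centre `x`. -/
def IsLebesguePoint (F : EuclideanSpace ℝ (Fin d) → ℝ) (x : EuclideanSpace ℝ (Fin d)) : Prop :=
  Tendsto (fun r => (∫⁻ y in Metric.closedBall x r, ‖F y - F x‖ₑ) / volume (Metric.closedBall x r))
    (𝓝[>] 0) (𝓝 0)

lemma ae_isLebesguePoint {F : EuclideanSpace ℝ (Fin d) → ℝ} (hF : LocallyIntegrable F) :
    ∀ᵐ x, IsLebesguePoint F x := by
  filter_upwards [(Besicovitch.vitaliFamily volume).ae_tendsto_lintegral_enorm_sub_div hF] with x hx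
  exact hx.comp (Besicovitch.tendsto_filterAt volume x)

/-- At a Lebesgue point the mass of $|F-F(x)|$ on a ball of radius $a/\sqrt k$ is $o(k^{-d/2})$, so
its $\alpha$-th power is negligible at the rate. -/
lemma tendsto_rate_mul_lintegral_rpow {α : ℝ} (hα : 0 < α) {F : EuclideanSpace ℝ (Fin d) → ℝ}
    {x : EuclideanSpace ℝ (Fin d)} (hx : IsLebesguePoint F x) {a : ℝ} (ha : 0 < a) :
    Tendsto (fun k : ℕ => ENNReal.ofReal (rate d α k) *
      (∫⁻ y in Metric.closedBall x (a / Real.sqrt k), ‖F y - F x‖ₑ) ^ α) atTop (𝓝 0) := by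
  set V : ℝ≥0∞ := volume (Metric.closedBall (0 : EuclideanSpace ℝ (Fin d)) 1) with hV
  have hVtop : V ≠ ∞ := measure_closedBall_lt_top.ne
  have hr : Tendsto (fun k : ℕ => a / Real.sqrt k) atTop (𝓝[>] 0) := by
    refine tendsto_nhdsWithin_iff.2 ⟨?_, ?_⟩
    · exact tendsto_const_nhds.div_atTop (Real.tendsto_sqrt_atTop.comp
        (tendsto_natCast_atTop_atTop (R := ℝ)))
    · filter_upwards [eventually_gt_atTop 0] with k hk
      have : 0 < Real.sqrt k := by positivity
      exact div_pos ha this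
  have hlim := hx.comp hr
  have h1 : Tendsto (fun k : ℕ => (ENNReal.ofReal (a ^ d) * (V *
      ((∫⁻ y in Metric.closedBall x (a / Real.sqrt k), ‖F y - F x‖ₑ) /
        volume (Metric.closedBall x (a / Real.sqrt k))))) ^ α) atTop (𝓝 0) := by
    have h2 := ENNReal.Tendsto.const_mul (a := ENNReal.ofReal (a ^ d))
      (ENNReal.Tendsto.const_mul (a := V) hlim (Or.inr hVtop)) (Or.inr ENNReal.ofReal_ne_top)
    have h3 := (ENNReal.continuous_rpow_const (y := α)).tendsto _ |>.comp h2
    rw [mul_zero, mul_zero, ENNReal.zero_rpow_of_pos hα] at h3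
    exact h3
  refine h1.congr' ?_
  filter_upwards [eventually_gt_atTop 0] with k hk
  have hsk : 0 < Real.sqrt k := by positivity
  have hr0 : 0 < a / Real.sqrt k := div_pos ha hsk
  rw [← rate_mul_rpow d hα hk, ← mul_assoc (ENNReal.ofReal _) V]
  congr 2
  have hvol : volume (Metric.closedBall x (a / Real.sqrt k)) =
      ENNReal.ofReal ((a / Real.sqrt k) ^ d) * V := by
    rw [Measure.addHaar_closedBall' _ _ hr0.le, finrank_euclideanSpace_fin]
  rw [← hvol]
  exact ENNReal.mul_div_cancel (Metric.measure_closedBall_pos volume x hr0).ne'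
    measure_closedBall_lt_top.ne

/-- Windows are ellipsoids; comparison with balls of radius of order $M/\sqrt k$, from outside here
and from inside in `le_norm_of_notMem_window`, links them to Lebesgue points and to the tail
estimate. -/
lemma window_subset {A : EuclideanSpace ℝ (Fin d) ≃L[ℝ] EuclideanSpace ℝ (Fin d)} :
    ∃ a > 0, ∀ (M : ℝ), 0 ≤ M → ∀ (θ₀ : EuclideanSpace ℝ (Fin d)) (k : ℕ),
      window A θ₀ M k ⊆ Metric.closedBall θ₀ (a * M / Real.sqrt k) := by
  refine ⟨‖(A : EuclideanSpace ℝ (Fin d) →L[ℝ] EuclideanSpace ℝ (Fin d))‖ + 1, by positivity,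
    fun M hM θ₀ k => ?_⟩
  rintro _ ⟨u, hu, rfl⟩
  rw [mem_closedBall_iff_norm, localMap, add_sub_cancel_left, norm_smul,
    Real.norm_of_nonneg (by positivity), inv_mul_eq_div]
  have h1 := (A : EuclideanSpace ℝ (Fin d) →L[ℝ] EuclideanSpace ℝ (Fin d)).le_opNorm u
  have h2 : ‖u‖ ≤ M := by simpa using hu
  gcongr
  exact h1.trans (by gcongr; linarith)

lemma le_norm_of_notMem_window {A : EuclideanSpace ℝ (Fin d) ≃L[ℝ] EuclideanSpace ℝ (Fin d)} :
    ∃ a > 0, ∀ (M : ℝ) (θ₀ : EuclideanSpace ℝ (Fin d)) (k : ℕ), 0 < k → ∀ x ∉ window A θ₀ M k,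
      a * M / Real.sqrt k ≤ ‖x - θ₀‖ := by
  set b := ‖(A.symm : EuclideanSpace ℝ (Fin d) →L[ℝ] EuclideanSpace ℝ (Fin d))‖ + 1 with hb
  have hb0 : 0 < b := by positivity
  refine ⟨b⁻¹, by positivity, fun M θ₀ k hk x hx => ?_⟩
  have hsk : 0 < Real.sqrt k := by positivity
  set u := Real.sqrt k • A.symm (x - θ₀) with hu
  have hxu : localMap A θ₀ k u = x := by
    rw [localMap, hu, map_smul, inv_smul_smul₀ hsk.ne']
    simp
  have hM : M ≤ ‖u‖ := by
    by_contra! h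
    exact hx ⟨u, by simpa using h.le, hxu⟩
  have h1 : ‖u‖ ≤ Real.sqrt k * (b * ‖x - θ₀‖) := by
    rw [hu, norm_smul, Real.norm_of_nonneg hsk.le]
    gcongr
    refine ((A.symm : EuclideanSpace ℝ (Fin d) →L[ℝ] EuclideanSpace ℝ (Fin d)).le_opNorm _).trans ?_
    gcongr
    linarith
  rw [div_le_iff₀ hsk, inv_mul_le_iff₀ hb0]
  linarith

lemma isCompact_window (A : EuclideanSpace ℝ (Fin d) ≃L[ℝ] EuclideanSpace ℝ (Fin d))
    (θ₀ : EuclideanSpace ℝ (Fin d)) (M : ℝ) (k : ℕ) : IsCompact (window A θ₀ M k) :=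
  (isCompact_closedBall _ _).image (continuous_localMap A θ₀ k)

/-- Together with `smul_le_withDensity_add`, a two-sided comparison of a density with a constant, up
to the error $|F-c|$. Subadditivity transfers it to affinities. -/
lemma withDensity_le_smul_add (F : EuclideanSpace ℝ (Fin d) → ℝ) (c : ℝ) :
    (volume.withDensity fun x => ENNReal.ofReal (F x)) ≤
      ENNReal.ofReal c • volume + volume.withDensity fun x => ‖F x - c‖ₑ := by
  rw [← withDensity_const, ← withDensity_add_left measurable_const]
  refine withDensity_mono (Eventually.of_forall fun x => ?_)
  simp only [Pi.add_apply]
  rw [← ofReal_norm]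
  refine (ENNReal.ofReal_le_ofReal ?_).trans ENNReal.ofReal_add_le
  linarith [Real.le_norm_self (F x - c)]

lemma smul_le_withDensity_add {F : EuclideanSpace ℝ (Fin d) → ℝ} (hF : Measurable F) (c : ℝ) :
    ENNReal.ofReal c • volume ≤ (volume.withDensity fun x => ENNReal.ofReal (F x)) +
      volume.withDensity fun x => ‖F x - c‖ₑ := by
  rw [← withDensity_const, ← withDensity_add_left hF.ennreal_ofReal]
  refine withDensity_mono (Eventually.of_forall fun x => ?_)
  simp only [Pi.add_apply]
  rw [← ofReal_norm]
  refine (ENNReal.ofReal_le_ofReal ?_).trans ENNReal.ofReal_add_le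
  linarith [neg_abs_le (F x - c), Real.norm_eq_abs (F x - c)]

namespace IsRegularModel

variable (hℓ : IsRegularModel μ ℓ U Θ)
include hℓ

lemma eventually_window_subset {θ₀ : EuclideanSpace ℝ (Fin d)} (hθ₀ : θ₀ ∈ Θ)
    (A : EuclideanSpace ℝ (Fin d) ≃L[ℝ] EuclideanSpace ℝ (Fin d)) (M : ℝ) :
    ∀ᶠ k : ℕ in atTop, window A θ₀ M k ⊆ U := by
  filter_upwards [hℓ.eventually_localMap_mem hθ₀ A M] with k hk
  rintro _ ⟨u, hu, rfl⟩
  exact hk u hu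

/-- The contribution of a window to the affinity, at a Lebesgue point of the density. -/
lemma exists_tendsto_withDensity_window [SigmaFinite μ] {α : ℝ} (hα : α ∈ Ioo (0 : ℝ) 1)
    {θ₀ : EuclideanSpace ℝ (Fin d)} (hθ₀ : θ₀ ∈ Θ) :
    ∃ A : EuclideanSpace ℝ (Fin d) ≃L[ℝ] EuclideanSpace ℝ (Fin d),
      ∀ F : EuclideanSpace ℝ (Fin d) → ℝ, Measurable F → IsLebesguePoint F θ₀ → ∀ M : ℝ, 0 < M →
      Tendsto (fun k : ℕ => ENNReal.ofReal (rate d α k) * affinity μ (edensity ℓ) α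
          ((volume.withDensity fun x => ENNReal.ofReal (F x)).restrict (window A θ₀ M k)) k θ₀) atTop
        (𝓝 (ENNReal.ofReal (F θ₀) ^ α *
          (ENNReal.ofReal (jeffreys μ ℓ θ₀)⁻¹ ^ α * gaussConst d α M))) := by
  obtain ⟨A, hA⟩ := hℓ.exists_tendsto_window hα hθ₀
  refine ⟨A, fun F hF hFp M hM => ?_⟩
  have hL := hℓ.measurable_edensity
  have hθU := hℓ.subset hθ₀
  obtain ⟨a, ha, hwin⟩ := window_subset (A := A)
  have hx := ENNReal.Tendsto.const_mul (a := ENNReal.ofReal (F θ₀) ^ α) (hA M)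
    (Or.inr (ENNReal.rpow_ne_top_of_nonneg hα.1.le ENNReal.ofReal_ne_top))
  have hs := tendsto_rate_mul_lintegral_rpow hα.1 hFp (mul_pos ha hM)
  have hlow := ENNReal.Tendsto.sub hx hs (Or.inr ENNReal.zero_ne_top)
  have hup := hx.add hs
  rw [tsub_zero] at hlow
  rw [add_zero] at hup
  set ρ : Measure (EuclideanSpace ℝ (Fin d)) := volume.withDensity fun x => ENNReal.ofReal (F x)
    with hρ
  set δ : Measure (EuclideanSpace ℝ (Fin d)) := volume.withDensity fun x => ‖F x - F θ₀‖ₑ with hδ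
  -- Replacing `F` by its value costs only the Hölder bound for the error measure, which is
  -- negligible at a Lebesgue point.
  have hδW : ∀ᶠ k : ℕ in atTop, affinity μ (edensity ℓ) α (δ.restrict (window A θ₀ M k)) k θ₀ ≤
      (∫⁻ y in Metric.closedBall θ₀ (a * M / Real.sqrt k), ‖F y - F θ₀‖ₑ) ^ α := by
    filter_upwards [hℓ.eventually_window_subset hθ₀ A M] with k hk
    have hWm := (isCompact_window A θ₀ M k).isClosed.measurableSet
    refine (affinity_le_measure_univ_rpow hL hα.1 hα.2 ?_ (hℓ.lintegral_edensity hθU)).trans ?_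
    · filter_upwards [ae_restrict_mem hWm] with x hx
      exact hℓ.lintegral_edensity (hk hx)
    · rw [Measure.restrict_apply_univ, hδ, withDensity_apply _ hWm]
      gcongr
      · exact hα.1.le
      · exact hwin M hM.le θ₀ k
  refine tendsto_of_tendsto_of_tendsto_of_le_of_le' hlow hup ?_ ?_
  · filter_upwards [hδW] with k hk
    have h1 := Measure.restrict_mono_measure (smul_le_withDensity_add hF (F θ₀)) (window A θ₀ M k)
    rw [Measure.restrict_smul, Measure.restrict_add] at h1
    rw [tsub_le_iff_right, mul_left_comm, ← mul_add]
    gcongr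
    rw [← affinity_smul hL hα.1.le]
    refine (affinity_mono hα.1.le h1).trans ((affinity_add_le hL hα.1.le hα.2.le).trans ?_)
    gcongr
  · filter_upwards [hδW] with k hk
    have h1 := Measure.restrict_mono_measure (withDensity_le_smul_add F (F θ₀)) (window A θ₀ M k)
    rw [Measure.restrict_add, Measure.restrict_smul] at h1
    rw [mul_left_comm, ← mul_add]
    gcongr
    rw [← affinity_smul hL hα.1.le]
    refine (affinity_mono hα.1.le h1).trans ((affinity_add_le hL hα.1.le hα.2.le).trans ?_)
    gcongr

/-- Pointwise asymptotics of the affinity with a mixture. -/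
lemma tendsto_rate_mul_affinity [SigmaFinite μ] (hΘ : IsCompact Θ) {α : ℝ}
    (hα : α ∈ Ioo (0 : ℝ) 1) {θ₀ : EuclideanSpace ℝ (Fin d)} (hθ₀ : θ₀ ∈ Θ)
    {F : EuclideanSpace ℝ (Fin d) → ℝ} (hF : Measurable F) {B : ℝ} (hFB : ∀ x, F x ≤ B)
    (hF0 : ∀ x ∉ Θ, F x = 0) (hFp : IsLebesguePoint F θ₀) :
    Tendsto (fun k : ℕ => ENNReal.ofReal (rate d α k) * affinity μ (edensity ℓ) α
        (volume.withDensity fun x => ENNReal.ofReal (F x)) k θ₀) atTop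
      (𝓝 (ENNReal.ofReal (F θ₀) ^ α *
        (ENNReal.ofReal (jeffreys μ ℓ θ₀)⁻¹ ^ α * gaussSup d α))) := by
  have hL := hℓ.measurable_edensity
  obtain ⟨A, hA⟩ := hℓ.exists_tendsto_withDensity_window hα hθ₀
  obtain ⟨C, hC⟩ := hℓ.exists_tail_le hΘ hα
  obtain ⟨a, ha, hwin⟩ := le_norm_of_notMem_window (A := A)
  have hne : ∀ x : ℝ, ENNReal.ofReal x ^ α ≠ ∞ := fun x =>
    ENNReal.rpow_ne_top_of_nonneg hα.1.le ENNReal.ofReal_ne_top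
  set ρ : Measure (EuclideanSpace ℝ (Fin d)) := volume.withDensity fun x => ENNReal.ofReal (F x)
    with hρ
  have hcast : Tendsto (fun n : ℕ => ((n + 1 : ℕ) : ℝ)) atTop atTop :=
    (tendsto_natCast_atTop_atTop (R := ℝ)).comp (tendsto_add_atTop_nat 1)
  refine tendsto_of_approximation
    (b := fun n k => ENNReal.ofReal (rate d α k) *
      affinity μ (edensity ℓ) α (ρ.restrict (window A θ₀ ((n + 1 : ℕ) : ℝ) k)) k θ₀)
    (c := fun n => ENNReal.ofReal (F θ₀) ^ α *
      (ENNReal.ofReal (jeffreys μ ℓ θ₀)⁻¹ ^ α * gaussConst d α ((n + 1 : ℕ) : ℝ)))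
    (e := fun n => ENNReal.ofReal B ^ α * ENNReal.ofReal (C / (a * ((n + 1 : ℕ) : ℝ))))
    (fun n => hA F hF hFp _ (by positivity)) (Eventually.of_forall fun n => ?_) ?_ ?_
  · filter_upwards [eventually_gt_atTop 0] with k hk
    refine ⟨by gcongr; exact affinity_mono hα.1.le Measure.restrict_le_self, ?_⟩
    set W := window A θ₀ ((n + 1 : ℕ) : ℝ) k with hW
    have hWm : MeasurableSet W := (isCompact_window A θ₀ _ k).isClosed.measurableSet
    set t := Θ ∩ {x | a * ((n + 1 : ℕ) : ℝ) / Real.sqrt k ≤ ‖x - θ₀‖} with ht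
    have htm : MeasurableSet t := hΘ.isClosed.measurableSet.inter
      (isClosed_le continuous_const (by fun_prop)).measurableSet
    -- Outside the window, the density is bounded by `B` on `Θ`, and the points are at distance at
    -- least $aM/\sqrt k$ from `θ₀`, so the tail estimate applies.
    have hle : ρ ≤ ρ.restrict W + ENNReal.ofReal B • volume.restrict t := by
      conv_lhs => rw [← Measure.restrict_add_restrict_compl (μ := ρ) hWm]
      gcongr
      rw [hρ, restrict_withDensity hWm.compl, ← withDensity_indicator hWm.compl,
        ← withDensity_const, ← withDensity_indicator htm]
      refine withDensity_mono (Eventually.of_forall fun x => ?_)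
      by_cases hxW : x ∈ W
      · simp [hxW]
      by_cases hx : x ∈ Θ
      · have hxt : x ∈ t := ⟨hx, hwin _ θ₀ k hk x hxW⟩
        simpa [hxW, hxt] using ENNReal.ofReal_le_ofReal (hFB x)
      · simp [hxW, hF0 x hx]
    calc _ ≤ ENNReal.ofReal (rate d α k) * (affinity μ (edensity ℓ) α (ρ.restrict W) k θ₀ +
          affinity μ (edensity ℓ) α (ENNReal.ofReal B • volume.restrict t) k θ₀) := by
          gcongr
          exact (affinity_mono hα.1.le hle).trans (affinity_add_le hL hα.1.le hα.2.le)
      _ ≤ _ := by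
          rw [mul_add, affinity_smul hL hα.1.le, mul_left_comm (ENNReal.ofReal (rate d α k)) (_ ^ α)]
          gcongr
          exact hC θ₀ hθ₀ k hk _ (by positivity)
  · refine ENNReal.Tendsto.const_mul (ENNReal.Tendsto.const_mul ?_ (Or.inr (hne _))) (Or.inr (hne _))
    exact (tendsto_gaussConst hα.1.le).comp (tendsto_add_atTop_nat 1)
  · have h1 : Tendsto (fun n : ℕ => C / (a * ((n + 1 : ℕ) : ℝ))) atTop (𝓝 0) :=
      tendsto_const_nhds.div_atTop (hcast.const_mul_atTop ha)
    have h2 := ENNReal.Tendsto.const_mul (a := ENNReal.ofReal B ^ α)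
      (ENNReal.tendsto_ofReal h1) (Or.inr (hne _))
    simpa using h2

/-- No Gaussian computation is needed: the pointwise limit for the density $1$ on `Θ`, at a Lebesgue
point, is bounded by the uniform estimate. Positive volume provides such a point. -/
lemma gaussSup_ne_top [SigmaFinite μ] (hΘ : IsCompact Θ) {α : ℝ} (hα : α ∈ Ioo (0 : ℝ) 1)
    (hvol : volume Θ ≠ 0) : gaussSup d α ≠ ∞ := by
  have hΘm := hΘ.isClosed.measurableSet
  set F : EuclideanSpace ℝ (Fin d) → ℝ := Θ.indicator 1 with hF
  have hFm : Measurable F := measurable_one.indicator hΘm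
  have hFle : ∀ x, F x ≤ 1 := fun x => indicator_le_self' (by simp) x
  have hFi : Integrable F := (integrable_indicator_iff hΘm).2
    (integrableOn_const hΘ.measure_lt_top.ne)
  have hne : (ae (volume.restrict Θ)).NeBot := by
    rw [ae_neBot]
    exact fun h => hvol (Measure.restrict_eq_zero.1 h)
  obtain ⟨θ₀, hp, hθ₀⟩ := ((ae_restrict_of_ae (ae_isLebesguePoint hFi.locallyIntegrable)).and
    (ae_restrict_mem hΘm)).exists
  have hlim := hℓ.tendsto_rate_mul_affinity hΘ hα hθ₀ hFm hFle
    (fun x hx => indicator_of_notMem hx _) hp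
  obtain ⟨C, hC, hle⟩ := hℓ.exists_rate_mul_affinity_le hΘ hα
  have hρ : (volume.withDensity fun x => ENNReal.ofReal (F x)) = volume.restrict Θ := by
    rw [← withDensity_indicator_one hΘm]
    congr 1
    ext x
    by_cases hx : x ∈ Θ <;> simp [hF, hx]
  rw [hρ] at hlim
  have h1 := le_of_tendsto hlim ((eventually_gt_atTop 0).mono fun k hk => hle θ₀ hθ₀ k hk)
  have hF1 : F θ₀ = 1 := by simp [hF, hθ₀]
  rw [hF1, ENNReal.ofReal_one, ENNReal.one_rpow, one_mul] at h1
  intro htop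
  rw [htop, ENNReal.mul_top] at h1
  · exact hC (top_le_iff.1 h1)
  · exact (ENNReal.rpow_pos (ENNReal.ofReal_pos.2 (inv_pos.2 (hℓ.jeffreys_pos hθ₀)))
      ENNReal.ofReal_ne_top).ne'

/-- Asymptotics of the average of the affinity over the mixing distribution. -/
lemma tendsto_rate_mul_lintegral_affinity [SigmaFinite μ] (hΘ : IsCompact Θ) {α : ℝ}
    (hα : α ∈ Ioo (0 : ℝ) 1) {F : EuclideanSpace ℝ (Fin d) → ℝ} (hF : Measurable F) {B : ℝ}
    (hFnn : ∀ x, 0 ≤ F x) (hFB : ∀ x, F x ≤ B) (hF0 : ∀ x ∉ Θ, F x = 0) :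
    Tendsto (fun k : ℕ => ENNReal.ofReal (rate d α k) * ∫⁻ θ, affinity μ (edensity ℓ) α
        (volume.withDensity fun x => ENNReal.ofReal (F x)) k θ
        ∂(volume.withDensity fun x => ENNReal.ofReal (F x))) atTop
      (𝓝 (∫⁻ θ, ENNReal.ofReal (F θ) ^ α *
        (ENNReal.ofReal (jeffreys μ ℓ θ)⁻¹ ^ α * gaussSup d α)
        ∂(volume.withDensity fun x => ENNReal.ofReal (F x)))) := by
  have hL := hℓ.measurable_edensity
  have hΘm := hΘ.isClosed.measurableSet
  set ρ : Measure (EuclideanSpace ℝ (Fin d)) := volume.withDensity fun x => ENNReal.ofReal (F x)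
    with hρ
  have hρle : ρ ≤ ENNReal.ofReal B • volume.restrict Θ := by
    rw [← withDensity_const, ← withDensity_indicator hΘm, hρ]
    refine withDensity_mono (Eventually.of_forall fun x => ?_)
    by_cases hx : x ∈ Θ
    · simpa [hx] using ENNReal.ofReal_le_ofReal (hFB x)
    · simp [hx, hF0 x hx]
  have hfin : IsFiniteMeasure (ENNReal.ofReal B • volume.restrict Θ) := by
    refine ⟨?_⟩
    rw [Measure.smul_apply, Measure.restrict_apply_univ, smul_eq_mul]
    exact ENNReal.mul_lt_top ENNReal.ofReal_lt_top hΘ.measure_lt_top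
  have hρΘ : ∀ᵐ x ∂ρ, x ∈ Θ := by
    have h1 : ρ Θᶜ ≤ 0 := (hρle _).trans_eq (by
      rw [Measure.smul_apply, Measure.restrict_apply hΘm.compl]; simp)
    exact mem_ae_iff.2 (le_antisymm h1 bot_le)
  have hFi : Integrable F := by
    refine ((integrable_indicator_iff hΘm).2
      (integrableOn_const (C := B) hΘ.measure_lt_top.ne)).mono' hF.aestronglyMeasurable
      (Eventually.of_forall fun x => ?_)
    rw [Real.norm_of_nonneg (hFnn x)]
    by_cases hx : x ∈ Θ
    · simpa [hx] using hFB x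
    · simp [hx, hF0 x hx]
  obtain ⟨C, hC, hle⟩ := hℓ.exists_rate_mul_affinity_le hΘ hα
  have hm : ∀ k, Measurable (affinity μ (edensity ℓ) α ρ k) := fun k => measurable_affinity hL k
  simp_rw [← lintegral_const_mul _ (hm _)]
  -- The dominating constant compares the density with `B` on `Θ` and uses homogeneity of degree
  -- $\alpha$.
  refine tendsto_lintegral_filter_of_dominated_convergence (fun _ => ENNReal.ofReal B ^ α * C)
    (Eventually.of_forall fun k => (hm k).const_mul _) ?_ ?_ ?_
  · filter_upwards [eventually_gt_atTop 0] with k hk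
    filter_upwards [hρΘ] with θ hθ
    calc _ ≤ ENNReal.ofReal (rate d α k) *
          affinity μ (edensity ℓ) α (ENNReal.ofReal B • volume.restrict Θ) k θ := by
          gcongr
          exact affinity_mono hα.1.le hρle
      _ ≤ _ := by
          rw [affinity_smul hL hα.1.le, mul_left_comm]
          gcongr
          exact hle θ hθ k hk
  · rw [lintegral_const]
    refine ENNReal.mul_ne_top (ENNReal.mul_ne_top
      (ENNReal.rpow_ne_top_of_nonneg hα.1.le ENNReal.ofReal_ne_top) hC) ?_
    exact ((hρle _).trans_lt (measure_lt_top _ _)).ne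
  · filter_upwards [hρΘ, (withDensity_absolutelyContinuous volume _).ae_le
      (ae_isLebesguePoint hFi.locallyIntegrable)] with θ hθ hp
    exact hℓ.tendsto_rate_mul_affinity hΘ hα hθ hF hFB hF0 hp

end IsRegularModel

end Pointwise

/-! ### Stability of the regularity class. -/

section RegularityClass

variable {d : ℕ} {Θ : Set (EuclideanSpace ℝ (Fin d))} {f h : EuclideanSpace ℝ (Fin d) → ℝ}

namespace IsLocBddAECont

lemma measurable_indicator (hf : IsLocBddAECont Θ f) (hΘ : MeasurableSet Θ) :
    Measurable (Θ.indicator f) := by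
  refine measurable_of_restrict_of_restrict_compl hΘ ?_ ?_
  · convert hf.measurable using 1
    ext θ
    simp
  · convert measurable_const (a := (0 : ℝ)) using 1
    ext θ
    exact indicator_of_notMem θ.2 f

lemma aestronglyMeasurable (hf : IsLocBddAECont Θ f) (hΘ : MeasurableSet Θ) :
    AEStronglyMeasurable f (volume.restrict Θ) :=
  (aemeasurable_restrict_of_measurable_subtype hΘ hf.measurable).aestronglyMeasurable

lemma exists_bound (hf : IsLocBddAECont Θ f) (hΘ : IsCompact Θ) :
    ∃ B : ℝ, 0 ≤ B ∧ ∀ θ ∈ Θ, |f θ| ≤ B := by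
  obtain ⟨B, hB⟩ : ∃ B : ℝ, ∀ θ ∈ Θ, |f θ| ≤ B := by
    refine hΘ.induction_on (p := fun s => ∃ B : ℝ, ∀ θ ∈ s, |f θ| ≤ B) ⟨0, by simp⟩
      (fun s t hst ⟨B, hB⟩ => ⟨B, fun θ hθ => hB θ (hst hθ)⟩)
      (fun s t ⟨B, hB⟩ ⟨C, hC⟩ => ⟨max B C, fun θ hθ => hθ.elim
        (fun h => (hB θ h).trans (le_max_left _ _)) fun h => (hC θ h).trans (le_max_right _ _)⟩)
      fun θ hθ => ?_
    obtain ⟨M, hM⟩ := hf.locallyBounded θ hθ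
    exact ⟨_, hM, M, fun θ' hθ' => hθ'⟩
  exact ⟨max B 0, le_max_right _ _, fun θ hθ => (hB θ hθ).trans (le_max_left _ _)⟩

lemma integrableOn (hf : IsLocBddAECont Θ f) (hΘ : IsCompact Θ) : IntegrableOn f Θ := by
  obtain ⟨B, _, hB⟩ := hf.exists_bound hΘ
  have hΘm := hΘ.isClosed.measurableSet
  refine (integrableOn_const (C := B) hΘ.measure_lt_top.ne).mono' (hf.aestronglyMeasurable hΘm) ?_
  filter_upwards [ae_restrict_mem hΘm] with θ hθ
  exact hB θ hθ

lemma of_continuousOn (hf : ContinuousOn f Θ) (hΘ : MeasurableSet Θ) : IsLocBddAECont Θ f where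
  measurable := (continuousOn_iff_continuous_domRestrict.1 hf).measurable
  locallyBounded θ hθ := by
    refine ⟨|f θ| + 1, ?_⟩
    have := (hf θ hθ).abs.eventually (gt_mem_nhds (lt_add_one |f θ|))
    exact this.mono fun _ h => h.le
  aeContinuous := (ae_restrict_mem hΘ).mono fun θ hθ => hf θ hθ

lemma const (c : ℝ) : IsLocBddAECont Θ fun _ => c where
  measurable := measurable_const
  locallyBounded _ _ := ⟨|c|, Eventually.of_forall fun _ => le_rfl⟩
  aeContinuous := Eventually.of_forall fun _ => continuousWithinAt_const

lemma add (hf : IsLocBddAECont Θ f) (hh : IsLocBddAECont Θ h) :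
    IsLocBddAECont Θ fun θ => f θ + h θ where
  measurable := hf.measurable.add hh.measurable
  locallyBounded θ hθ := by
    obtain ⟨M, hM⟩ := hf.locallyBounded θ hθ
    obtain ⟨N, hN⟩ := hh.locallyBounded θ hθ
    refine ⟨M + N, ?_⟩
    filter_upwards [hM, hN] with x h1 h2
    exact (abs_add_le _ _).trans (add_le_add h1 h2)
  aeContinuous := by
    filter_upwards [hf.aeContinuous, hh.aeContinuous] with θ h1 h2
    exact h1.add h2

lemma mul (hf : IsLocBddAECont Θ f) (hh : IsLocBddAECont Θ h) :
    IsLocBddAECont Θ fun θ => f θ * h θ where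
  measurable := hf.measurable.mul hh.measurable
  locallyBounded θ hθ := by
    obtain ⟨M, hM⟩ := hf.locallyBounded θ hθ
    obtain ⟨N, hN⟩ := hh.locallyBounded θ hθ
    refine ⟨M * N, ?_⟩
    filter_upwards [hM, hN] with x h1 h2
    rw [abs_mul]
    exact mul_le_mul h1 h2 (abs_nonneg _) ((abs_nonneg _).trans h1)
  aeContinuous := by
    filter_upwards [hf.aeContinuous, hh.aeContinuous] with θ h1 h2
    exact h1.mul h2

lemma sum {ι : Type*} (s : Finset ι) {g : ι → EuclideanSpace ℝ (Fin d) → ℝ}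
    (hg : ∀ i, IsLocBddAECont Θ (g i)) : IsLocBddAECont Θ fun θ => ∑ i ∈ s, g i θ := by
  classical
  induction s using Finset.induction_on with
  | empty => simpa using const 0
  | insert i s hi ih =>
    simp_rw [Finset.sum_insert hi]
    exact (hg i).add ih

lemma comp_continuous (hf : IsLocBddAECont Θ f) {φ : ℝ → ℝ} (hφ : Continuous φ) :
    IsLocBddAECont Θ fun θ => φ (f θ) where
  measurable := hφ.measurable.comp hf.measurable
  locallyBounded θ hθ := by
    obtain ⟨M, hM⟩ := hf.locallyBounded θ hθ
    obtain ⟨N, hN⟩ := (isCompact_Icc (a := -M) (b := M)).exists_bound_of_continuousOn hφ.continuousOn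
    exact ⟨N, hM.mono fun x hx => hN _ (abs_le.1 hx)⟩
  aeContinuous := by
    filter_upwards [hf.aeContinuous] with θ h
    exact hφ.continuousAt.comp_continuousWithinAt h

/-- Keeps the weight $(f/J)^\alpha$ in the regularity class. Zeros of `f` are harmless because
$x\mapsto x^\alpha$ is continuous for $\alpha\ge0$. -/
lemma rpow_div (hf : IsLocBddAECont Θ f) (hh : ContinuousOn h Θ) (hh0 : ∀ θ ∈ Θ, 0 < h θ)
    (hΘ : MeasurableSet Θ) {α : ℝ} (hα : 0 ≤ α) : IsLocBddAECont Θ fun θ => (f θ / h θ) ^ α := by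
  simp_rw [div_eq_mul_inv]
  exact (hf.mul (of_continuousOn (hh.inv₀ fun θ hθ => (hh0 θ hθ).ne') hΘ)).comp_continuous
    (Real.continuous_rpow_const hα)

end IsLocBddAECont

end RegularityClass

/-! ### Mutual information expressed by affinities. -/

section MutualInformation

variable {𝒴 : Type*} [MeasurableSpace 𝒴] {μ : Measure 𝒴} {d : ℕ}
  {ℓ : EuclideanSpace ℝ (Fin d) → 𝒴 → ℝ} {U Θ : Set (EuclideanSpace ℝ (Fin d))}

namespace IsRegularModel

variable (hℓ : IsRegularModel μ ℓ U Θ)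
include hℓ

lemma likelihood_eq_toReal {θ : EuclideanSpace ℝ (Fin d)} (hθ : θ ∈ U) (k : ℕ) (y : Fin k → 𝒴) :
    likelihood ℓ k θ y = (prodDensity (edensity ℓ) k θ y).toReal := by
  rw [likelihood, prodDensity, ENNReal.toReal_prod]
  exact Finset.prod_congr rfl fun i _ => (ENNReal.toReal_ofReal (hℓ.nonneg θ hθ _)).symm

lemma marginal_eq_toReal {ν : Measure (EuclideanSpace ℝ (Fin d))} (hν : ∀ᵐ θ ∂ν, θ ∈ U) (k : ℕ)
    (y : Fin k → 𝒴) : marginal ℓ ν k y = (mixture (edensity ℓ) ν k y).toReal := by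
  rw [marginal, mixture, ← integral_toReal
    (measurable_prodDensity_left hℓ.measurable_edensity k y).aemeasurable
    (Eventually.of_forall fun θ => (ENNReal.prod_ne_top fun i _ => ENNReal.ofReal_ne_top).lt_top)]
  exact integral_congr_ae (hν.mono fun θ hθ => hℓ.likelihood_eq_toReal hθ k y)

lemma ae_pi_commonSupport [SigmaFinite μ] (k : ℕ) : ∀ᵐ y ∂(Measure.pi fun _ : Fin k => μ), ∀ i,
    (∀ θ ∈ U, 0 < ℓ θ (y i)) ∨ ∀ θ ∈ U, ℓ θ (y i) = 0 :=
  ae_all_iff.2 fun i =>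
    (Measure.tendsto_eval_ae_ae (μ := fun _ : Fin k => μ) (i := i)).eventually hℓ.commonSupport

/-- Mixture and likelihood both integrate to one, so the affine part of $f_\alpha$ contributes
$-\alpha-(1-\alpha)=-1$, and the power part contributes the affinity. -/
lemma alphaDivergence_eq [SigmaFinite μ] {α : ℝ} (hα : α ∈ Ioo (0 : ℝ) 1)
    {ν : Measure (EuclideanSpace ℝ (Fin d))} [IsProbabilityMeasure ν] (hν : ∀ᵐ θ ∂ν, θ ∈ U) (k : ℕ)
    {θ : EuclideanSpace ℝ (Fin d)} (hθ : θ ∈ U) :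
    alphaDivergence μ ℓ α ν k θ =
      (1 - (affinity μ (edensity ℓ) α ν k θ).toReal) / (α * (1 - α)) := by
  have hL := hℓ.measurable_edensity
  have hα0 := hα.1
  have hα1 : 0 < 1 - α := by linarith [hα.2]
  set m := mixture (edensity ℓ) ν k with hm
  set q := prodDensity (edensity ℓ) k θ with hq
  have hmm : Measurable m := measurable_mixture hL k
  have hqm : Measurable q := measurable_prodDensity hL k θ
  have hm1 : ∫⁻ y, m y ∂(Measure.pi fun _ : Fin k => μ) = 1 := by
    rw [hm, lintegral_mixture hL, lintegral_congr_ae (g := fun _ => 1), lintegral_one, measure_univ]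
    filter_upwards [hν] with x hx
    rw [hℓ.lintegral_edensity hx, one_pow]
  have hq1 : ∫⁻ y, q y ∂(Measure.pi fun _ : Fin k => μ) = 1 := by
    rw [hq, lintegral_prodDensity hL, hℓ.lintegral_edensity hθ, one_pow]
  have hqtop : ∀ y, q y ≠ ∞ := fun y => ENNReal.prod_ne_top fun i _ => ENNReal.ofReal_ne_top
  have hmtop : ∀ᵐ y ∂(Measure.pi fun _ : Fin k => μ), m y < ∞ :=
    ae_lt_top hmm (by rw [hm1]; exact ENNReal.one_ne_top)
  have hafftop : affinity μ (edensity ℓ) α ν k θ ≠ ∞ := by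
    refine ne_top_of_le_ne_top ?_ (affinity_le_measure_univ_rpow hL hα.1 hα.2
      (hν.mono fun x hx => hℓ.lintegral_edensity hx) (hℓ.lintegral_edensity hθ))
    simp
  have ham : Measurable fun y => m y ^ α * q y ^ (1 - α) := measurable_affinity_integrand hL k θ
  have ham_top : ∀ᵐ y ∂(Measure.pi fun _ : Fin k => μ), m y ^ α * q y ^ (1 - α) < ∞ :=
    ae_lt_top ham hafftop
  have hI1 : ∫ y, (m y).toReal ∂(Measure.pi fun _ : Fin k => μ) = 1 := by
    rw [integral_toReal hmm.aemeasurable hmtop, hm1, ENNReal.toReal_one]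
  have hI2 : ∫ y, (q y).toReal ∂(Measure.pi fun _ : Fin k => μ) = 1 := by
    rw [integral_toReal hqm.aemeasurable (Eventually.of_forall fun y => (hqtop y).lt_top), hq1,
      ENNReal.toReal_one]
  have hI3 : ∫ y, (m y ^ α * q y ^ (1 - α)).toReal ∂(Measure.pi fun _ : Fin k => μ) =
      (affinity μ (edensity ℓ) α ν k θ).toReal := integral_toReal ham.aemeasurable ham_top
  have hi1 : Integrable (fun y => (m y).toReal) (Measure.pi fun _ : Fin k => μ) :=
    integrable_toReal_of_lintegral_ne_top hmm.aemeasurable (by rw [hm1]; exact ENNReal.one_ne_top)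
  have hi2 : Integrable (fun y => (q y).toReal) (Measure.pi fun _ : Fin k => μ) :=
    integrable_toReal_of_lintegral_ne_top hqm.aemeasurable (by rw [hq1]; exact ENNReal.one_ne_top)
  have hi3 : Integrable (fun y => (m y ^ α * q y ^ (1 - α)).toReal)
      (Measure.pi fun _ : Fin k => μ) :=
    integrable_toReal_of_lintegral_ne_top ham.aemeasurable hafftop
  have hkey : alphaDivergence μ ℓ α ν k θ = ∫ y, ((m y ^ α * q y ^ (1 - α)).toReal -
      α * (m y).toReal - (1 - α) * (q y).toReal) / (α * (α - 1))
        ∂(Measure.pi fun _ : Fin k => μ) := by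
    refine integral_congr_ae ?_
    filter_upwards [hℓ.ae_pi_commonSupport k] with y hy
    rw [hℓ.likelihood_eq_toReal hθ, hℓ.marginal_eq_toReal hν, ← hq, ← hm, fAlpha, div_mul_eq_mul_div]
    congr 1
    -- At a zero of the likelihood the left integrand is $0$, while the right one contains $-\alpha
    -- m$; the common support forces $m=0$ there.
    rcases eq_or_ne (q y) 0 with h0 | h0
    · have hmy : m y = 0 := by
        obtain ⟨i, _, hi⟩ := Finset.prod_eq_zero_iff.1 h0
        have h1 : ∀ θ' ∈ U, ℓ θ' (y i) = 0 := (hy i).resolve_left fun h =>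
          (ENNReal.ofReal_pos.2 (h θ hθ)).ne' hi
        rw [hm, mixture, lintegral_eq_zero_iff (measurable_prodDensity_left hL k y)]
        filter_upwards [hν] with θ' hθ'
        exact Finset.prod_eq_zero (Finset.mem_univ i) (by simp [edensity, h1 θ' hθ'])
      rw [h0, hmy, ENNReal.zero_rpow_of_pos hα0]
      simp
    · have hq0 : 0 < (q y).toReal := ENNReal.toReal_pos h0 (hqtop y)
      rw [ENNReal.toReal_mul, ← ENNReal.toReal_rpow, ← ENNReal.toReal_rpow,
        Real.div_rpow ENNReal.toReal_nonneg hq0.le, Real.rpow_sub hq0, Real.rpow_one]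
      have := (Real.rpow_pos_of_pos hq0 α).ne'
      field_simp
  have hi4 : Integrable (fun y => (m y ^ α * q y ^ (1 - α)).toReal - α * (m y).toReal)
      (Measure.pi fun _ : Fin k => μ) := hi3.sub (hi1.const_mul _)
  rw [hkey, integral_div, integral_sub hi4 (hi2.const_mul _),
    integral_sub hi3 (hi1.const_mul _), integral_const_mul, integral_const_mul, hI1, hI2, hI3]
  rw [div_eq_div_iff (mul_neg_of_pos_of_neg hα0 (by linarith)).ne (mul_pos hα0 hα1).ne']
  ring

lemma mutualInformation_eq [SigmaFinite μ] {α : ℝ} (hα : α ∈ Ioo (0 : ℝ) 1)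
    {ν : Measure (EuclideanSpace ℝ (Fin d))} [IsProbabilityMeasure ν] (hν : ∀ᵐ θ ∂ν, θ ∈ U)
    (k : ℕ) :
    mutualInformation μ ℓ α ν k =
      (1 - (∫⁻ θ, affinity μ (edensity ℓ) α ν k θ ∂ν).toReal) / (α * (1 - α)) := by
  have hL := hℓ.measurable_edensity
  have ham : Measurable (affinity μ (edensity ℓ) α ν k) := measurable_affinity hL k
  have hle : ∀ᵐ θ ∂ν, affinity μ (edensity ℓ) α ν k θ ≤ 1 := by
    filter_upwards [hν] with θ hθ
    refine (affinity_le_measure_univ_rpow hL hα.1 hα.2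
      (hν.mono fun x hx => hℓ.lintegral_edensity hx) (hℓ.lintegral_edensity hθ)).trans_eq ?_
    simp
  have hlt : ∫⁻ θ, affinity μ (edensity ℓ) α ν k θ ∂ν ≠ ∞ :=
    ne_top_of_le_ne_top (by simp) (lintegral_mono_ae hle)
  rw [mutualInformation, integral_congr_ae (hν.mono fun θ hθ => hℓ.alphaDivergence_eq hα hν k hθ),
    integral_div, integral_sub (integrable_const _)
      (integrable_toReal_of_lintegral_ne_top ham.aemeasurable hlt),
    integral_toReal ham.aemeasurable (hle.mono fun θ h => h.trans_lt ENNReal.one_lt_top)]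
  simp

end IsRegularModel

end MutualInformation

/-! ### The limit functional. -/

section Functional

variable {𝒴 : Type*} [MeasurableSpace 𝒴] {μ : Measure 𝒴} {d : ℕ}
  {ℓ : EuclideanSpace ℝ (Fin d) → 𝒴 → ℝ} {U Θ : Set (EuclideanSpace ℝ (Fin d))}

/-- The functional that governs the asymptotics of the mutual information. -/
def powerFunctional (Θ : Set (EuclideanSpace ℝ (Fin d))) (α : ℝ)
    (J f : EuclideanSpace ℝ (Fin d) → ℝ) : ℝ :=
  ∫ θ in Θ, f θ * (f θ / J θ) ^ α

lemma priorMeasure_eq (hΘ : MeasurableSet Θ) (f : EuclideanSpace ℝ (Fin d) → ℝ) :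
    priorMeasure Θ f = volume.withDensity fun θ => ENNReal.ofReal (Θ.indicator f θ) := by
  rw [priorMeasure, ← withDensity_indicator hΘ]
  congr 1
  ext θ
  by_cases hθ : θ ∈ Θ <;> simp [hθ]

lemma ae_priorMeasure_mem (hΘ : MeasurableSet Θ) (f : EuclideanSpace ℝ (Fin d) → ℝ) :
    ∀ᵐ θ ∂(priorMeasure Θ f), θ ∈ Θ :=
  (withDensity_absolutelyContinuous _ _).ae_le (ae_restrict_mem hΘ)

namespace IsRegularModel

variable (hℓ : IsRegularModel μ ℓ U Θ)
include hℓ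

/-- Rewrites the integrated asymptotics in terms of $\int_\Theta f(f/J)^\alpha$, passing from
extended non-negative to real integrals. -/
lemma tendsto_rate_mul_affinity_priorMeasure [SigmaFinite μ] (hΘ : IsCompact Θ) {α : ℝ}
    (hα : α ∈ Ioo (0 : ℝ) 1) {f : EuclideanSpace ℝ (Fin d) → ℝ} (hf : IsPriorDensity Θ f) :
    Tendsto (fun k : ℕ => rate d α k *
      (∫⁻ θ, affinity μ (edensity ℓ) α (priorMeasure Θ f) k θ ∂(priorMeasure Θ f)).toReal) atTop
      (𝓝 ((gaussSup d α).toReal * powerFunctional Θ α (jeffreys μ ℓ) f)) := by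
  have hΘm := hΘ.isClosed.measurableSet
  obtain ⟨B, hB0, hB⟩ := hf.locBddAECont.exists_bound hΘ
  have hFm := hf.locBddAECont.measurable_indicator hΘm
  have hvol : volume Θ ≠ 0 := fun h => hf.nonnull (by
    rw [Measure.restrict_eq_zero.2 h]
    rfl)
  have hG := hℓ.gaussSup_ne_top hΘ hα hvol
  have hlim := hℓ.tendsto_rate_mul_lintegral_affinity hΘ hα hFm (B := B)
    (fun θ => indicator_nonneg (fun θ hθ => hf.nonneg θ hθ) θ)
    (fun θ => indicator_le' (fun θ hθ => (le_abs_self _).trans (hB θ hθ)) (fun _ _ => hB0) θ)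
    (fun θ hθ => indicator_of_notMem hθ _)
  have hval : ∫⁻ θ, ENNReal.ofReal (Θ.indicator f θ) ^ α *
        (ENNReal.ofReal (jeffreys μ ℓ θ)⁻¹ ^ α * gaussSup d α)
        ∂(volume.withDensity fun x => ENNReal.ofReal (Θ.indicator f x)) =
      ENNReal.ofReal ((gaussSup d α).toReal * powerFunctional Θ α (jeffreys μ ℓ) f) := by
    have hr := hf.locBddAECont.mul (hf.locBddAECont.rpow_div hℓ.continuousOn_jeffreys
      (fun θ hθ => hℓ.jeffreys_pos hθ) hΘm hα.1.le)
    rw [lintegral_withDensity_eq_lintegral_mul_non_measurable _ hFm.ennreal_ofReal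
      (Eventually.of_forall fun θ => ENNReal.ofReal_lt_top), powerFunctional,
      ENNReal.ofReal_mul ENNReal.toReal_nonneg, ENNReal.ofReal_toReal hG,
      ofReal_integral_eq_lintegral_ofReal (hr.integrableOn hΘ), ← lintegral_const_mul' _ _ hG,
      ← lintegral_indicator hΘm]
    · refine lintegral_congr fun θ => ?_
      by_cases hθ : θ ∈ Θ
      · have hf0 := hf.nonneg θ hθ
        have hJ := hℓ.jeffreys_pos hθ
        simp only [Pi.mul_apply, indicator_of_mem hθ]
        rw [ENNReal.ofReal_mul hf0, ← ENNReal.ofReal_rpow_of_nonneg (by positivity) hα.1.le,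
          div_eq_mul_inv, ENNReal.ofReal_mul hf0, ENNReal.mul_rpow_of_nonneg _ _ hα.1.le]
        ring
      · simp [hθ]
    · filter_upwards [ae_restrict_mem hΘm] with θ hθ
      have hf0 := hf.nonneg θ hθ
      have hJ := hℓ.jeffreys_pos hθ
      positivity
  rw [hval, ← priorMeasure_eq hΘm] at hlim
  have h2 := (ENNReal.tendsto_toReal ENNReal.ofReal_ne_top).comp hlim
  rw [ENNReal.toReal_ofReal] at h2
  · refine h2.congr fun k => ?_
    simp only [Function.comp]
    rw [ENNReal.toReal_mul, ENNReal.toReal_ofReal (rate_nonneg _ _ _)]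
  · refine mul_nonneg ENNReal.toReal_nonneg (setIntegral_nonneg hΘm fun θ hθ => ?_)
    have hf0 := hf.nonneg θ hθ
    have hJ := hℓ.jeffreys_pos hθ
    positivity

/-- The limit of the normalized difference of mutual informations. -/
lemma tendsto_mutualInformation_sub [SigmaFinite μ] (hΘ : IsCompact Θ) {α : ℝ}
    (hα : α ∈ Ioo (0 : ℝ) 1) {f h : EuclideanSpace ℝ (Fin d) → ℝ} (hf : IsPriorDensity Θ f)
    (hh : IsPriorDensity Θ h) [IsProbabilityMeasure (priorMeasure Θ f)]
    [IsProbabilityMeasure (priorMeasure Θ h)] :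
    Tendsto (fun k : ℕ => (k : ℝ) ^ ((d : ℝ) * α / 2) *
      (mutualInformation μ ℓ α (priorMeasure Θ f) k - mutualInformation μ ℓ α (priorMeasure Θ h) k))
      atTop (𝓝 ((gaussSup d α).toReal * (powerFunctional Θ α (jeffreys μ ℓ) h -
        powerFunctional Θ α (jeffreys μ ℓ) f) / (α * (1 - α)))) := by
  have hΘm := hΘ.isClosed.measurableSet
  have hmem : ∀ f : EuclideanSpace ℝ (Fin d) → ℝ, ∀ᵐ θ ∂(priorMeasure Θ f), θ ∈ U := fun f =>
    (ae_priorMeasure_mem hΘm f).mono fun θ hθ => hℓ.subset hθ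
  have h1 := ((hℓ.tendsto_rate_mul_affinity_priorMeasure hΘ hα hh).sub
    (hℓ.tendsto_rate_mul_affinity_priorMeasure hΘ hα hf)).div_const (α * (1 - α))
  rw [← mul_sub] at h1
  refine h1.congr fun k => ?_
  rw [hℓ.mutualInformation_eq hα (hmem f), hℓ.mutualInformation_eq hα (hmem h)]
  unfold rate
  ring

lemma gaussSup_toReal_pos [SigmaFinite μ] (hΘ : IsCompact Θ) {α : ℝ} (hα : α ∈ Ioo (0 : ℝ) 1)
    (hvol : volume Θ ≠ 0) : 0 < (gaussSup d α).toReal :=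
  ENNReal.toReal_pos (gaussSup_ne_zero d α) (hℓ.gaussSup_ne_top hΘ hα hvol)

end IsRegularModel

end Functional

/-! ### Convexity, uniqueness and Lagrange multipliers. -/

section Variational

variable {d p : ℕ} {Θ : Set (EuclideanSpace ℝ (Fin d))} {f h : EuclideanSpace ℝ (Fin d) → ℝ}
  {g : Fin p → EuclideanSpace ℝ (Fin d) → ℝ} {c : Fin p → ℝ} {J : EuclideanSpace ℝ (Fin d) → ℝ}
  {α : ℝ}

lemma mul_div_rpow {x a : ℝ} (hx : 0 ≤ x) (ha : 0 < a) (hα : 0 ≤ α) :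
    x * (x / a) ^ α = a * (x / a) ^ (1 + α) := by
  rw [Real.rpow_one_add' (by positivity) (by linarith), ← mul_assoc, mul_div_cancel₀ _ ha.ne']

/-- Bernoulli's inequality with exponent $1+\alpha$, applied to $y/x$: the convex function lies
above its tangent at `x`. At `x = 0` the tangent is zero. -/
lemma mul_div_rpow_tangent {x y a : ℝ} (hx : 0 ≤ x) (hy : 0 ≤ y) (ha : 0 < a) (hα : 0 < α) :
    x * (x / a) ^ α + (1 + α) * ((x / a) ^ α * (y - x)) ≤ y * (y / a) ^ α := by
  rcases hx.eq_or_lt with rfl | hx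
  · simp only [zero_div, Real.zero_rpow hα.ne']
    have : 0 ≤ y * (y / a) ^ α := by positivity
    linarith
  have h1 := one_add_mul_self_le_rpow_one_add (s := y / x - 1) (p := 1 + α)
    (by linarith [div_nonneg hy hx.le]) (by linarith)
  rw [add_sub_cancel] at h1
  have h2 : y * (y / a) ^ α = (x * (x / a) ^ α) * (y / x) ^ (1 + α) := by
    rw [Real.rpow_one_add' (by positivity) (by linarith), show y / a = (x / a) * (y / x) by
      field_simp, Real.mul_rpow (by positivity) (by positivity)]
    field_simp
  rw [h2]
  calc _ = (x * (x / a) ^ α) * (1 + (1 + α) * (y / x - 1)) := by field_simp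
    _ ≤ _ := by gcongr

lemma mul_div_rpow_midpoint {x y a : ℝ} (hx : 0 ≤ x) (hy : 0 ≤ y) (ha : 0 < a) (hα : 0 < α)
    (hxy : x ≠ y) : (2⁻¹ * (x + y)) * ((2⁻¹ * (x + y)) / a) ^ α <
      2⁻¹ * (x * (x / a) ^ α + y * (y / a) ^ α) := by
  rw [mul_div_rpow hx ha hα.le, mul_div_rpow hy ha hα.le, mul_div_rpow (by positivity) ha hα.le]
  have h1 := (strictConvexOn_rpow (show 1 < 1 + α by linarith)).2 (mem_Ici.2 (div_nonneg hx ha.le))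
    (mem_Ici.2 (div_nonneg hy ha.le)) (fun h => hxy ((div_left_inj' ha.ne').1 h))
    (show (0 : ℝ) < 2⁻¹ by norm_num) (show (0 : ℝ) < 2⁻¹ by norm_num) (by norm_num)
  simp only [smul_eq_mul] at h1
  rw [show 2⁻¹ * (x + y) / a = 2⁻¹ * (x / a) + 2⁻¹ * (y / a) by ring]
  calc _ < a * (2⁻¹ * (x / a) ^ (1 + α) + 2⁻¹ * (y / a) ^ (1 + α)) := by gcongr
    _ = _ := by ring

/-- The concave Bernoulli inequality $(1+s)^\alpha\le1+\alpha s$ gives an exact upper bound with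
quadratic remainder, which replaces differentiation under the integral. -/
lemma mul_div_rpow_one_add_le {x a s : ℝ} (hx : 0 ≤ x) (ha : 0 < a) (hα : α ∈ Ioo (0 : ℝ) 1)
    (hs : -1 ≤ s) : (x * (1 + s)) * ((x * (1 + s)) / a) ^ α ≤
      x * (x / a) ^ α + (1 + α) * (x * (x / a) ^ α * s) + α * (x * (x / a) ^ α * s ^ 2) := by
  have h0 : 0 ≤ 1 + s := by linarith
  have h1 := rpow_one_add_le_one_add_mul_self hs hα.1.le hα.2.le
  rw [mul_div_right_comm, Real.mul_rpow (by positivity) h0]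
  calc _ = x * (x / a) ^ α * (1 + s) * (1 + s) ^ α := by ring
    _ ≤ x * (x / a) ^ α * (1 + s) * (1 + α * s) := by gcongr
    _ = _ := by ring

lemma integral_priorMeasure (hΘ : IsCompact Θ) (hf : IsPriorDensity Θ f)
    (u : EuclideanSpace ℝ (Fin d) → ℝ) :
    ∫ θ, u θ ∂(priorMeasure Θ f) = ∫ θ in Θ, f θ * u θ := by
  have hΘm := hΘ.isClosed.measurableSet
  rw [priorMeasure, integral_withDensity_eq_integral_toReal_smul₀
    (hf.locBddAECont.aestronglyMeasurable hΘm).aemeasurable.ennreal_ofReal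
    (Eventually.of_forall fun _ => ENNReal.ofReal_lt_top)]
  refine setIntegral_congr_fun hΘm fun θ hθ => ?_
  simp [ENNReal.toReal_ofReal (hf.nonneg θ hθ)]

lemma priorMeasure_univ (hΘ : IsCompact Θ) (hf : IsPriorDensity Θ f) :
    priorMeasure Θ f univ = ENNReal.ofReal (∫ θ in Θ, f θ) := by
  rw [priorMeasure, withDensity_apply _ MeasurableSet.univ, Measure.restrict_univ,
    ofReal_integral_eq_lintegral_ofReal (hf.locBddAECont.integrableOn hΘ)]
  filter_upwards [ae_restrict_mem hΘ.isClosed.measurableSet] with θ hθ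
  exact hf.nonneg θ hθ

lemma mem_constrainedPriors_iff (hΘ : IsCompact Θ) (hf : IsPriorDensity Θ f) :
    priorMeasure Θ f ∈ constrainedPriors Θ g c ↔
      ∫ θ in Θ, f θ = 1 ∧ ∀ j, ∫ θ in Θ, f θ * g j θ = c j := by
  have h1 : IsProbabilityMeasure (priorMeasure Θ f) ↔ ∫ θ in Θ, f θ = 1 := by
    rw [isProbabilityMeasure_iff, priorMeasure_univ hΘ hf, ENNReal.ofReal_eq_one]
  rw [← h1]
  simp_rw [← integral_priorMeasure hΘ hf]
  exact ⟨fun h => h.2, fun h => ⟨⟨f, hf, rfl⟩, h⟩⟩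

/-- `f` minimizes the limit functional among the densities of the constrained priors. -/
def IsMinimizer (Θ : Set (EuclideanSpace ℝ (Fin d))) (α : ℝ) (J : EuclideanSpace ℝ (Fin d) → ℝ)
    (g : Fin p → EuclideanSpace ℝ (Fin d) → ℝ) (c : Fin p → ℝ)
    (f : EuclideanSpace ℝ (Fin d) → ℝ) : Prop :=
  ∀ h, IsPriorDensity Θ h → priorMeasure Θ h ∈ constrainedPriors Θ g c →
    powerFunctional Θ α J f ≤ powerFunctional Θ α J h

lemma IsPriorDensity.of_integral_eq_one (hf : IsLocBddAECont Θ f) (h0 : ∀ θ ∈ Θ, 0 ≤ f θ)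
    (h1 : ∫ θ in Θ, f θ = 1) : IsPriorDensity Θ f where
  locBddAECont := hf
  nonneg := h0
  nonnull h := by
    rw [integral_congr_ae h] at h1
    simp at h1

variable (hΘ : IsCompact Θ) (hJ : ContinuousOn J Θ) (hJ0 : ∀ θ ∈ Θ, 0 < J θ)
  (hα : α ∈ Ioo (0 : ℝ) 1)
include hΘ hJ hJ0 hα

lemma integrableOn_mul_rpow_div (hf : IsLocBddAECont Θ f) :
    IntegrableOn (fun θ => f θ * (f θ / J θ) ^ α) Θ :=
  (hf.mul (hf.rpow_div hJ hJ0 hΘ.isClosed.measurableSet hα.1.le)).integrableOn hΘ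

/-- The midpoint of two minimizers satisfies the constraints. Minimality gives the convexity gap a
non-positive integral, while strict convexity makes it positive wherever the two densities differ.
-/
lemma IsMinimizer.ae_eq (hg : ∀ j, IsLocBddAECont Θ (g j))
    (hf : IsPriorDensity Θ f) (hfP : priorMeasure Θ f ∈ constrainedPriors Θ g c)
    (hh : IsPriorDensity Θ h) (hhP : priorMeasure Θ h ∈ constrainedPriors Θ g c)
    (hfm : IsMinimizer Θ α J g c f) (hhm : IsMinimizer Θ α J g c h) :
    f =ᵐ[volume.restrict Θ] h := by
  have hΘm := hΘ.isClosed.measurableSet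
  obtain ⟨hf1, hfc⟩ := (mem_constrainedPriors_iff hΘ hf).1 hfP
  obtain ⟨hh1, hhc⟩ := (mem_constrainedPriors_iff hΘ hh).1 hhP
  set m : EuclideanSpace ℝ (Fin d) → ℝ := fun θ => 2⁻¹ * (f θ + h θ) with hm
  have hmR : IsLocBddAECont Θ m :=
    (IsLocBddAECont.const 2⁻¹).mul (hf.locBddAECont.add hh.locBddAECont)
  have hm1 : ∫ θ in Θ, m θ = 1 := by
    rw [hm, integral_const_mul, integral_add (hf.locBddAECont.integrableOn hΘ)
      (hh.locBddAECont.integrableOn hΘ), hf1, hh1]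
    norm_num
  have hmd : IsPriorDensity Θ m := .of_integral_eq_one hmR (fun θ hθ => by
    have := hf.nonneg θ hθ
    have := hh.nonneg θ hθ
    positivity) hm1
  have hmP : priorMeasure Θ m ∈ constrainedPriors Θ g c := by
    refine (mem_constrainedPriors_iff hΘ hmd).2 ⟨hm1, fun j => ?_⟩
    have : ∀ θ, m θ * g j θ = 2⁻¹ * (f θ * g j θ + h θ * g j θ) := fun θ => by
      rw [hm]
      ring
    simp_rw [this]
    rw [integral_const_mul, integral_add ((hf.locBddAECont.mul (hg j)).integrableOn hΘ)
      ((hh.locBddAECont.mul (hg j)).integrableOn hΘ), hfc, hhc]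
    ring
  have hif := integrableOn_mul_rpow_div hΘ hJ hJ0 hα hf.locBddAECont
  have hih := integrableOn_mul_rpow_div hΘ hJ hJ0 hα hh.locBddAECont
  have him := integrableOn_mul_rpow_div hΘ hJ hJ0 hα hmR
  set D : EuclideanSpace ℝ (Fin d) → ℝ := fun θ =>
    2⁻¹ * (f θ * (f θ / J θ) ^ α + h θ * (h θ / J θ) ^ α) - m θ * (m θ / J θ) ^ α with hD
  have hstrict : ∀ θ ∈ Θ, f θ ≠ h θ → 0 < D θ := fun θ hθ hne => sub_pos.2
    (mul_div_rpow_midpoint (hf.nonneg θ hθ) (hh.nonneg θ hθ) (hJ0 θ hθ) hα.1 hne)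
  have hDnn : ∀ θ ∈ Θ, 0 ≤ D θ := fun θ hθ => by
    rcases eq_or_ne (f θ) (h θ) with he | hne
    · have : m θ = f θ := by
        rw [hm]
        dsimp only
        rw [← he]
        ring
      rw [hD]
      dsimp only
      rw [this, ← he]
      exact le_of_eq (by ring)
    · exact (hstrict θ hθ hne).le
  have hDi : IntegrableOn D Θ := ((hif.add hih).const_mul _).sub him
  have hDint : ∫ θ in Θ, D θ ≤ 0 := by
    have hs : IntegrableOn (fun θ => 2⁻¹ * (f θ * (f θ / J θ) ^ α + h θ * (h θ / J θ) ^ α)) Θ :=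
      (hif.add hih).const_mul _
    rw [hD, integral_sub hs him, integral_const_mul, integral_add hif hih]
    have h1 := hfm m hmd hmP
    have h2 := hhm m hmd hmP
    unfold powerFunctional at h1 h2
    linarith
  have hD0 := (setIntegral_eq_zero_iff_of_nonneg_ae
    ((ae_restrict_mem hΘm).mono fun θ hθ => hDnn θ hθ) hDi).1
    (le_antisymm hDint (setIntegral_nonneg hΘm hDnn))
  filter_upwards [hD0, ae_restrict_mem hΘm] with θ h1 hθ
  by_contra hne
  exact (hstrict θ hθ hne).ne' h1

/-- A positive minimizer is a critical point for multiplicative perturbations. -/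
lemma IsMinimizer.integral_eq_zero (hg : ∀ j, IsLocBddAECont Θ (g j))
    (hf : IsPriorDensity Θ f) (hfP : priorMeasure Θ f ∈ constrainedPriors Θ g c)
    (hfm : IsMinimizer Θ α J g c f) {φ : EuclideanSpace ℝ (Fin d) → ℝ} (hφ : IsLocBddAECont Θ φ)
    (hφ1 : ∫ θ in Θ, f θ * φ θ = 0) (hφg : ∀ j, ∫ θ in Θ, f θ * g j θ * φ θ = 0) :
    ∫ θ in Θ, f θ * (f θ / J θ) ^ α * φ θ = 0 := by
  have hΘm := hΘ.isClosed.measurableSet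
  obtain ⟨hf1, hfc⟩ := (mem_constrainedPriors_iff hΘ hf).1 hfP
  have hfR := hf.locBddAECont
  have hu := hfR.mul (hfR.rpow_div hJ hJ0 hΘm hα.1.le)
  -- One sign suffices, as the hypotheses are invariant under $\varphi\mapsto-\varphi$.
  have key : ∀ φ : EuclideanSpace ℝ (Fin d) → ℝ, IsLocBddAECont Θ φ → ∫ θ in Θ, f θ * φ θ = 0 →
      (∀ j, ∫ θ in Θ, f θ * g j θ * φ θ = 0) → 0 ≤ ∫ θ in Θ, f θ * (f θ / J θ) ^ α * φ θ := by
    intro φ hφ hφ1 hφg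
    obtain ⟨N, hN0, hN⟩ := hφ.exists_bound hΘ
    set a := ∫ θ in Θ, f θ * (f θ / J θ) ^ α * φ θ with ha
    set b := ∫ θ in Θ, f θ * (f θ / J θ) ^ α * φ θ ^ 2 with hb
    have hφ2 : IsLocBddAECont Θ fun θ => f θ * (f θ / J θ) ^ α * φ θ ^ 2 :=
      hu.mul (hφ.comp_continuous (continuous_pow 2))
    have hstep : ∀ t : ℝ, 0 < t → t * N ≤ 1 → 0 ≤ (1 + α) * (t * a) + α * (t ^ 2 * b) := by
      intro t ht htN
      have hs : ∀ θ ∈ Θ, -1 ≤ t * φ θ := fun θ hθ => by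
        have h1 := (abs_le.1 (hN θ hθ)).1
        nlinarith
      set m : EuclideanSpace ℝ (Fin d) → ℝ := fun θ => f θ * (1 + t * φ θ) with hm
      have hmR : IsLocBddAECont Θ m :=
        hfR.mul ((IsLocBddAECont.const 1).add ((IsLocBddAECont.const t).mul hφ))
      have hm1 : ∫ θ in Θ, m θ = 1 := by
        have : ∀ θ, m θ = f θ + t * (f θ * φ θ) := fun θ => by rw [hm]; ring
        simp_rw [this]
        rw [integral_add (hfR.integrableOn hΘ) (((hfR.mul hφ).integrableOn hΘ).const_mul _),
          integral_const_mul, hφ1, hf1]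
        ring
      have hmd : IsPriorDensity Θ m := .of_integral_eq_one hmR (fun θ hθ =>
        mul_nonneg (hf.nonneg θ hθ) (by linarith [hs θ hθ])) hm1
      have hmP : priorMeasure Θ m ∈ constrainedPriors Θ g c := by
        refine (mem_constrainedPriors_iff hΘ hmd).2 ⟨hm1, fun j => ?_⟩
        have : ∀ θ, m θ * g j θ = f θ * g j θ + t * (f θ * g j θ * φ θ) := fun θ => by
          rw [hm]; ring
        simp_rw [this]
        rw [integral_add ((hfR.mul (hg j)).integrableOn hΘ)
          ((((hfR.mul (hg j)).mul hφ).integrableOn hΘ).const_mul _), integral_const_mul, hφg, hfc]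
        ring
      have hmin := hfm m hmd hmP
      have hi0 := hu.integrableOn hΘ
      have hi1 := (((hu.mul hφ).integrableOn hΘ).const_mul t).const_mul (1 + α)
      have hi2 := ((hφ2.integrableOn hΘ).const_mul (t ^ 2)).const_mul α
      have hle : powerFunctional Θ α J m ≤
          powerFunctional Θ α J f + (1 + α) * (t * a) + α * (t ^ 2 * b) := by
        have hi3 : IntegrableOn (fun θ => f θ * (f θ / J θ) ^ α +
            (1 + α) * (t * (f θ * (f θ / J θ) ^ α * φ θ))) Θ := hi0.add hi1
        rw [ha, hb, powerFunctional, powerFunctional, ← integral_const_mul, ← integral_const_mul,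
          ← integral_const_mul, ← integral_const_mul, ← integral_add hi0 hi1,
          ← integral_add hi3 hi2]
        refine setIntegral_mono_on (integrableOn_mul_rpow_div hΘ hJ hJ0 hα hmR)
          (hi3.add hi2) hΘm fun θ hθ => ?_
        refine (mul_div_rpow_one_add_le (hf.nonneg θ hθ) (hJ0 θ hθ) hα (hs θ hθ)).trans_eq ?_
        ring
      linarith
    have hb0 : 0 ≤ b := setIntegral_nonneg hΘm fun θ hθ => by
      have h1 := hf.nonneg θ hθ
      have h2 := hJ0 θ hθ
      positivity
    by_contra! hneg
    -- The first bound keeps $1+t\varphi\ge0$. The second gives $tb\le-a/2$, so that the variation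
    -- divided by $t$ is at most $(1+\alpha/2)a<0$.
    set t : ℝ := min (1 / (N + 1)) (-a / (2 * (b + 1))) with ht
    have ht0 : 0 < t := lt_min (by positivity) (div_pos (by linarith) (by positivity))
    have htN : t * N ≤ 1 := by
      have h1 : t ≤ 1 / (N + 1) := min_le_left _ _
      rw [le_div_iff₀ (by positivity)] at h1
      linarith
    have htb : t * b ≤ -a / 2 := by
      have h1 : t ≤ -a / (2 * (b + 1)) := min_le_right _ _
      rw [le_div_iff₀ (by positivity)] at h1
      linarith
    have h1 := hstep t ht0 htN
    have h2 : 0 ≤ (1 + α) * a + α * (t * b) := by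
      refine nonneg_of_mul_nonneg_right (a := t) ?_ ht0
      linarith
    nlinarith [hα.1]
  have h1 := key φ hφ hφ1 hφg
  have h2 := key (fun θ => -φ θ) (hφ.comp_continuous continuous_neg)
    (by simp_rw [mul_neg]; rw [integral_neg, hφ1, neg_zero])
    (fun j => by simp_rw [mul_neg]; rw [integral_neg, hφg, neg_zero])
  simp_rw [mul_neg] at h2
  rw [integral_neg] at h2
  linarith

/-- The Lagrange multipliers of a positive minimizer. -/
lemma IsMinimizer.exists_multipliers (hg : ∀ j, IsLocBddAECont Θ (g j))
    (hf : IsPriorDensity Θ f) (hfP : priorMeasure Θ f ∈ constrainedPriors Θ g c)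
    (hfm : IsMinimizer Θ α J g c f) (hpos : ∀ᵐ θ ∂(volume.restrict Θ), 0 < f θ) :
    ∃ (lam₀ : ℝ) (lam : Fin p → ℝ), ∀ᵐ θ ∂(volume.restrict Θ),
      (f θ / J θ) ^ α = lam₀ + ∑ j, lam j * g j θ := by
  have hΘm := hΘ.isClosed.measurableSet
  have hfR := hf.locBddAECont
  have hu := hfR.rpow_div hJ hJ0 hΘm hα.1.le
  let W : Submodule ℝ (EuclideanSpace ℝ (Fin d) → ℝ) :=
    { carrier := {φ | IsLocBddAECont Θ φ}
      add_mem' := fun h1 h2 => h1.add h2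
      zero_mem' := .const 0
      smul_mem' := fun a _ h => (IsLocBddAECont.const a).mul h }
  let T (w : EuclideanSpace ℝ (Fin d) → ℝ) (hw : IsLocBddAECont Θ w) : W →ₗ[ℝ] ℝ :=
    { toFun := fun φ => ∫ θ in Θ, w θ * φ.1 θ
      map_add' := fun φ ψ => by
        rw [← integral_add ((hw.mul φ.2).integrableOn hΘ) ((hw.mul ψ.2).integrableOn hΘ)]
        exact integral_congr_ae (Eventually.of_forall fun θ => mul_add _ _ _)
      map_smul' := fun a φ => by
        rw [RingHom.id_apply, smul_eq_mul, ← integral_const_mul]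
        exact integral_congr_ae (Eventually.of_forall fun θ => mul_left_comm _ _ _) }
  let L : Option (Fin p) → W →ₗ[ℝ] ℝ := fun i =>
    i.elim (T f hfR) fun j => T (fun θ => f θ * g j θ) (hfR.mul (hg j))
  -- A linear functional vanishing on the common kernel of finitely many others is a combination of
  -- them; the coefficients are the multipliers.
  have hspan := mem_span_of_iInf_ker_le_ker (L := L)
    (K := T (fun θ => f θ * (f θ / J θ) ^ α) (hfR.mul hu)) (by
      intro φ hφ
      rw [Submodule.mem_iInf] at hφ
      exact hfm.integral_eq_zero hΘ hJ hJ0 hα hg hf hfP φ.2 (hφ none) fun j => hφ (some j))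
  obtain ⟨lam, hlam⟩ := (Submodule.mem_span_range_iff_exists_fun ℝ).1 hspan
  rw [Fintype.sum_option] at hlam
  refine ⟨lam none, fun j => lam (some j), ?_⟩
  have hv : IsLocBddAECont Θ fun θ => lam none + ∑ j, lam (some j) * g j θ :=
    (IsLocBddAECont.const _).add (.sum _ fun j => (IsLocBddAECont.const _).mul (hg j))
  set φ : EuclideanSpace ℝ (Fin d) → ℝ := fun θ =>
    (f θ / J θ) ^ α + -1 * (lam none + ∑ j, lam (some j) * g j θ) with hφ
  have hφR : IsLocBddAECont Θ φ := hu.add ((IsLocBddAECont.const _).mul hv)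
  have happ := LinearMap.congr_fun hlam (⟨φ, hφR⟩ : W)
  simp only [LinearMap.add_apply, LinearMap.sum_apply, LinearMap.smul_apply, smul_eq_mul] at happ
  change lam none * (∫ θ in Θ, f θ * φ θ) + ∑ j, lam (some j) * (∫ θ in Θ, f θ * g j θ * φ θ) =
    ∫ θ in Θ, f θ * (f θ / J θ) ^ α * φ θ at happ
  -- The multiplier identity is tested against its own defect `φ`, which is admissible since the
  -- regularity class is stable under these operations.
  have hsq : ∫ θ in Θ, f θ * φ θ ^ 2 = 0 := by
    have hi1 := (((hfR.mul hφR).integrableOn hΘ).const_mul (lam none))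
    have hi2 := fun j => (((hfR.mul (hg j)).mul hφR).integrableOn hΘ).const_mul (lam (some j))
    have hi3 : IntegrableOn (fun θ => ∑ j, lam (some j) * (f θ * g j θ * φ θ)) Θ :=
      integrable_finsetSum _ fun j _ => hi2 j
    have hi4 := (((hfR.mul hu).mul hφR).integrableOn hΘ)
    have hi5 : IntegrableOn (fun θ => lam none * (f θ * φ θ) +
      ∑ j, lam (some j) * (f θ * g j θ * φ θ)) Θ := hi1.add hi3
    have : ∀ θ, f θ * φ θ ^ 2 = f θ * (f θ / J θ) ^ α * φ θ -
        (lam none * (f θ * φ θ) + ∑ j, lam (some j) * (f θ * g j θ * φ θ)) := by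
      intro θ
      have h1 : ∑ j, lam (some j) * (f θ * g j θ * φ θ) =
          f θ * φ θ * ∑ j, lam (some j) * g j θ := by
        rw [Finset.mul_sum]
        exact Finset.sum_congr rfl fun j _ => by ring
      rw [h1, sq]
      nth_rewrite 2 [hφ]
      ring
    simp_rw [this]
    rw [integral_sub hi4 hi5, integral_add hi1 hi3, integral_finsetSum _ fun j _ => hi2 j,
      integral_const_mul]
    simp_rw [integral_const_mul]
    rw [happ, sub_self]
  have hz := (setIntegral_eq_zero_iff_of_nonneg_ae
    ((ae_restrict_mem hΘm).mono fun θ hθ => mul_nonneg (hf.nonneg θ hθ) (sq_nonneg (φ θ)))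
    ((hfR.mul (hφR.comp_continuous (continuous_pow 2))).integrableOn hΘ)).1 hsq
  -- From $f\varphi^2=0$ a.e., positivity of `f` is what allows the conclusion $\varphi=0$.
  filter_upwards [hz, hpos] with θ h1 h2
  have h3 : φ θ = 0 := by
    have h4 : f θ * φ θ ^ 2 = 0 := h1
    exact pow_eq_zero_iff two_ne_zero |>.1 ((mul_eq_zero.1 h4).resolve_left h2.ne')
  rw [hφ] at h3
  dsimp only at h3
  linarith

/-- On the constraint set, the integral of $(f/J)^\alpha$ against any admissible density is
$\lambda_0+\sum_j\lambda_jc_j$. The first-order term of the tangent inequality therefore integrates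
to zero. -/
lemma isMinimizer_of_multipliers (hg : ∀ j, IsLocBddAECont Θ (g j))
    (hf : IsPriorDensity Θ f) (hfP : priorMeasure Θ f ∈ constrainedPriors Θ g c)
    {lam₀ : ℝ} {lam : Fin p → ℝ}
    (hlam : ∀ᵐ θ ∂(volume.restrict Θ), (f θ / J θ) ^ α = lam₀ + ∑ j, lam j * g j θ) :
    IsMinimizer Θ α J g c f := by
  intro h hh hhP
  have hΘm := hΘ.isClosed.measurableSet
  obtain ⟨hf1, hfc⟩ := (mem_constrainedPriors_iff hΘ hf).1 hfP
  obtain ⟨hh1, hhc⟩ := (mem_constrainedPriors_iff hΘ hh).1 hhP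
  have hfR := hf.locBddAECont
  have hhR := hh.locBddAECont
  have hlin : ∀ q : EuclideanSpace ℝ (Fin d) → ℝ, IsLocBddAECont Θ q → ∫ θ in Θ, q θ = 1 →
      (∀ j, ∫ θ in Θ, q θ * g j θ = c j) →
      ∫ θ in Θ, (f θ / J θ) ^ α * q θ = lam₀ + ∑ j, lam j * c j := by
    intro q hq hq1 hqc
    have hi1 := (hq.integrableOn hΘ).const_mul lam₀
    have hi2 := fun j => ((hq.mul (hg j)).integrableOn hΘ).const_mul (lam j)
    have hi3 : IntegrableOn (fun θ => ∑ j, lam j * (q θ * g j θ)) Θ :=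
      integrable_finsetSum _ fun j _ => hi2 j
    rw [integral_congr_ae (g := fun θ => lam₀ * q θ + ∑ j, lam j * (q θ * g j θ)),
      integral_add hi1 hi3, integral_finsetSum _ fun j _ => hi2 j, integral_const_mul, hq1, mul_one]
    · simp_rw [integral_const_mul, hqc]
    · filter_upwards [hlam] with θ hθ
      rw [hθ, add_mul, Finset.sum_mul]
      congr 1
      exact Finset.sum_congr rfl fun j _ => by ring
  have hu := hfR.rpow_div hJ hJ0 hΘm hα.1.le
  have hif := integrableOn_mul_rpow_div hΘ hJ hJ0 hα hfR
  have hih := integrableOn_mul_rpow_div hΘ hJ hJ0 hα hhR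
  have hi1 := (hu.mul hhR).integrableOn hΘ
  have hi2 := (hu.mul hfR).integrableOn hΘ
  have hi3 : IntegrableOn (fun θ => (1 + α) * ((f θ / J θ) ^ α * h θ - (f θ / J θ) ^ α * f θ)) Θ :=
    (hi1.sub hi2).const_mul _
  have hle : ∫ θ in Θ, (f θ * (f θ / J θ) ^ α +
      (1 + α) * ((f θ / J θ) ^ α * h θ - (f θ / J θ) ^ α * f θ)) ≤
        ∫ θ in Θ, h θ * (h θ / J θ) ^ α :=
    setIntegral_mono_on (hif.add hi3) hih hΘm fun θ hθ => by
      rw [← mul_sub]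
      exact mul_div_rpow_tangent (hf.nonneg θ hθ) (hh.nonneg θ hθ) (hJ0 θ hθ) hα.1
  rw [integral_add hif hi3, integral_const_mul, integral_sub hi1 hi2, hlin h hhR hh1 hhc,
    hlin f hfR hf1 hfc, sub_self, mul_zero, add_zero] at hle
  exact hle

end Variational

/-! ### Reference priors as minimizers, and the theorem. -/

section ReferencePrior

variable {𝒴 : Type*} [MeasurableSpace 𝒴] {μ : Measure 𝒴} {d p : ℕ}
  {ℓ : EuclideanSpace ℝ (Fin d) → 𝒴 → ℝ} {U Θ : Set (EuclideanSpace ℝ (Fin d))}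
  {g : Fin p → EuclideanSpace ℝ (Fin d) → ℝ} {c : Fin p → ℝ} {α : ℝ}
  {f : EuclideanSpace ℝ (Fin d) → ℝ}

/-- The relatively open sets between consecutive members cover the compact `Θ`; by monotonicity a
finite subcover lies in a single member. -/
lemma IsOpenlyIncreasing.exists_eq (hΘ : IsCompact Θ) {K : ℕ → Set (EuclideanSpace ℝ (Fin d))}
    (hK : IsOpenlyIncreasing Θ K) (hsub : ∀ i, K i ⊆ Θ) (hU : (⋃ i, K i) = Θ) : ∃ i, K i = Θ := by
  obtain ⟨hmono, i₀, V, hV⟩ := hK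
  choose O hO using fun i (hi : i ≥ i₀) => (hV i hi).1
  obtain ⟨t, ht⟩ := hΘ.elim_finite_subcover (fun n : ℕ => O (i₀ + n) (Nat.le_add_right _ _))
    (fun n => (hO _ _).1) (fun θ hθ => by
      rw [← hU] at hθ
      obtain ⟨i, hi⟩ := mem_iUnion.1 hθ
      have h1 : θ ∈ V (i₀ + i) := (hV _ (Nat.le_add_right _ _)).2.1 (hmono (Nat.le_add_left _ _) hi)
      rw [(hO (i₀ + i) (Nat.le_add_right _ _)).2] at h1
      exact mem_iUnion.2 ⟨i, h1.1⟩)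
  refine ⟨i₀ + t.sup id + 1, (hsub _).antisymm fun θ hθ => ?_⟩
  obtain ⟨n, hn, hθn⟩ := mem_iUnion₂.1 (ht hθ)
  have h2 : θ ∈ V (i₀ + n) := by
    rw [(hO (i₀ + n) (Nat.le_add_right _ _)).2]
    exact ⟨hθn, hθ⟩
  have h3 : n ≤ t.sup id := Finset.le_sup (f := id) hn
  exact hmono (by omega) ((hV _ (Nat.le_add_right _ _)).2.2 h2)

lemma cond_self_of_ae_mem {ν : Measure (EuclideanSpace ℝ (Fin d))} [IsProbabilityMeasure ν]
    (hν : ∀ᵐ θ ∂ν, θ ∈ Θ) : ProbabilityTheory.cond ν Θ = ν := by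
  have h1 : ν Θ = 1 := prob_compl_eq_zero_iff₀ ?_ |>.1 (mem_ae_iff.1 hν)
  · rw [ProbabilityTheory.cond, h1, inv_one, one_smul, Measure.restrict_eq_self_of_ae_mem hν]
  · exact NullMeasurableSet.of_compl (NullMeasurableSet.of_null (mem_ae_iff.1 hν))

namespace IsRegularModel

variable (hℓ : IsRegularModel μ ℓ U Θ)
include hℓ

/-- On a compact parameter set, reference priors are the minimizers of the limit functional. -/
lemma isReferencePrior_iff [SigmaFinite μ] (hΘ : IsCompact Θ) (hα : α ∈ Ioo (0 : ℝ) 1)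
    (hf : IsPriorDensity Θ f) (hfP : priorMeasure Θ f ∈ constrainedPriors Θ g c) :
    IsReferencePrior μ ℓ α Θ (constrainedPriors Θ g c) (priorMeasure Θ f) ↔
      IsMinimizer Θ α (jeffreys μ ℓ) g c f := by
  have hΘm := hΘ.isClosed.measurableSet
  have hvol : volume Θ ≠ 0 := fun h => hf.nonnull (by
    rw [Measure.restrict_eq_zero.2 h]
    rfl)
  have hG := hℓ.gaussSup_toReal_pos hΘ hα hvol
  have hαα : 0 < α * (1 - α) := mul_pos hα.1 (by linarith [hα.2])
  have hcond : ∀ h : EuclideanSpace ℝ (Fin d) → ℝ, priorMeasure Θ h ∈ constrainedPriors Θ g c →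
      ProbabilityTheory.cond (priorMeasure Θ h) Θ = priorMeasure Θ h := fun h hh => by
    have := hh.2.1
    exact cond_self_of_ae_mem (ae_priorMeasure_mem hΘm h)
  have hone : ∀ h : EuclideanSpace ℝ (Fin d) → ℝ, priorMeasure Θ h ∈ constrainedPriors Θ g c →
      0 < priorMeasure Θ h Θ := fun h hh => by
    have := hh.2.1
    have h1 := measure_eq_measure_of_null_sdiff (subset_univ Θ)
      (by rw [← compl_eq_univ_sdiff]; exact mem_ae_iff.1 (ae_priorMeasure_mem hΘm h))
    rw [h1, measure_univ]
    exact one_pos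
  have hprobf := hfP.2.1
  constructor
  · rintro ⟨-, K, hK, hKc, hKU, hlim⟩ h hh hhP
    have hprobh := hhP.2.1
    -- At an index whose set is all of `Θ`, conditioning changes nothing and the defining limit
    -- compares the priors themselves.
    obtain ⟨i, hi⟩ := hK.exists_eq hΘ (fun i => (hKc i).2.1) hKU
    obtain ⟨L, hL0, hL⟩ := hlim i _ hhP (by rw [hi]; exact hone h hhP)
    rw [hi, hcond f hfP, hcond h hhP] at hL
    have h1 := tendsto_nhds_unique hL (hℓ.tendsto_mutualInformation_sub hΘ hα hf hh)
    rw [h1] at hL0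
    have h2 := mul_nonneg hL0 hαα.le
    rw [div_mul_cancel₀ _ hαα.ne'] at h2
    exact sub_nonneg.1 (nonneg_of_mul_nonneg_right h2 hG)
  · intro hmin
    -- The constant sequence `Θ` is openly increasing, because `Θ` is open relative to itself.
    refine ⟨hfP, fun _ => Θ, ⟨monotone_const, 0, fun _ => Θ, fun _ _ =>
      ⟨⟨univ, isOpen_univ, (univ_inter Θ).symm⟩, subset_rfl, subset_rfl⟩⟩,
      fun _ => ⟨hΘ, subset_rfl, hone f hfP⟩, iUnion_const Θ, fun _ ν' hν' _ => ?_⟩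
    obtain ⟨h, hh, rfl⟩ := hν'.1
    have hprobh := hν'.2.1
    rw [hcond f hfP, hcond h hν']
    refine ⟨_, ?_, hℓ.tendsto_mutualInformation_sub hΘ hα hf hh⟩
    exact div_nonneg (mul_nonneg hG.le (sub_nonneg.2 (hmin h hh hν'))) hαα.le

end IsRegularModel

end ReferencePrior

end RefPrior

end

theorem mainTheorem2 {𝒴 : Type*} [MeasurableSpace 𝒴] {d p : ℕ} (hd : 1 ≤ d)
    (μ : Measure 𝒴) [SigmaFinite μ] (ℓ : EuclideanSpace ℝ (Fin d) → 𝒴 → ℝ)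
    (U Θ : Set (EuclideanSpace ℝ (Fin d))) (hΘ : IsCompact Θ)
    (hℓ : RefPrior.IsRegularModel μ ℓ U Θ)
    (α : ℝ) (hα : α ∈ Ioo (0 : ℝ) 1)
    (g : Fin p → EuclideanSpace ℝ (Fin d) → ℝ) (hg : ∀ j, RefPrior.IsLocBddAECont Θ (g j))
    (hlin : LinearIndependent ℝ fun j : Fin (p + 1) =>
      Θ.domRestrict (Fin.cons (α := fun _ => EuclideanSpace ℝ (Fin d) → ℝ) (fun _ => 1) g j))
    (c : Fin p → ℝ) :
    (∀ ν₁ ν₂ : Measure (EuclideanSpace ℝ (Fin d)),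
      RefPrior.IsReferencePrior μ ℓ α Θ (RefPrior.constrainedPriors Θ g c) ν₁ →
      RefPrior.IsReferencePrior μ ℓ α Θ (RefPrior.constrainedPriors Θ g c) ν₂ → ν₁ = ν₂) ∧
    (∀ f : EuclideanSpace ℝ (Fin d) → ℝ, RefPrior.IsPriorDensity Θ f →
      RefPrior.IsReferencePrior μ ℓ α Θ (RefPrior.constrainedPriors Θ g c)
        (RefPrior.priorMeasure Θ f) →
      (∀ᵐ θ ∂(volume.restrict Θ), 0 < f θ) → RefPrior.HasConstrainedForm μ ℓ α Θ g f) ∧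
    (∀ f : EuclideanSpace ℝ (Fin d) → ℝ, RefPrior.IsPriorDensity Θ f →
      RefPrior.priorMeasure Θ f ∈ RefPrior.constrainedPriors Θ g c →
      RefPrior.HasConstrainedForm μ ℓ α Θ g f →
      RefPrior.IsReferencePrior μ ℓ α Θ (RefPrior.constrainedPriors Θ g c)
        (RefPrior.priorMeasure Θ f)) := by
  have hΘm := hΘ.isClosed.measurableSet
  have hJ := hℓ.continuousOn_jeffreys
  have hJ0 : ∀ θ ∈ Θ, 0 < RefPrior.jeffreys μ ℓ θ := fun θ hθ => hℓ.jeffreys_pos hθ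
  have hα0 : α ≠ 0 := hα.1.ne'
  refine ⟨fun ν₁ ν₂ h₁ h₂ => ?_, fun f hf hfr hpos => ?_, fun f hf hfP hform => ?_⟩
  · obtain ⟨f₁, hf₁, rfl⟩ := h₁.1.1
    obtain ⟨f₂, hf₂, rfl⟩ := h₂.1.1
    have hae := RefPrior.IsMinimizer.ae_eq hΘ hJ hJ0 hα hg hf₁ h₁.1 hf₂ h₂.1
      ((hℓ.isReferencePrior_iff hΘ hα hf₁ h₁.1).1 h₁)
      ((hℓ.isReferencePrior_iff hΘ hα hf₂ h₂.1).1 h₂)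
    exact withDensity_congr_ae (hae.mono fun θ hθ => congrArg ENNReal.ofReal hθ)
  · obtain ⟨lam₀, lam, hlam⟩ := RefPrior.IsMinimizer.exists_multipliers hΘ hJ hJ0 hα hg hf hfr.1
      ((hℓ.isReferencePrior_iff hΘ hα hf hfr.1).1 hfr) hpos
    refine ⟨lam₀, lam, ?_⟩
    filter_upwards [hlam, ae_restrict_mem hΘm] with θ h1 hθ
    have h2 : 0 ≤ f θ / RefPrior.jeffreys μ ℓ θ := div_nonneg (hf.nonneg θ hθ) (hJ0 θ hθ).le
    rw [← h1, one_div, Real.rpow_rpow_inv h2 hα0, mul_div_cancel₀ _ (hJ0 θ hθ).ne']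
    exact ⟨Real.rpow_nonneg h2 α, rfl⟩
  · obtain ⟨lam₀, lam, hlam⟩ := hform
    refine (hℓ.isReferencePrior_iff hΘ hα hf hfP).2 (RefPrior.isMinimizer_of_multipliers hΘ hJ hJ0
      hα hg hf hfP (lam₀ := lam₀) (lam := lam) ?_)
    filter_upwards [hlam, ae_restrict_mem hΘm] with θ h1 hθ
    rw [h1.2, mul_div_cancel_left₀ _ (hJ0 θ hθ).ne', one_div, Real.rpow_inv_rpow h1.1 hα0]
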